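/- All locally compact groups are Hausdorff and second countable. A matched pair (m.p.) $G_1,G_2\subset G$ consists of closed subgroups $G_1,G_2$ of a locally compact group $G$ with $G_1\cap G_2=\{e\}$ and such that $G\setminus G_1G_2$ has Haar measure zero. A Polish $G$-module is an abelian Polish group with a continuous action of $G$ by group automorphisms; morphisms are continuous $G$-equivariant homomorphisms. For a standard Borel space $X$ with a measure class, $\mathrm L(X,A)$ is the group of Borel maps $X\to A$ modulo almost everywhere equality, with the topology of the metric $\int\rho(F,H)\,d\mu$ ($\mu$ a finite measure in the class, $\rho$ a bounded complete metric on $A$). On $\mathrm L(G,A)$ the group $G$ acts by $(x\cdot F)(y)=x\cdot F(x^{-1}y)$. For $p,q\ge 0$ let $\Gamma_{pq}$ be the space of matrices $X=(x_{ij})_{0\le i\le p,\,0\le j\le q}$ over $G$ with $x_{00}=e$, $x_{ij}^{-1}x_{kj}\in G_1$ and $x_{ij}^{-1}x_{ik}\in G_2$, with the measure class obtained from the Haar class of $G_1^p\times G_2^q$ under the injective map that picks out the left column and the top row; thus $\Gamma_{p0}=G_1^p$, $\Gamma_{0q}=G_2^q$. Let $\partial^h_i X$ (resp. $\partial^v_jX$)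 be obtained by deleting column $i$ (resp. row $j$) and multiplying all entries on the left by the inverse of the remaining upper left entry $x$ of $X$, and put $(d^h_iF)(X)=x\cdot F(\partial^h_iX)$, $(d^v_jF)(X)=x\cdot F(\partial^v_jX)$, $d^h=\sum_i(-1)^id^h_i$, $d^v=\sum_j(-1)^jd^v_j$. Let $D^n(A)=\bigoplus_{p+q=n}\mathrm L(\Gamma_{pq},A)$ with $d=d^h+(-1)^qd^v$ on $\mathrm L(\Gamma_{pq},A)$, let $K^n(A)=\mathrm L(G_1^n,A)\oplus\mathrm L(G_2^n,A)$ with the group coboundaries, and let $J:D^n(A)\to K^n(A)$ be the projection to the components $(n,0)$ and $(0,n)$ (so $J(a)=a\oplus a$ for $n=0$). The Kac cohomology $H^n(\mathrm{m.p.},A)$ is the $n$-th cohomology of the mapping cone $M^n(A)=D^{n+1}(A)\oplus K^n(A)$, $n\ge -1$, $d(F,H)=(dF,-dH+JF)$ (with $K^{-1}(A)=0$). **Corollary.** Let $G_1,G_2\subset G$ be a matched pair. (1) For every Polish $G$-module $A$, $\mathrm L(G,A)$ is a Polish $G$-module and $H^n(\mathrm{m.p.},\mathrm L(G,A))=0$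 for all $n\ge 1$. (2) The Kac cohomology satisfies the Buchsbaum criterion on Polish $G$-modules: (a) every short exact sequence $0\to A\to B\to C\to 0$ of Polish $G$-modules gives rise to a long exact sequence $$0\to H^0(\mathrm{m.p.},A)\to H^0(\mathrm{m.p.},B)\to H^0(\mathrm{m.p.},C)\to H^1(\mathrm{m.p.},A)\to H^1(\mathrm{m.p.},B)\to\cdots$$ whose connecting homomorphisms are natural with respect to morphisms of short exact sequences; (b) (effaceability) for every $n\ge 1$, every Polish $G$-module $A$ and every $\alpha\in H^n(\mathrm{m.p.},A)$ there is a short exact sequence $0\to A\to B\to C\to 0$ of Polish $G$-modules such that $\alpha$ has image $0$ in $H^n(\mathrm{m.p.},B)$. -/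

import Mathlib

open MeasureTheory

universe u v w

noncomputable section

set_option linter.unusedSectionVars false

/-- A matched pair of locally compact groups: closed subgroups `G₁, G₂` of `G` with `G₁ ∩ G₂ = {e}` such that `G \ G₁G₂` has Haar measure zero. -/
structure MatchedPair (G : Type u) [Group G] [TopologicalSpace G] [IsTopologicalGroup G]
    [LocallyCompactSpace G] [MeasurableSpace G] [BorelSpace G] where
  G₁ : Subgroup G
  G₂ : Subgroup G
  isClosed₁ : IsClosed (G₁ : Set G)
  isClosed₂ : IsClosed (G₂ : Set G)
  inf_eq_bot : G₁ ⊓ G₂ = ⊥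
  null_compl : (Measure.haar : Measure G) {x : G | ∃ g ∈ G₁, ∃ s ∈ G₂, g * s = x}ᶜ = 0

namespace MatchedPair

section Basic

variable {G : Type u} [Group G] [TopologicalSpace G] [IsTopologicalGroup G]
  [LocallyCompactSpace G] [SecondCountableTopology G] [T2Space G] [MeasurableSpace G] [BorelSpace G]
  (M : MatchedPair G)

instance locallyCompactSpace₁ : LocallyCompactSpace M.G₁ :=
  M.isClosed₁.isClosedEmbedding_subtypeVal.locallyCompactSpace

instance locallyCompactSpace₂ : LocallyCompactSpace M.G₂ :=
  M.isClosed₂.isClosedEmbedding_subtypeVal.locallyCompactSpace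

instance secondCountable₁ : SecondCountableTopology M.G₁ :=
  TopologicalSpace.Subtype.secondCountableTopology (M.G₁ : Set G)

instance secondCountable₂ : SecondCountableTopology M.G₂ :=
  TopologicalSpace.Subtype.secondCountableTopology (M.G₂ : Set G)

/-- The matched pair `G₂, G₁ ⊂ G`. -/
def swap : MatchedPair G where
  G₁ := M.G₂
  G₂ := M.G₁
  isClosed₁ := M.isClosed₂
  isClosed₂ := M.isClosed₁
  inf_eq_bot := by rw [inf_comm]; exact M.inf_eq_bot
  null_compl := by
    rw [← measure_inv_null, ← M.null_compl]
    congr 1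
    ext x
    simp only [Set.mem_inv, Set.mem_compl_iff, Set.mem_ofPred_eq, not_iff_not]
    constructor
    · rintro ⟨s, hs, g, hg, h⟩
      exact ⟨g⁻¹, inv_mem hg, s⁻¹, inv_mem hs, by rw [← mul_inv_rev, h, inv_inv]⟩
    · rintro ⟨g, hg, s, hs, h⟩
      exact ⟨s⁻¹, inv_mem hs, g⁻¹, inv_mem hg, by rw [← mul_inv_rev, h]⟩

theorem eq_one_of_mem {x : G} (h₁ : x ∈ M.G₁) (h₂ : x ∈ M.G₂) : x = 1 := by
  have : x ∈ M.G₁ ⊓ M.G₂ := ⟨h₁, h₂⟩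
  rwa [M.inf_eq_bot, Subgroup.mem_bot] at this

theorem polishSpace_group (G : Type u) [Group G] [TopologicalSpace G] [IsTopologicalGroup G]
    [LocallyCompactSpace G] [SecondCountableTopology G] [T2Space G] : PolishSpace G := by
  let : UniformSpace G := IsTopologicalGroup.rightUniformSpace G
  have : IsRightUniformGroup G := ⟨rfl⟩
  have : CompleteSpace G := IsRightUniformGroup.completeSpace_of_weaklyLocallyCompactSpace
  have : (uniformity G).IsCountablyGenerated := by
    rw [uniformity_eq_comap_nhds_one]
    infer_instance
  have h := TopologicalSpace.IsCompletelyMetrizableSpace.of_completeSpace_metrizable (X := G)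
  exact @PolishSpace.mk G _ inferInstance h

theorem ae_mem_mul : ∀ᵐ x ∂(Measure.haar : Measure G), ∃ g ∈ M.G₁, ∃ s ∈ M.G₂, g * s = x :=
  M.null_compl

theorem null_iff {B : Set G} (hB : MeasurableSet B) :
    (Measure.haar : Measure G) B = 0 ↔
      ∀ᵐ z ∂((Measure.haar : Measure M.G₁).prod (Measure.haar : Measure M.G₂)),
        (z.1 : G) * (z.2 : G)⁻¹ ∉ B := by
  set π := (Measure.haar : Measure M.G₁).prod (Measure.haar : Measure M.G₂) with hπ
  have : SFinite π := by rw [hπ]; infer_instance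
  have : Measure.IsMulLeftInvariant π := by rw [hπ]; infer_instance
  have : NeZero π := by rw [hπ]; infer_instance
  have c₁ : ∀ z : M.G₁ × M.G₂, (∀ᵐ y ∂(Measure.haar : Measure G),
      (z.1 : G) * y * (z.2 : G)⁻¹ ∉ B) ↔ (Measure.haar : Measure G) B = 0 := by
    intro z
    rw [ae_iff, ← measure_mul_right_null _ (s := B) (z.2 : G)⁻¹,
      ← measure_preimage_mul _ (z.1 : G) (_ ⁻¹' B)]
    simp [Set.preimage]
  have c₂ : ∀ y : G, (∃ g ∈ M.G₁, ∃ s ∈ M.G₂, g * s = y) →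
      ((∀ᵐ z ∂π, (z.1 : G) * y * (z.2 : G)⁻¹ ∉ B) ↔ ∀ᵐ z ∂π, (z.1 : G) * (z.2 : G)⁻¹ ∉ B) := by
    rintro y ⟨g, hg, s, hs, rfl⟩
    have := measure_mul_right_null π (s := {z | ¬ (z.1 : G) * (z.2 : G)⁻¹ ∉ B})
      ((⟨g, hg⟩, ⟨s, hs⟩⁻¹) : M.G₁ × M.G₂)
    rw [ae_iff, ae_iff, ← this]
    simp [Set.preimage, mul_assoc]
  have hm : MeasurableSet {x : (M.G₁ × M.G₂) × G | (x.1.1 : G) * x.2 * (x.1.2 : G)⁻¹ ∉ B} := by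
    refine (MeasurableSet.compl hB).preimage (f := fun x : (M.G₁ × M.G₂) × G =>
      (x.1.1 : G) * x.2 * (x.1.2 : G)⁻¹) ?_
    fun_prop
  have key := Measure.ae_ae_comm (μ := π) (ν := (Measure.haar : Measure G))
    (p := fun z y => (z.1 : G) * y * (z.2 : G)⁻¹ ∉ B) hm
  constructor
  · intro h
    have h1 := key.1 (Filter.Eventually.of_forall fun z => (c₁ z).2 h)
    obtain ⟨y, hy, hy'⟩ := (h1.and M.ae_mem_mul).exists
    exact (c₂ y hy').1 hy
  · intro h
    have h1 := key.2 (M.ae_mem_mul.mono fun y hy => (c₂ y hy).2 h)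
    obtain ⟨z, hz⟩ := h1.exists
    exact (c₁ z).1 hz


theorem measurableEmbedding_mul :
    MeasurableEmbedding fun z : M.G₁ × M.G₂ => (z.1 : G) * (z.2 : G) := by
  have := polishSpace_group M.G₁
  have := polishSpace_group M.G₂
  have hinj : Function.Injective fun z : M.G₁ × M.G₂ => (z.1 : G) * (z.2 : G) := by
    rintro ⟨g, s⟩ ⟨g', s'⟩ h
    have h' : (g' : G)⁻¹ * g = s' * (s : G)⁻¹ := by
      simp only at h
      rw [inv_mul_eq_iff_eq_mul, ← mul_assoc, eq_mul_inv_iff_mul_eq, h]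
    have h1 : (g' : G)⁻¹ * g = 1 := M.eq_one_of_mem
      (M.G₁.mul_mem (M.G₁.inv_mem g'.2) g.2) (h' ▸ M.G₂.mul_mem s'.2 (M.G₂.inv_mem s.2))
    have hg : g = g' := Subtype.ext (inv_mul_eq_one.1 h1).symm
    rw [h1] at h'
    have hs : s = s' := Subtype.ext (mul_inv_eq_one.1 h'.symm).symm
    rw [hg, hs]
  exact Continuous.measurableEmbedding (by fun_prop) hinj

theorem exists_factor : ∃ P : G → M.G₁, Measurable P ∧
    ∀ (g : M.G₁) (s : M.G₂), P ((g : G) * (s : G)) = g := by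
  obtain ⟨P, hP, hP'⟩ := M.measurableEmbedding_mul.exists_measurable_extend (g := Prod.fst)
    measurable_fst fun _ => ⟨(1 : M.G₁)⟩
  exact ⟨P, hP, fun g s => congrFun hP' (g, s)⟩

theorem measurableSet_mul : MeasurableSet {x : G | ∃ g ∈ M.G₁, ∃ s ∈ M.G₂, g * s = x} := by
  have h : {x : G | ∃ g ∈ M.G₁, ∃ s ∈ M.G₂, g * s = x}
      = Set.range fun z : M.G₁ × M.G₂ => (z.1 : G) * (z.2 : G) := by
    ext x
    constructor
    · rintro ⟨g, hg, s, hs, rfl⟩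
      exact ⟨(⟨g, hg⟩, ⟨s, hs⟩), rfl⟩
    · rintro ⟨⟨g, s⟩, rfl⟩
      exact ⟨g, g.2, s, s.2, rfl⟩
  rw [h]
  exact M.measurableEmbedding_mul.measurableSet_range

theorem qmp_factor {P : G → M.G₁} (hP : Measurable P)
    (hP' : ∀ (g : M.G₁) (s : M.G₂), P ((g : G) * (s : G)) = g) (x : G) :
    Measure.QuasiMeasurePreserving (fun a : M.G₁ => P (x * a)) Measure.haar Measure.haar := by
  have hm : Measurable fun a : M.G₁ => P (x * a) := by fun_prop
  refine ⟨hm, Measure.AbsolutelyContinuous.mk fun N hN hN0 => ?_⟩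
  rw [Measure.map_apply hm hN]
  set R : Set G := {x : G | ∃ g ∈ M.G₁, ∃ s ∈ M.G₂, g * s = x} with hR
  have hRm : MeasurableSet R := M.measurableSet_mul
  set B : Set G := (P ⁻¹' N ∩ R) ∪ Rᶜ with hB
  have hBm : MeasurableSet B := ((hP hN).inter hRm).union hRm.compl
  have hRB : ∀ (y : G) (t : M.G₂), y * (t : G)⁻¹ ∈ R ↔ y ∈ R := by
    intro y t
    constructor
    · rintro ⟨g, hg, s, hs, h⟩
      exact ⟨g, hg, s * t, mul_mem hs t.2, by rw [← mul_assoc, h, inv_mul_cancel_right]⟩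
    · rintro ⟨g, hg, s, hs, h⟩
      exact ⟨g, hg, s * (t : G)⁻¹, mul_mem hs (inv_mem t.2), by rw [← mul_assoc, h]⟩
  have hPB : ∀ (y : G) (t : M.G₂), y ∈ R → P (y * (t : G)⁻¹) = P y := by
    rintro _ t ⟨g, hg, s, hs, rfl⟩
    have h1 := hP' ⟨g, hg⟩ ⟨s, hs⟩
    have h2 := hP' ⟨g, hg⟩ (⟨s, hs⟩ * t⁻¹)
    simp only [Subgroup.coe_mul, Subgroup.coe_inv, ← mul_assoc] at h1 h2
    rw [h1, h2]
  have hB0 : (Measure.haar : Measure G) B = 0 := by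
    refine measure_union_null ?_ M.null_compl
    rw [M.null_iff ((hP hN).inter hRm)]
    have h0 : ∀ᵐ g ∂(Measure.haar : Measure M.G₁), g ∉ N := measure_eq_zero_iff_ae_notMem.1 hN0
    have := (Measure.quasiMeasurePreserving_fst (μ := (Measure.haar : Measure M.G₁))
      (ν := (Measure.haar : Measure M.G₂))).ae h0
    filter_upwards [this] with z hz h
    apply hz
    have := hP' z.1 (z.2)⁻¹
    simp only [Subgroup.coe_inv] at this
    rw [← this]
    exact h.1
  have hxB : (Measure.haar : Measure G) ((fun y => x * y) ⁻¹' B) = 0 := by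
    rw [measure_preimage_mul]; exact hB0
  rw [M.null_iff (hBm.preimage (by fun_prop))] at hxB
  have h2 := Measure.ae_ae_of_ae_prod hxB
  rw [measure_eq_zero_iff_ae_notMem]
  filter_upwards [h2] with a ha hn
  obtain ⟨t, ht⟩ := ha.exists
  apply ht
  simp only [Set.mem_preimage, ← mul_assoc] at hn ⊢
  by_cases h : x * (a : G) ∈ R
  · exact Or.inl ⟨by rw [Set.mem_preimage, hPB _ _ h]; exact hn, (hRB _ _).2 h⟩
  · exact Or.inr fun h' => h ((hRB _ _).1 h')

theorem qmp_pi {X Y : Type*} [MeasurableSpace X] [MeasurableSpace Y] {μ : Measure X}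
    {ν : Measure Y} [SigmaFinite μ] [SigmaFinite ν] {f : X → Y}
    (hf : Measure.QuasiMeasurePreserving f μ ν) (n : ℕ) :
    Measure.QuasiMeasurePreserving (fun (x : Fin n → X) i => f (x i))
      (Measure.pi fun _ => μ) (Measure.pi fun _ => ν) := by
  have := hf.measurable
  induction n with
  | zero =>
    refine ⟨by fun_prop, ?_⟩
    have hm : Measurable (fun (x : Fin 0 → X) (i : Fin 0) => f (x i)) := by fun_prop
    rw [Measure.pi_of_empty, Measure.pi_of_empty]
    have := Measure.map_dirac' hm (fun a => isEmptyElim a)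
    rw [this]
    convert Measure.AbsolutelyContinuous.rfl
  | succ n ih =>
    have e1 := (measurePreserving_piFinSuccAbove (fun _ : Fin (n + 1) => μ) 0).quasiMeasurePreserving
    have e2 := ((measurePreserving_piFinSuccAbove (fun _ : Fin (n + 1) => ν) 0).symm).quasiMeasurePreserving
    have := e2.comp ((QuasiMeasurePreserving.prodMap hf ih).comp e1)
    convert this using 1
    funext x i
    refine Fin.cases ?_ (fun j => ?_) i
    · simp [MeasurableEquiv.piFinSuccAbove, Fin.insertNthEquiv]
    · simp [MeasurableEquiv.piFinSuccAbove, Fin.insertNthEquiv, Fin.tail]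

theorem qmp_drop {X : Type*} [MeasurableSpace X] {μ : Measure X} [SigmaFinite μ] {n : ℕ}
    (j : Fin (n + 1)) :
    Measure.QuasiMeasurePreserving (fun (x : Fin (n + 1) → X) i => x (j.succAbove i))
      (Measure.pi fun _ => μ) (Measure.pi fun _ => μ) :=
  Measure.quasiMeasurePreserving_snd.comp
    (measurePreserving_piFinSuccAbove (fun _ : Fin (n + 1) => μ) j).quasiMeasurePreserving

theorem qmp_change {P : G → M.G₁} (hP : Measurable P)
    (hP' : ∀ (g : M.G₁) (s : M.G₂), P ((g : G) * (s : G)) = g) (p q : ℕ) :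
    Measure.QuasiMeasurePreserving
      (fun z : (Fin p → M.G₁) × (Fin (q + 1) → M.G₂) =>
        ((fun i => P ((z.2 0 : G)⁻¹ * z.1 i), fun j => (z.2 0)⁻¹ * z.2 (Fin.succ j)) :
          (Fin p → M.G₁) × (Fin q → M.G₂)))
      ((Measure.pi fun _ => Measure.haar).prod (Measure.pi fun _ => Measure.haar))
      ((Measure.pi fun _ => Measure.haar).prod (Measure.pi fun _ => Measure.haar)) := by
  have e1 := ((MeasurePreserving.id (Measure.pi fun _ : Fin p => (Measure.haar : Measure M.G₁))).prod
    (measurePreserving_piFinSuccAbove (fun _ : Fin (q + 1) => (Measure.haar : Measure M.G₂))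
      0)).quasiMeasurePreserving
  have e2 := ((measurePreserving_prodAssoc (Measure.pi fun _ : Fin p => (Measure.haar : Measure M.G₁))
    (Measure.haar : Measure M.G₂)
    (Measure.pi fun _ : Fin q => (Measure.haar : Measure M.G₂))).symm).quasiMeasurePreserving
  have e3 := ((Measure.measurePreserving_swap
      (μ := Measure.pi fun _ : Fin p => (Measure.haar : Measure M.G₁))
      (ν := (Measure.haar : Measure M.G₂))).prod
    (MeasurePreserving.id
      (Measure.pi fun _ : Fin q => (Measure.haar : Measure M.G₂)))).quasiMeasurePreserving
  have e4 := (measurePreserving_prodAssoc (Measure.haar : Measure M.G₂)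
    (Measure.pi fun _ : Fin p => (Measure.haar : Measure M.G₁))
    (Measure.pi fun _ : Fin q => (Measure.haar : Measure M.G₂))).quasiMeasurePreserving
  have e5 : Measure.QuasiMeasurePreserving
      (fun y : M.G₂ × ((Fin p → M.G₁) × (Fin q → M.G₂)) =>
        ((fun i => P ((y.1 : G)⁻¹ * y.2.1 i), fun j => y.1⁻¹ * y.2.2 j) :
          (Fin p → M.G₁) × (Fin q → M.G₂)))
      ((Measure.haar : Measure M.G₂).prod
        ((Measure.pi fun _ => Measure.haar).prod (Measure.pi fun _ => Measure.haar)))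
      ((Measure.pi fun _ => Measure.haar).prod (Measure.pi fun _ => Measure.haar)) := by
    refine QuasiMeasurePreserving.prod_of_right (by fun_prop) (Filter.Eventually.of_forall fun s => ?_)
    exact QuasiMeasurePreserving.prodMap (qmp_pi (M.qmp_factor hP hP' (s : G)⁻¹) p)
      (qmp_pi (measurePreserving_mul_left Measure.haar s⁻¹).quasiMeasurePreserving q)
  exact e5.comp (e4.comp (e3.comp (e2.comp e1)))


/-- The space `Γ_{pq}` of `p × q`-grids whose horizontal edges lie in `G₂`, whose vertical edges
lie in `G₁`, and in which every square commutes. A grid is recorded by its `(p+1) × (q+1)`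
vertices `x_{ij} ∈ G`, normalized by `x_{00} = e`; its vertical edges are
`g_{ij} = x_{i-1,j}⁻¹ x_{ij} ∈ G₁` and its horizontal edges `s_{ij} = x_{i,j-1}⁻¹ x_{ij} ∈ G₂`.
In particular `Γ_{p0}` is `G₁ ^ p` and `Γ_{0q}` is `G₂ ^ q`, and `Γ_{00}` is one point. -/
def Γ (p q : ℕ) : Type u :=
  {X : Fin (p + 1) → Fin (q + 1) → G // X 0 0 = 1 ∧
    (∀ i k j, (X i j)⁻¹ * X k j ∈ M.G₁) ∧ (∀ i j k, (X i j)⁻¹ * X i k ∈ M.G₂)}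

instance (p q : ℕ) : TopologicalSpace (M.Γ p q) := instTopologicalSpaceSubtype

instance (p q : ℕ) : MeasurableSpace (M.Γ p q) := Subtype.instMeasurableSpace

instance (p q : ℕ) : BorelSpace (M.Γ p q) := Subtype.borelSpace _

instance (p q : ℕ) : SecondCountableTopology (M.Γ p q) :=
  TopologicalSpace.Subtype.secondCountableTopology _

theorem polishSpace_Γ (p q : ℕ) : PolishSpace (M.Γ p q) := by
  have := polishSpace_group G
  have h : IsClosed {X : Fin (p + 1) → Fin (q + 1) → G | X 0 0 = 1 ∧
      (∀ i k j, (X i j)⁻¹ * X k j ∈ M.G₁) ∧ (∀ i j k, (X i j)⁻¹ * X i k ∈ M.G₂)} := by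
    have e : {X : Fin (p + 1) → Fin (q + 1) → G | X 0 0 = 1 ∧
        (∀ i k j, (X i j)⁻¹ * X k j ∈ M.G₁) ∧ (∀ i j k, (X i j)⁻¹ * X i k ∈ M.G₂)} =
        {X | X 0 0 = 1} ∩ ((⋂ i, ⋂ k, ⋂ j, {X | (X i j)⁻¹ * X k j ∈ (M.G₁ : Set G)}) ∩
          ⋂ i, ⋂ j, ⋂ k, {X | (X i j)⁻¹ * X i k ∈ (M.G₂ : Set G)}) := by
      ext X; simp
    rw [e]
    refine IsClosed.inter (isClosed_eq (by fun_prop) (by fun_prop)) (IsClosed.inter ?_ ?_)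
    · exact isClosed_iInter fun i => isClosed_iInter fun k => isClosed_iInter fun j =>
        M.isClosed₁.preimage (by fun_prop)
    · exact isClosed_iInter fun i => isClosed_iInter fun k => isClosed_iInter fun j =>
        M.isClosed₂.preimage (by fun_prop)
  exact h.polishSpace

/-- Picking out the left column and the top row: `X ↦ ((x_{i0})_{1≤i≤p}, (x_{0j})_{1≤j≤q})`.
Here `x_{i0} = g_{10} ⋯ g_{i0}` and `x_{0j} = s_{01} ⋯ s_{0j}`; passing between a sequence of group
elements and its partial products preserves the Haar measure class, so one may equally pick out
the edges of the column and of the row. -/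
def coord (p q : ℕ) (X : M.Γ p q) : (Fin p → M.G₁) × (Fin q → M.G₂) :=
  (fun i => ⟨X.1 i.succ 0, by simpa [X.2.1] using X.2.2.1 0 i.succ 0⟩,
    fun j => ⟨X.1 0 j.succ, by simpa [X.2.1] using X.2.2.2 0 0 j.succ⟩)

/-- The measure on `Γ_{pq}` that corresponds to Haar measure on `G₁ ^ p × G₂ ^ q` under the
injective map `coord` (a measurable embedding). Only its measure class matters. -/
def μ (p q : ℕ) : Measure (M.Γ p q) :=
  Measure.comap (M.coord p q)
    ((Measure.pi fun _ => Measure.haar).prod (Measure.pi fun _ => Measure.haar))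

theorem continuous_coord (p q : ℕ) : Continuous (M.coord p q) := by
  have h : ∀ i j, Continuous fun X : M.Γ p q => X.1 i j := fun i j =>
    (continuous_apply_apply i j).comp continuous_subtype_val
  refine Continuous.prodMk (continuous_pi fun i => ?_) (continuous_pi fun j => ?_)
  · exact (h _ _).subtype_mk _
  · exact (h _ _).subtype_mk _

theorem injective_coord (p q : ℕ) : Function.Injective (M.coord p q) := by
  intro X Y h
  have h0 : ∀ i, X.1 i 0 = Y.1 i 0 := by
    intro i
    refine Fin.cases ?_ (fun i => ?_) i
    · rw [X.2.1, Y.2.1]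
    · exact congrArg Subtype.val (congrFun (congrArg Prod.fst h) i)
  have h1 : ∀ j, X.1 0 j = Y.1 0 j := by
    intro j
    refine Fin.cases ?_ (fun j => ?_) j
    · rw [X.2.1, Y.2.1]
    · exact congrArg Subtype.val (congrFun (congrArg Prod.snd h) j)
  apply Subtype.ext
  funext i j
  have hA := M.G₁.mul_mem (M.G₁.inv_mem (X.2.2.1 0 i j)) (h1 j ▸ Y.2.2.1 0 i j)
  have hB := M.G₂.mul_mem (M.G₂.inv_mem (X.2.2.2 i 0 j)) (h0 i ▸ Y.2.2.2 i 0 j)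
  simp only [mul_inv_rev, inv_inv, mul_assoc, mul_inv_cancel_left] at hA hB
  exact inv_mul_eq_one.1 (M.eq_one_of_mem hA hB)

theorem measurableEmbedding_coord (p q : ℕ) : MeasurableEmbedding (M.coord p q) := by
  have := M.polishSpace_Γ p q
  exact (M.continuous_coord p q).measurableEmbedding (M.injective_coord p q)

theorem qmp_of_coord {p q p' q' : ℕ} {φ : M.Γ p q → M.Γ p' q'} (hφ : Continuous φ)
    {Φ : (Fin p → M.G₁) × (Fin q → M.G₂) → (Fin p' → M.G₁) × (Fin q' → M.G₂)}
    (hΦ : Measure.QuasiMeasurePreserving Φ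
      ((Measure.pi fun _ => Measure.haar).prod (Measure.pi fun _ => Measure.haar))
      ((Measure.pi fun _ => Measure.haar).prod (Measure.pi fun _ => Measure.haar)))
    (h : ∀ X, M.coord p' q' (φ X) = Φ (M.coord p q X)) :
    Measure.QuasiMeasurePreserving φ (M.μ p q) (M.μ p' q') := by
  refine ⟨hφ.measurable, Measure.AbsolutelyContinuous.mk fun N hN hN0 => ?_⟩
  rw [Measure.map_apply hφ.measurable hN]
  unfold μ at hN0 ⊢
  rw [(M.measurableEmbedding_coord _ _).comap_apply] at hN0 ⊢
  refine measure_mono_null ?_ (hΦ.preimage_null hN0)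
  rintro _ ⟨X, hX, rfl⟩
  exact ⟨φ X, hX, h X⟩

/-- The horizontal face `∂ʰ_i`, which removes the `i`-th column; on normalized vertices
one then multiplies by the inverse of the new upper left vertex (which is `e` unless `i = 0`). -/
def faceH {p q : ℕ} (i : Fin (q + 2)) (X : M.Γ p (q + 1)) : M.Γ p q :=
  ⟨fun k l => (X.1 0 (i.succAbove 0))⁻¹ * X.1 k (i.succAbove l), by simp,
    fun k k' l => by simpa [mul_assoc] using X.2.2.1 k k' (i.succAbove l),
    fun k l l' => by simpa [mul_assoc] using X.2.2.2 k (i.succAbove l) (i.succAbove l')⟩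

/-- The vertical face `∂ᵛ_j`, which removes the `j`-th row. -/
def faceV {p q : ℕ} (j : Fin (p + 2)) (X : M.Γ (p + 1) q) : M.Γ p q :=
  ⟨fun k l => (X.1 (j.succAbove 0) 0)⁻¹ * X.1 (j.succAbove k) l, by simp,
    fun k k' l => by simpa [mul_assoc] using X.2.2.1 (j.succAbove k) (j.succAbove k') l,
    fun k l l' => by simpa [mul_assoc] using X.2.2.2 (j.succAbove k) l l'⟩

theorem continuous_vertex {p q : ℕ} (k : Fin (p + 1)) (l : Fin (q + 1)) :
    Continuous fun X : M.Γ p q => X.1 k l :=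
  (continuous_apply_apply k l).comp continuous_subtype_val

theorem continuous_faceH {p q : ℕ} (i : Fin (q + 2)) :
    Continuous (M.faceH i : M.Γ p (q + 1) → M.Γ p q) :=
  Continuous.subtype_mk (continuous_pi fun _ => continuous_pi fun _ =>
    (M.continuous_vertex _ _).inv.mul (M.continuous_vertex _ _)) _

theorem continuous_faceV {p q : ℕ} (j : Fin (p + 2)) :
    Continuous (M.faceV j : M.Γ (p + 1) q → M.Γ p q) :=
  Continuous.subtype_mk (continuous_pi fun _ => continuous_pi fun _ =>
    (M.continuous_vertex _ _).inv.mul (M.continuous_vertex _ _)) _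

theorem qmp_faceH {p q : ℕ} (i : Fin (q + 2)) :
    Measure.QuasiMeasurePreserving (M.faceH i) (M.μ p (q + 1)) (M.μ p q) := by
  refine Fin.cases ?_ (fun i => ?_) i
  · obtain ⟨P, hP, hP'⟩ := M.exists_factor
    refine M.qmp_of_coord (M.continuous_faceH _) (M.qmp_change hP hP' p q) fun X => ?_
    refine Prod.ext (funext fun k => ?_) (funext fun l => ?_)
    · have h1 : (X.1 0 1)⁻¹ * X.1 k.succ 1 ∈ M.G₁ := X.2.2.1 0 k.succ 1
      have h2 : (X.1 k.succ 1)⁻¹ * X.1 k.succ 0 ∈ M.G₂ := X.2.2.2 k.succ 1 0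
      have := hP' ⟨_, h1⟩ ⟨_, h2⟩
      simp only [mul_assoc, mul_inv_cancel_left] at this
      exact this.symm
    · apply Subtype.ext
      simp [coord, faceH]
  · refine M.qmp_of_coord (M.continuous_faceH _)
      (QuasiMeasurePreserving.prodMap (Measure.QuasiMeasurePreserving.id _) (qmp_drop i))
      fun X => ?_
    refine Prod.ext (funext fun k => ?_) (funext fun l => ?_) <;> apply Subtype.ext <;>
      simp [coord, faceH, X.2.1]

theorem qmp_faceV {p q : ℕ} (j : Fin (p + 2)) :
    Measure.QuasiMeasurePreserving (M.faceV j) (M.μ (p + 1) q) (M.μ p q) := by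
  refine Fin.cases ?_ (fun j => ?_) j
  · obtain ⟨Q, hQ, hQ'⟩ := M.swap.exists_factor
    have h := M.swap.qmp_change hQ hQ' q p
    have h' := (Measure.measurePreserving_swap.quasiMeasurePreserving.comp h).comp
      (Measure.measurePreserving_swap.quasiMeasurePreserving)
    refine M.qmp_of_coord (M.continuous_faceV _) h' fun X => ?_
    refine Prod.ext (funext fun k => ?_) (funext fun l => ?_)
    · apply Subtype.ext
      simp only [coord, faceV, swap]
      rfl
    · have h1 : (X.1 1 0)⁻¹ * X.1 1 l.succ ∈ M.G₂ := X.2.2.2 1 0 l.succ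
      have h2 : (X.1 1 l.succ)⁻¹ * X.1 0 l.succ ∈ M.G₁ := X.2.2.1 1 0 l.succ
      have := hQ' ⟨_, h1⟩ ⟨_, h2⟩
      simp only [mul_assoc, mul_inv_cancel_left] at this
      exact this.symm
  · refine M.qmp_of_coord (M.continuous_faceV _)
      (QuasiMeasurePreserving.prodMap (qmp_drop j) (Measure.QuasiMeasurePreserving.id _))
      fun X => ?_
    refine Prod.ext (funext fun k => ?_) (funext fun l => ?_) <;> apply Subtype.ext <;>
      simp [coord, faceV, X.2.1]

end Basic

section Cochains

variable {G : Type u} [Group G] [TopologicalSpace G] [IsTopologicalGroup G]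
  [LocallyCompactSpace G] [SecondCountableTopology G] [T2Space G] [MeasurableSpace G] [BorelSpace G]
  (M : MatchedPair G)
  (A : Type v) [AddCommGroup A] [TopologicalSpace A] [IsTopologicalAddGroup A]
  [DistribMulAction G A] [ContinuousSMul G A]
  {B : Type w} [AddCommGroup B] [TopologicalSpace B] [IsTopologicalAddGroup B]
  [DistribMulAction G B] [ContinuousSMul G B]

/-- `L(Γ_{pq}, A)`: classes of (strongly) measurable functions modulo almost everywhere equality.
For Polish `A`, strong measurability is Borel measurability. -/
abbrev L (p q : ℕ) : Type (max u v) := M.Γ p q →ₘ[M.μ p q] A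

/-- The `i`-th horizontal face on cochains, `(dʰ_i F)(X) = x_{0,k} • F(∂ʰ_i X)`, where `x_{0,k}`
is the upper left vertex that remains after removal of column `i`: it is `s_{01}` for `i = 0`
and `e` for `i ≥ 1`. -/
def dHFace {p q : ℕ} (i : Fin (q + 2)) : M.L A p q →+ M.L A p (q + 1) :=
  AddMonoidHom.mk' (fun F =>
    AEEqFun.comp₂ (fun (x : G) (a : A) => x • a) continuous_smul
      (AEEqFun.mk (fun X : M.Γ p (q + 1) => X.1 0 (i.succAbove 0))
        (M.continuous_vertex _ _).aestronglyMeasurable)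
      (F.compQuasiMeasurePreserving (M.faceH i) (M.qmp_faceH i))) <| by
    intro F F'
    refine AEEqFun.induction_on₂ F F' fun f hf f' hf' => ?_
    simp only [AEEqFun.mk_add_mk, AEEqFun.compQuasiMeasurePreserving_mk]
    exact AEEqFun.mk_eq_mk.2 (Filter.Eventually.of_forall fun X => smul_add _ _ _)

/-- The `j`-th vertical face on cochains, `(dᵛ_j F)(X) = x_{k,0} • F(∂ᵛ_j X)`, where `x_{k,0}`
is the upper left vertex that remains after removal of row `j`: it is `g_{10}` for `j = 0`
and `e` for `j ≥ 1`. -/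
def dVFace {p q : ℕ} (j : Fin (p + 2)) : M.L A p q →+ M.L A (p + 1) q :=
  AddMonoidHom.mk' (fun F =>
    AEEqFun.comp₂ (fun (x : G) (a : A) => x • a) continuous_smul
      (AEEqFun.mk (fun X : M.Γ (p + 1) q => X.1 (j.succAbove 0) 0)
        (M.continuous_vertex _ _).aestronglyMeasurable)
      (F.compQuasiMeasurePreserving (M.faceV j) (M.qmp_faceV j))) <| by
    intro F F'
    refine AEEqFun.induction_on₂ F F' fun f hf f' hf' => ?_
    simp only [AEEqFun.mk_add_mk, AEEqFun.compQuasiMeasurePreserving_mk]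
    exact AEEqFun.mk_eq_mk.2 (Filter.Eventually.of_forall fun X => smul_add _ _ _)

/-- `dʰ = ∑ i, (-1) ^ i dʰ_i`. -/
def dH (p q : ℕ) : M.L A p q →+ M.L A p (q + 1) :=
  ∑ i : Fin (q + 2), (-1 : ℤ) ^ (i : ℕ) • M.dHFace A i

/-- `dᵛ = ∑ j, (-1) ^ j dᵛ_j`. -/
def dV (p q : ℕ) : M.L A p q →+ M.L A (p + 1) q :=
  ∑ j : Fin (p + 2), (-1 : ℤ) ^ (j : ℕ) • M.dVFace A j

/-- `Dⁿ(A) = ⨁_{p+q=n} L(Γ_{pq}, A)`, `p, q ≥ 0`. -/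
abbrev D (n : ℕ) : Type (max u v) :=
  ∀ x : {x : ℕ × ℕ // x.1 + x.2 = n}, M.L A x.1.1 x.1.2

/-- The component in `L(Γ_{pq}, A)` of `dʰ F`, for `F ∈ Dⁿ(A)`. -/
def dHPart {n : ℕ} (F : M.D A n) : M.D A (n + 1)
  | ⟨(_, 0), _⟩ => 0
  | ⟨(p, q + 1), h⟩ => M.dH A p q (F ⟨(p, q), Nat.succ.inj h⟩)

/-- The component in `L(Γ_{pq}, A)` of `dᵛ F`, for `F ∈ Dⁿ(A)`. -/
def dVPart {n : ℕ} (F : M.D A n) : M.D A (n + 1)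
  | ⟨(0, _), _⟩ => 0
  | ⟨(p + 1, q), h⟩ => M.dV A p q (F ⟨(p, q), Nat.succ.inj ((Nat.succ_add p q).symm.trans h)⟩)

/-- The total coboundary `d = dʰ + ε dᵛ`, with `ε = (-1) ^ q` on `L(Γ_{pq}, A)`. -/
def dD (n : ℕ) : M.D A n →+ M.D A (n + 1) :=
  AddMonoidHom.mk' (fun F x => M.dHPart A F x + (-1 : ℤ) ^ x.1.2 • M.dVPart A F x) <| by
    intro F F'
    funext x
    obtain ⟨⟨p, q⟩, h⟩ := x
    have h1 : M.dHPart A (F + F') ⟨(p, q), h⟩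
        = M.dHPart A F ⟨(p, q), h⟩ + M.dHPart A F' ⟨(p, q), h⟩ := by
      cases q with
      | zero => exact (add_zero _).symm
      | succ q => exact map_add (M.dH A p q) _ _
    have h2 : M.dVPart A (F + F') ⟨(p, q), h⟩
        = M.dVPart A F ⟨(p, q), h⟩ + M.dVPart A F' ⟨(p, q), h⟩ := by
      cases p with
      | zero => exact (add_zero _).symm
      | succ p => exact map_add (M.dV A p q) _ _
    simp only [Pi.add_apply, h1, h2, smul_add]
    abel

/-- `Kⁿ(A) = L(G₁ⁿ, A) ⊕ L(G₂ⁿ, A)`, where `G₁ⁿ = Γ_{n0}` and `G₂ⁿ = Γ_{0n}`. -/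
abbrev K (n : ℕ) : Type (max u v) := M.L A n 0 × M.L A 0 n

/-- The coboundary of `K(A)`: the usual group coboundaries of `G₁` and of `G₂`. -/
def dK (n : ℕ) : M.K A n →+ M.K A (n + 1) := (M.dV A n 0).prodMap (M.dH A 0 n)

/-- The restriction `J : Dⁿ(A) → Kⁿ(A)`; for `n = 0` it is `a ↦ a ⊕ a`. -/
def J (n : ℕ) : M.D A n →+ M.K A n :=
  AddMonoidHom.mk' (fun F => (F ⟨(n, 0), Nat.add_zero n⟩, F ⟨(0, n), Nat.zero_add n⟩))
    fun _ _ => rfl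

/-- The mapping cone `Mⁿ(A) = Dⁿ⁺¹(A) ⊕ Kⁿ(A)` of `J` in degrees `n ≥ 0`; in degree `-1` the
mapping cone is `D⁰(A)`. -/
abbrev Cone (n : ℕ) : Type (max u v) := M.D A (n + 1) × M.K A n

/-- `d(F, H) = (d F, - d H + J F)` on `Mⁿ(A)`, `n ≥ 0`. -/
def dCone (n : ℕ) : M.Cone A n →+ M.Cone A (n + 1) :=
  ((M.dD A (n + 1)).comp (AddMonoidHom.fst _ _)).prod
    (-(M.dK A n).comp (AddMonoidHom.snd _ _) + (M.J A (n + 1)).comp (AddMonoidHom.fst _ _))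

/-- `d F = (d F, J F)` on `M⁻¹(A) = D⁰(A)`. -/
def dConeNegOne : M.D A 0 →+ M.Cone A 0 := (M.dD A 0).prod (M.J A 0)

/-- The cocycles in `Mⁿ(A)`. -/
def cocycles (n : ℕ) : AddSubgroup (M.Cone A n) := (M.dCone A n).ker

/-- The coboundaries in `Mⁿ(A)`. -/
def coboundaries : ∀ n : ℕ, AddSubgroup (M.Cone A n)
  | 0 => (M.dConeNegOne A).range
  | n + 1 => (M.dCone A n).range

/-- The Kac cohomology `Hⁿ(m.p., A)`, `n ≥ 0`: the cohomology of the mapping cone of `J`. -/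
abbrev H (n : ℕ) : Type (max u v) :=
  M.cocycles A n ⧸ (M.coboundaries A n).addSubgroupOf (M.cocycles A n)

variable {A}
variable (f : A →+[G] B) (hf : Continuous f)

/-- The map `L(Γ_{pq}, A) → L(Γ_{pq}, B)` induced by a continuous `G`-homomorphism. -/
def mapL (p q : ℕ) : M.L A p q →+ M.L B p q :=
  AddMonoidHom.mk' (fun F => AEEqFun.comp f hf F) <| by
    intro F F'
    refine AEEqFun.induction_on₂ F F' fun g hg g' hg' => ?_
    simp only [AEEqFun.mk_add_mk, AEEqFun.comp_mk]
    exact AEEqFun.mk_eq_mk.2 (Filter.Eventually.of_forall fun X => map_add f _ _)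

/-- The map `Dⁿ(A) → Dⁿ(B)` induced by a continuous `G`-homomorphism. -/
def mapD (n : ℕ) : M.D A n →+ M.D B n :=
  AddMonoidHom.mk' (fun F x => M.mapL f hf x.1.1 x.1.2 (F x)) fun _ _ =>
    funext fun _ => map_add _ _ _

/-- The map `Mⁿ(A) → Mⁿ(B)` induced by a continuous `G`-homomorphism. -/
def mapCone (n : ℕ) : M.Cone A n →+ M.Cone B n :=
  (M.mapD f hf (n + 1)).prodMap ((M.mapL f hf n 0).prodMap (M.mapL f hf 0 n))

theorem mapL_dH (p q : ℕ) (F : M.L A p q) :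
    M.mapL f hf p (q + 1) (M.dH A p q F) = M.dH B p q (M.mapL f hf p q F) := by
  have h : ∀ i, M.mapL f hf p (q + 1) (M.dHFace A i F) = M.dHFace B i (M.mapL f hf p q F) := by
    intro i
    refine AEEqFun.induction_on F fun g hg => ?_
    simp only [mapL, dHFace, AddMonoidHom.mk'_apply, AEEqFun.comp_mk,
      AEEqFun.compQuasiMeasurePreserving_mk]
    exact AEEqFun.mk_eq_mk.2 (Filter.Eventually.of_forall fun X => map_smul f _ _)
  simp only [dH, AddMonoidHom.finsetSum_apply, AddMonoidHom.smul_apply, map_sum, map_zsmul, h]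

theorem mapL_dV (p q : ℕ) (F : M.L A p q) :
    M.mapL f hf (p + 1) q (M.dV A p q F) = M.dV B p q (M.mapL f hf p q F) := by
  have h : ∀ i, M.mapL f hf (p + 1) q (M.dVFace A i F) = M.dVFace B i (M.mapL f hf p q F) := by
    intro i
    refine AEEqFun.induction_on F fun g hg => ?_
    simp only [mapL, dVFace, AddMonoidHom.mk'_apply, AEEqFun.comp_mk,
      AEEqFun.compQuasiMeasurePreserving_mk]
    exact AEEqFun.mk_eq_mk.2 (Filter.Eventually.of_forall fun X => map_smul f _ _)
  simp only [dV, AddMonoidHom.finsetSum_apply, AddMonoidHom.smul_apply, map_sum, map_zsmul, h]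

theorem mapD_dD (n : ℕ) (F : M.D A n) :
    M.mapD f hf (n + 1) (M.dD A n F) = M.dD B n (M.mapD f hf n F) := by
  funext x
  obtain ⟨⟨p, q⟩, h⟩ := x
  have h1 : M.mapL f hf p q (M.dHPart A F ⟨(p, q), h⟩)
      = M.dHPart B (M.mapD f hf n F) ⟨(p, q), h⟩ := by
    cases q with
    | zero => exact map_zero _
    | succ q => exact M.mapL_dH f hf p q _
  have h2 : M.mapL f hf p q (M.dVPart A F ⟨(p, q), h⟩)
      = M.dVPart B (M.mapD f hf n F) ⟨(p, q), h⟩ := by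
    cases p with
    | zero => exact map_zero _
    | succ p => exact M.mapL_dV f hf p q _
  change M.mapL f hf p q (_ + _) = _ + _
  rw [map_add, map_zsmul, h1, h2]

theorem mapCone_dCone (n : ℕ) (F : M.Cone A n) :
    M.mapCone f hf (n + 1) (M.dCone A n F) = M.dCone B n (M.mapCone f hf n F) := by
  refine Prod.ext (M.mapD_dD f hf (n + 1) F.1) (Prod.ext ?_ ?_)
  · change M.mapL f hf (n + 1) 0 (-(M.dV A n 0 F.2.1) + F.1 ⟨(n + 1, 0), _⟩)
      = -(M.dV B n 0 (M.mapL f hf n 0 F.2.1)) + M.mapL f hf (n + 1) 0 (F.1 ⟨(n + 1, 0), _⟩)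
    rw [map_add, map_neg, mapL_dV]
  · change M.mapL f hf 0 (n + 1) (-(M.dH A 0 n F.2.2) + F.1 ⟨(0, n + 1), _⟩)
      = -(M.dH B 0 n (M.mapL f hf 0 n F.2.2)) + M.mapL f hf 0 (n + 1) (F.1 ⟨(0, n + 1), _⟩)
    rw [map_add, map_neg, mapL_dH]

theorem mapCone_mem_cocycles (n : ℕ) {z : M.Cone A n} (hz : z ∈ M.cocycles A n) :
    M.mapCone f hf n z ∈ M.cocycles B n := by
  have h : M.dCone A n z = 0 := hz
  change M.dCone B n _ = 0
  rw [← mapCone_dCone, h, map_zero]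

theorem mapCone_mem_coboundaries (n : ℕ) {z : M.Cone A n} (hz : z ∈ M.coboundaries A n) :
    M.mapCone f hf n z ∈ M.coboundaries B n := by
  cases n with
  | zero =>
    obtain ⟨y, rfl⟩ := hz
    exact ⟨M.mapD f hf 0 y, Prod.ext (M.mapD_dD f hf 0 y).symm rfl⟩
  | succ n =>
    obtain ⟨y, rfl⟩ := hz
    exact ⟨M.mapCone f hf n y, (M.mapCone_dCone f hf n y).symm⟩

/-- The map `Hⁿ(m.p., A) → Hⁿ(m.p., B)` induced by a continuous `G`-homomorphism `A → B`. -/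
def mapH (n : ℕ) : M.H A n →+ M.H B n :=
  QuotientAddGroup.map _ _
    (((M.mapCone f hf n).comp (M.cocycles A n).subtype).codRestrict (M.cocycles B n)
      fun z => M.mapCone_mem_cocycles f hf n z.2)
    fun _ hz => M.mapCone_mem_coboundaries f hf n hz

end Cochains

end MatchedPair

section LFun

variable (G : Type u) [Group G] [TopologicalSpace G] [IsTopologicalGroup G]
  [LocallyCompactSpace G] [SecondCountableTopology G] [T2Space G] [MeasurableSpace G] [BorelSpace G]
  (A : Type v) [AddCommGroup A] [TopologicalSpace A] [IsTopologicalAddGroup A]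
  [DistribMulAction G A] [ContinuousSMul G A]

/-- `L(G, A)`: classes of measurable functions `G → A` modulo almost everywhere equality with
respect to Haar measure. -/
def LFun : Type (max u v) := G →ₘ[(Measure.haar : Measure G)] A

namespace LFun

instance : AddCommGroup (LFun G A) :=
  inferInstanceAs (AddCommGroup (G →ₘ[(Measure.haar : Measure G)] A))

variable {G A}

/-- `(x • F)(y) = x • F(x⁻¹ y)`. -/
def act (x : G) (F : LFun G A) : LFun G A :=
  AEEqFun.comp (fun a : A => x • a) (continuous_const_smul x)
    (AEEqFun.compQuasiMeasurePreserving F (fun y => x⁻¹ * y)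
      (measurePreserving_mul_left Measure.haar x⁻¹).quasiMeasurePreserving)

theorem act_mk (x : G) (f : G → A) (hf : AEStronglyMeasurable f (Measure.haar : Measure G)) :
    act x (AEEqFun.mk f hf) = AEEqFun.mk (fun y => x • f (x⁻¹ * y))
      ((hf.comp_quasiMeasurePreserving
        (measurePreserving_mul_left Measure.haar x⁻¹).quasiMeasurePreserving).const_smul x) := rfl

instance : DistribMulAction G (LFun G A) where
  smul := act
  one_smul F := AEEqFun.induction_on F fun f hf => by
    change act _ _ = _
    rw [act_mk]
    exact AEEqFun.mk_eq_mk.2 (Filter.Eventually.of_forall fun y => by simp)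
  mul_smul x x' F := AEEqFun.induction_on F fun f hf => by
    change act _ _ = act _ (act _ _)
    rw [act_mk, act_mk, act_mk]
    exact AEEqFun.mk_eq_mk.2 (Filter.Eventually.of_forall fun y => by simp [mul_smul, mul_assoc])
  smul_zero x := by
    change act x (AEEqFun.mk _ _) = AEEqFun.mk _ _
    rw [act_mk]
    exact AEEqFun.mk_eq_mk.2 (Filter.Eventually.of_forall fun y => by simp)
  smul_add x F F' := AEEqFun.induction_on₂ F F' fun f hf f' hf' => by
    change act x (AEEqFun.mk _ _) = act x (AEEqFun.mk _ _) + act x (AEEqFun.mk _ _)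
    rw [act_mk, act_mk, act_mk]
    exact AEEqFun.mk_eq_mk.2 (Filter.Eventually.of_forall fun y => by simp)

/-- The distance `ρ_μ(F, H) = ∫ ρ(F(y), H(y)) dμ(y)`, for the bounded complete metric
`ρ = min 1 dist` on `A` and a finite measure `μ` in the Haar measure class of `G`. -/
def rho [PolishSpace A] (F H : LFun G A) : ℝ :=
  letI : MetricSpace A := TopologicalSpace.completelyMetrizableMetric A
  ∫ y, min 1 (dist (AEEqFun.cast F y) (AEEqFun.cast H y)) ∂(Measure.haar : Measure G).toFinite

/-- The pseudometric `ρ_μ` on `L(G, A)`. -/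
abbrev pseudoMetricSpace [PolishSpace A] : PseudoMetricSpace (LFun G A) where
  dist := rho
  dist_self F := by
    let : MetricSpace A := TopologicalSpace.completelyMetrizableMetric A
    change ∫ y, min 1 (dist (AEEqFun.cast F y) (AEEqFun.cast F y)) ∂_ = 0
    simp
  dist_comm F H := by
    let : MetricSpace A := TopologicalSpace.completelyMetrizableMetric A
    change ∫ y, min 1 (dist (AEEqFun.cast F y) (AEEqFun.cast H y)) ∂_
      = ∫ y, min 1 (dist (AEEqFun.cast H y) (AEEqFun.cast F y)) ∂_
    simp only [dist_comm]
  dist_triangle F H K := by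
    let : MetricSpace A := TopologicalSpace.completelyMetrizableMetric A
    have hi : ∀ F H : LFun G A,
        Integrable (fun y => min 1 (dist (AEEqFun.cast F y) (AEEqFun.cast H y)))
          (Measure.haar : Measure G).toFinite := by
      intro F H
      refine (integrable_const (1 : ℝ)).mono' ?_ (Filter.Eventually.of_forall fun y => ?_)
      · exact (stronglyMeasurable_const.inf
          ((AEEqFun.stronglyMeasurable F).dist (AEEqFun.stronglyMeasurable H))).aestronglyMeasurable
      · rw [Real.norm_of_nonneg (le_min zero_le_one dist_nonneg)]
        exact min_le_left _ _
    change ∫ y, min 1 (dist (AEEqFun.cast F y) (AEEqFun.cast K y)) ∂_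
      ≤ ∫ y, min 1 (dist (AEEqFun.cast F y) (AEEqFun.cast H y)) ∂_
        + ∫ y, min 1 (dist (AEEqFun.cast H y) (AEEqFun.cast K y)) ∂_
    rw [← integral_add (hi F H) (hi H K)]
    refine integral_mono (hi F K) ((hi F H).add (hi H K)) fun y => ?_
    have h := dist_triangle (AEEqFun.cast F y) (AEEqFun.cast H y) (AEEqFun.cast K y)
    have h1 : 0 ≤ dist (AEEqFun.cast F y) (AEEqFun.cast H y) := dist_nonneg
    have h2 : 0 ≤ dist (AEEqFun.cast H y) (AEEqFun.cast K y) := dist_nonneg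
    rcases le_total 1 (dist (AEEqFun.cast F y) (AEEqFun.cast H y)) with h3 | h3 <;>
    rcases le_total 1 (dist (AEEqFun.cast H y) (AEEqFun.cast K y)) with h4 | h4 <;>
    rcases le_total 1 (dist (AEEqFun.cast F y) (AEEqFun.cast K y)) with h5 | h5 <;>
    simp only [min_eq_left, min_eq_right, h3, h4, h5] <;> linarith

/-- The topology on `L(G, A)` given by the distance `ρ_μ`. It does not depend on the choices
of `ρ` and `μ`. -/
instance [PolishSpace A] : TopologicalSpace (LFun G A) :=
  pseudoMetricSpace.toUniformSpace.toTopologicalSpace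

end LFun

end LFun

/-- A Polish `G`-module: an abelian Polish group with a continuous action of `G` by group
automorphisms. -/
structure PolishGModule (G : Type u) [Group G] [TopologicalSpace G] where
  carrier : Type w
  [addCommGroup : AddCommGroup carrier]
  [topologicalSpace : TopologicalSpace carrier]
  [polishSpace : PolishSpace carrier]
  [isTopologicalAddGroup : IsTopologicalAddGroup carrier]
  [distribMulAction : DistribMulAction G carrier]
  [continuousSMul : ContinuousSMul G carrier]

namespace PolishGModule

attribute [instance] addCommGroup topologicalSpace polishSpace isTopologicalAddGroup
  distribMulAction continuousSMul

variable {G : Type u} [Group G] [TopologicalSpace G]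

/-- A short exact sequence `0 → A → B → C → 0` of Polish `G`-modules: the arrows are continuous
`G`-homomorphisms and the sequence is exact. -/
structure ShortExact (A B C : PolishGModule.{u, w} G) where
  i : A.carrier →+[G] B.carrier
  p : B.carrier →+[G] C.carrier
  continuous_i : Continuous i
  continuous_p : Continuous p
  injective_i : Function.Injective i
  exact : Function.Exact i p
  surjective_p : Function.Surjective p

end PolishGModule

namespace MatchedPair

variable {G : Type u} [Group G] [TopologicalSpace G] [IsTopologicalGroup G]
  [LocallyCompactSpace G] [SecondCountableTopology G] [T2Space G] [MeasurableSpace G] [BorelSpace G]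
  (M : MatchedPair G)

open PolishGModule

/-- Every short exact sequence `0 → A → B → C → 0` of Polish `G`-modules gives rise to a long exact
sequence `0 → H⁰(A) → H⁰(B) → H⁰(C) → H¹(A) → H¹(B) → ⋯` in Kac cohomology, with connecting
homomorphisms `δ` that are natural with respect to morphisms of short exact sequences. -/
def HasNaturalLongExactSequences : Prop :=
  ∃ δ : ∀ {A B C : PolishGModule.{u, w} G}, ShortExact A B C →
      ∀ n : ℕ, M.H C.carrier n →+ M.H A.carrier (n + 1),
    (∀ {A B C : PolishGModule.{u, w} G} (S : ShortExact A B C),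
      Function.Injective (M.mapH S.i S.continuous_i 0) ∧
      ∀ n : ℕ,
        Function.Exact (M.mapH S.i S.continuous_i n) (M.mapH S.p S.continuous_p n) ∧
        Function.Exact (M.mapH S.p S.continuous_p n) (δ S n) ∧
        Function.Exact (δ S n) (M.mapH S.i S.continuous_i (n + 1))) ∧
    (∀ {A B C A' B' C' : PolishGModule.{u, w} G} (S : ShortExact A B C)
      (S' : ShortExact A' B' C') (a : A.carrier →+[G] A'.carrier) (b : B.carrier →+[G] B'.carrier)
      (c : C.carrier →+[G] C'.carrier) (ha : Continuous a) (_ : Continuous b) (hc : Continuous c),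
      (∀ x, b (S.i x) = S'.i (a x)) → (∀ x, c (S.p x) = S'.p (b x)) →
      ∀ (n : ℕ) (α : M.H C.carrier n), M.mapH a ha (n + 1) (δ S n α) = δ S' n (M.mapH c hc n α))

/-- Effaceability in positive degrees: for every `n ≥ 1` and every `α ∈ Hⁿ(m.p., A)` there is a
short exact sequence `0 → A → B → C → 0` of Polish `G`-modules such that `α` becomes `0` in
`Hⁿ(m.p., B)`. -/
def IsEffaceable : Prop :=
  ∀ (A : PolishGModule.{u, w} G) (n : ℕ), 1 ≤ n → ∀ α : M.H A.carrier n,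
    ∃ (B C : PolishGModule.{u, w} G) (S : ShortExact A B C), M.mapH S.i S.continuous_i n α = 0

end MatchedPair

end

set_option linter.unusedSectionVars false

/-! ### Simplicial identities and the equations `d² = 0`. -/

noncomputable section

/-! The long exact sequence is homological algebra once the functors `A ↦ L(Γ_{pq}, A)` are known to
be exact. A continuous surjection of Polish groups has a Borel section (`exists_measurable_section`,
from the selection theorem `exists_measurable_selection`), and a continuous injection of Polish
spaces is a Borel embedding. So classes of Borel functions lift along `B → C` and, where they vanish
in `C`, along `A → B` (`mapL_surjective`, `mapL_exact`). The mapping cones therefore form short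
exact sequences of complexes.

For the vanishing, a cochain on `Γ_{pq}` with values in `L(G, A)` is a function `F(X)(y)` on `Γ_{pq}
× G`. The translated grid `y⁻¹X` is determined by its `p + 1` rows, each inside one coset of `G₂`,
and its `q + 1` columns, each inside one coset of `G₁`. Up to null sets `G/G₂` is `G₁` and `G/G₁` is
`G₂`, so `(X, y)` ranges over `G₁^{p+1} × G₂^{q+1}` with its Haar class (`exists_cosets_inverse`).
Faces of grids become deletions of coordinates (`cosets_faceH`, `cosets_faceV`), and the
substitution `F(X)(y) = y • H` removes the action on `A` (`IsTwist`). What is left is the double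
complex of functions of two tuples, with alternating sums of deletions. It is contracted in either
direction by inserting a fixed generic point (`ae_eq_sum_cons`). Hence rows and columns are exact in
positive degrees, `D` and `K` are acyclic there, and so is the cone.

For this argument `L(G, A)` must be a Polish `G`-module. Its topology is that of convergence in
measure, and almost every verification passes to subsequences that converge almost everywhere.

Effaceability follows by embedding `A` in `L(G, A)` as the constants. The quotient is realized as
the kernel of a continuous map (`exact_diff_diff₂`), so it is Polish as a closed subgroup. -/

theorem sum_neg_one_pow_comp_eq_zero {X Y Z : Type*} [AddCommGroup X] [AddCommGroup Y]
    [AddCommGroup Z] {n : ℕ} (f : Fin (n + 2) → X →+ Y) (g : Fin (n + 3) → Y →+ Z)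
    (h : ∀ i j : Fin (n + 2), i ≤ j → ∀ x, g j.succ (f i x) = g i.castSucc (f j x)) (x : X) :
    (∑ j : Fin (n + 3), (-1 : ℤ) ^ (j : ℕ) • g j) ((∑ i : Fin (n + 2), (-1 : ℤ) ^ (i : ℕ) • f i) x) = 0 := by
  simp only [AddMonoidHom.finsetSum_apply, AddMonoidHom.smul_apply, map_sum, map_zsmul,
    Finset.smul_sum, smul_smul]
  rw [← Finset.sum_product']
  let P := Fin (n + 2) × Fin (n + 3)
  let S : Finset P := {ij : P | (ij.2 : ℕ) ≤ (ij.1 : ℕ)}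
  rw [Finset.univ_product_univ, ← Finset.sum_add_sum_compl S, ← eq_neg_iff_add_eq_zero,
    ← Finset.sum_neg_distrib]
  -- The term of `(i, j)` with `j ≤ i` cancels that of `(j, i + 1)`: the values agree by `h` and the
  -- exponents of the signs differ by one.
  let φ : ∀ ij : P, ij ∈ S → P := fun ij hij =>
    (Fin.castLT ij.2 (lt_of_le_of_lt (Finset.mem_filter.mp hij).right (Fin.is_lt ij.1)), ij.1.succ)
  apply Finset.sum_bij φ
  · intro ij hij
    simp_rw [S, φ, Finset.compl_filter, Finset.mem_filter_univ, Fin.val_succ,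
      Fin.val_castLT] at hij ⊢
    lia
  · rintro ⟨i, j⟩ hij ⟨i', j'⟩ hij' h
    rw [Prod.mk_inj]
    exact ⟨by simpa [φ] using! congr_arg Prod.snd h,
      by simpa [φ, Fin.castSucc_castLT] using! congr_arg Fin.castSucc (congr_arg Prod.fst h)⟩
  · rintro ⟨i', j'⟩ hij'
    simp_rw [S, Finset.compl_filter, Finset.mem_filter_univ, not_le] at hij'
    refine ⟨(j'.pred <| ?_, Fin.castSucc i'), ?_, ?_⟩
    · rintro rfl
      simp only [Fin.val_zero, not_lt_zero] at hij'
    · simpa [S] using! Nat.le_sub_one_of_lt hij'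
    · simp only [φ, Fin.castLT_castSucc, Fin.succ_pred]
  · rintro ⟨i, j⟩ hij
    have hij' : (j : ℕ) ≤ i := by simpa [S] using hij
    have := h (Fin.castLT j (lt_of_le_of_lt hij' i.2)) i hij' x
    simp only [φ, Fin.val_succ, Fin.val_castLT, Fin.castSucc_castLT] at this ⊢
    rw [this, ← neg_smul, pow_succ]
    congr 1
    ring

theorem Fin.succAbove_succAbove_of_le {n : ℕ} {i j : Fin (n + 2)} (h : i ≤ j) (k : Fin (n + 1)) :
    j.succ.succAbove (i.succAbove k) = i.castSucc.succAbove (j.succAbove k) := by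
  simp only [Fin.succAbove, Fin.lt_def, Fin.le_def] at *
  ext
  split_ifs <;> simp_all <;> omega

namespace MatchedPair

section Cochains

variable {G : Type u} [Group G] [TopologicalSpace G] [IsTopologicalGroup G]
  [LocallyCompactSpace G] [SecondCountableTopology G] [T2Space G] [MeasurableSpace G] [BorelSpace G]
  (M : MatchedPair G)
  (A : Type v) [AddCommGroup A] [TopologicalSpace A] [IsTopologicalAddGroup A]
  [DistribMulAction G A] [ContinuousSMul G A]

theorem coeFn_dHFace {p q : ℕ} (i : Fin (q + 2)) (F : M.L A p q) :
    M.dHFace A i F =ᵐ[M.μ p (q + 1)] fun X => X.1 0 (i.succAbove 0) • F (M.faceH i X) := by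
  refine (AEEqFun.coeFn_comp₂ _ continuous_smul _ _).trans ?_
  filter_upwards [AEEqFun.coeFn_mk (fun X : M.Γ p (q + 1) => X.1 0 (i.succAbove 0))
    (M.continuous_vertex _ _).aestronglyMeasurable,
    AEEqFun.coeFn_compQuasiMeasurePreserving F (M.qmp_faceH i)] with X h1 h2
  rw [h1, h2]
  rfl

theorem coeFn_dVFace {p q : ℕ} (j : Fin (p + 2)) (F : M.L A p q) :
    M.dVFace A j F =ᵐ[M.μ (p + 1) q] fun X => X.1 (j.succAbove 0) 0 • F (M.faceV j X) := by
  refine (AEEqFun.coeFn_comp₂ _ continuous_smul _ _).trans ?_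
  filter_upwards [AEEqFun.coeFn_mk (fun X : M.Γ (p + 1) q => X.1 (j.succAbove 0) 0)
    (M.continuous_vertex _ _).aestronglyMeasurable,
    AEEqFun.coeFn_compQuasiMeasurePreserving F (M.qmp_faceV j)] with X h1 h2
  rw [h1, h2]
  rfl

/-- The normalizing factors telescope: either composite acts by the vertex of `X` that is upper left
after both deletions. The same happens for the vertical and the mixed identities below. -/
theorem dHFace_dHFace {p q : ℕ} {i j : Fin (q + 2)} (h : i ≤ j) (F : M.L A p q) :
    M.dHFace A j.succ (M.dHFace A i F) = M.dHFace A i.castSucc (M.dHFace A j F) := by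
  refine AEEqFun.ext ?_
  filter_upwards [M.coeFn_dHFace A j.succ (M.dHFace A i F),
    M.coeFn_dHFace A i.castSucc (M.dHFace A j F),
    (M.qmp_faceH j.succ).ae (M.coeFn_dHFace A i F),
    (M.qmp_faceH i.castSucc).ae (M.coeFn_dHFace A j F)] with X h1 h2 h3 h4
  rw [h1, h2, h3, h4, smul_smul, smul_smul]
  simp only [faceH, Fin.succAbove_succAbove_of_le h, mul_inv_cancel_left, mul_inv_rev, inv_inv,
    mul_assoc]

theorem dVFace_dVFace {p q : ℕ} {i j : Fin (p + 2)} (h : i ≤ j) (F : M.L A p q) :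
    M.dVFace A j.succ (M.dVFace A i F) = M.dVFace A i.castSucc (M.dVFace A j F) := by
  refine AEEqFun.ext ?_
  filter_upwards [M.coeFn_dVFace A j.succ (M.dVFace A i F),
    M.coeFn_dVFace A i.castSucc (M.dVFace A j F),
    (M.qmp_faceV j.succ).ae (M.coeFn_dVFace A i F),
    (M.qmp_faceV i.castSucc).ae (M.coeFn_dVFace A j F)] with X h1 h2 h3 h4
  rw [h1, h2, h3, h4, smul_smul, smul_smul]
  simp only [faceV, Fin.succAbove_succAbove_of_le h, mul_inv_cancel_left, mul_inv_rev, inv_inv,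
    mul_assoc]

theorem dHFace_dVFace {p q : ℕ} (i : Fin (q + 2)) (j : Fin (p + 2)) (F : M.L A p q) :
    M.dHFace A i (M.dVFace A j F) = M.dVFace A j (M.dHFace A i F) := by
  refine AEEqFun.ext ?_
  filter_upwards [M.coeFn_dHFace A i (M.dVFace A j F),
    M.coeFn_dVFace A j (M.dHFace A i F),
    (M.qmp_faceH i).ae (M.coeFn_dVFace A j F),
    (M.qmp_faceV j).ae (M.coeFn_dHFace A i F)] with X h1 h2 h3 h4
  rw [h1, h2, h3, h4, smul_smul, smul_smul]
  simp only [faceH, faceV, mul_inv_cancel_left, mul_inv_rev, inv_inv, mul_assoc]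

theorem dH_dH {p q : ℕ} (F : M.L A p q) : M.dH A p (q + 1) (M.dH A p q F) = 0 :=
  sum_neg_one_pow_comp_eq_zero _ _ (fun _ _ h F => M.dHFace_dHFace A h F) F

theorem dV_dV {p q : ℕ} (F : M.L A p q) : M.dV A (p + 1) q (M.dV A p q F) = 0 :=
  sum_neg_one_pow_comp_eq_zero _ _ (fun _ _ h F => M.dVFace_dVFace A h F) F

theorem dH_dV {p q : ℕ} (F : M.L A p q) :
    M.dH A (p + 1) q (M.dV A p q F) = M.dV A p (q + 1) (M.dH A p q F) := by
  simp only [dH, dV, AddMonoidHom.finsetSum_apply, AddMonoidHom.smul_apply, map_sum, map_zsmul,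
    dHFace_dVFace, Finset.smul_sum]
  rw [Finset.sum_comm]
  exact Finset.sum_congr rfl fun _ _ => Finset.sum_congr rfl fun _ _ => smul_comm _ _ _

theorem dD_apply {n : ℕ} (F : M.D A n) (x : {x : ℕ × ℕ // x.1 + x.2 = n + 1}) :
    M.dD A n F x = M.dHPart A F x + (-1 : ℤ) ^ x.1.2 • M.dVPart A F x := rfl

/-- `dH` and `dV` commute rather than anticommute. The sign `(-1) ^ q` is changed by `dH` and not by
`dV`, so the two mixed terms cancel. -/
theorem dD_dD (n : ℕ) (F : M.D A n) : M.dD A (n + 1) (M.dD A n F) = 0 := by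
  funext ⟨⟨p, q⟩, h⟩
  rw [dD_apply]
  rcases p with _ | _ | p <;> rcases q with _ | _ | q <;>
    simp [dHPart, dVPart, dD_apply, dH_dH, dV_dV, dH_dV, pow_succ]

theorem J_dD (n : ℕ) (F : M.D A n) : M.J A (n + 1) (M.dD A n F) = M.dK A n (M.J A n F) := by
  refine Prod.ext ?_ ?_
  · simp [J, dK, dD_apply, dHPart, dVPart]
  · simp [J, dK, dD_apply, dHPart, dVPart]

theorem dK_dK (n : ℕ) (F : M.K A n) : M.dK A (n + 1) (M.dK A n F) = 0 :=
  Prod.ext (M.dV_dV A _) (M.dH_dH A _)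

theorem dCone_dCone (n : ℕ) (z : M.Cone A n) : M.dCone A (n + 1) (M.dCone A n z) = 0 := by
  refine Prod.ext (M.dD_dD A _ _) ?_
  change -(M.dK A (n + 1) (-(M.dK A n z.2) + M.J A (n + 1) z.1))
    + M.J A (n + 2) (M.dD A (n + 1) z.1) = 0
  rw [J_dD, map_add, map_neg, dK_dK]
  simp

theorem dCone_dConeNegOne (F : M.D A 0) : M.dCone A 0 (M.dConeNegOne A F) = 0 := by
  refine Prod.ext (M.dD_dD A _ _) ?_
  change -(M.dK A 0 (M.J A 0 F)) + M.J A 1 (M.dD A 0 F) = 0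
  rw [J_dD]
  simp

theorem coboundaries_le_cocycles (n : ℕ) : M.coboundaries A n ≤ M.cocycles A n := by
  cases n with
  | zero => rintro _ ⟨y, rfl⟩; exact M.dCone_dConeNegOne A y
  | succ n => rintro _ ⟨y, rfl⟩; exact M.dCone_dCone A n y

end Cochains

end MatchedPair

end

/-! ### Borel selections and sections. -/

noncomputable section

/-- The Kuratowski–Ryll-Nardzewski selection theorem. -/
theorem exists_measurable_selection {Ω X : Type*} [MeasurableSpace Ω] [TopologicalSpace X]
    [PolishSpace X] [MeasurableSpace X] [BorelSpace X] [Nonempty X] (Φ : Ω → Set X)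
    (hcl : ∀ ω, IsClosed (Φ ω)) (hne : ∀ ω, (Φ ω).Nonempty)
    (hm : ∀ O, IsOpen O → MeasurableSet {ω | (Φ ω ∩ O).Nonempty}) :
    ∃ s : Ω → X, Measurable s ∧ ∀ ω, s ω ∈ Φ ω := by
  let : MetricSpace X := TopologicalSpace.completelyMetrizableMetric X
  have : CompleteSpace X := TopologicalSpace.complete_completelyMetrizableMetric X
  let e := TopologicalSpace.denseSeq X
  let r : ℕ → ℝ := fun k => (1 / 2) ^ k
  have hr : ∀ k, 0 < r k := fun k => by positivity
  -- `Φ ω` is shrunk step by step: at stage `k` it is intersected with the ball of radius `2⁻ᵏ`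
  -- around the first dense point whose ball still meets the set. The centres chosen in this way are
  -- measurable in `ω`, and their limit is the selection.
  let N : ℕ → Set X → ℕ := fun k T => sInf {n | (T ∩ Metric.ball (e n) (r k)).Nonempty}
  let T : ℕ → Set X → Set X := fun k S =>
    Nat.rec S (fun k T => T ∩ Metric.ball (e (N k T)) (r k)) k
  have hT : ∀ k S, T (k + 1) S = T k S ∩ Metric.ball (e (N k (T k S))) (r k) := fun _ _ => rfl
  have hex : ∀ k T, T.Nonempty → {n | (T ∩ Metric.ball (e n) (r k)).Nonempty}.Nonempty := by
    rintro k T ⟨x, hx⟩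
    obtain ⟨n, hn⟩ := (TopologicalSpace.denseRange_denseSeq X).exists_dist_lt x (hr k)
    exact ⟨n, x, hx, hn⟩
  have hTne : ∀ k ω, (T k (Φ ω)).Nonempty := by
    intro k ω
    induction k with
    | zero => exact hne ω
    | succ k ih => exact Nat.sInf_mem (hex k _ ih)
  have hTsub : ∀ k ω, T k (Φ ω) ⊆ Φ ω := by
    intro k ω
    induction k with
    | zero => exact subset_rfl
    | succ k ih => exact Set.inter_subset_left.trans ih
  have hNm' : ∀ k, (∀ O, IsOpen O → MeasurableSet {ω | (T k (Φ ω) ∩ O).Nonempty}) →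
      Measurable fun ω => N k (T k (Φ ω)) := by
    intro k h
    classical
    have := measurable_find (p := fun ω n => (T k (Φ ω) ∩ Metric.ball (e n) (r k)).Nonempty)
      (fun ω => hex k _ (hTne k ω)) (fun n => h _ Metric.isOpen_ball)
    convert this using 2 with ω
    exact Nat.sInf_def (hex k _ (hTne k ω))
  have hTm : ∀ k O, IsOpen O → MeasurableSet {ω | (T k (Φ ω) ∩ O).Nonempty} := by
    intro k
    induction k with
    | zero => exact hm
    | succ k ih =>
      intro O hO
      -- For a fixed value `n` of the index, meeting `O` after the next shrinking means meeting the
      -- open set `ball ∩ O` before it, which is where the induction hypothesis applies.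
      have : {ω | (T (k + 1) (Φ ω) ∩ O).Nonempty} = ⋃ n, {ω | N k (T k (Φ ω)) = n} ∩
          {ω | (T k (Φ ω) ∩ (Metric.ball (e n) (r k) ∩ O)).Nonempty} := by
        ext ω
        simp [hT, Set.inter_assoc]
      rw [this]
      exact MeasurableSet.iUnion fun n => ((hNm' k ih) (measurableSet_singleton n)).inter
        (ih _ (Metric.isOpen_ball.inter hO))
  let c : ℕ → Ω → X := fun k ω => e (N k (T k (Φ ω)))
  have hcm : ∀ k, Measurable (c k) := fun k => measurable_from_nat.comp (hNm' k (hTm k))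
  have hcd : ∀ k ω, dist (c k ω) (c (k + 1) ω) ≤ 2 * (1 / 2) ^ k := by
    intro k ω
    -- A point of the set at stage `k + 2` lies in the balls chosen at stages `k` and `k + 1`, so
    -- the two centres are close.
    obtain ⟨x, ⟨_, hx⟩, hx'⟩ := hTne (k + 2) ω
    have h1 : dist x (c k ω) < r k := hx
    have h2 : dist x (c (k + 1) ω) < r (k + 1) := hx'
    have h3 : r (k + 1) = r k * (1 / 2) := pow_succ _ _
    have := hr k
    have := dist_triangle_left (c k ω) (c (k + 1) ω) x
    change _ ≤ 2 * r k
    linarith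
  have hcc : ∀ ω, CauchySeq fun k => c k ω := fun ω =>
    cauchySeq_of_le_geometric _ _ (by norm_num) fun k => hcd k ω
  choose s hs using fun ω => cauchySeq_tendsto_of_complete (hcc ω)
  refine ⟨s, measurable_of_tendsto_metrizable hcm (tendsto_pi_nhds.2 hs), fun ω => ?_⟩
  -- The centres need not lie in `Φ ω`, but points of the shrunken sets do, and they have the same
  -- limit.
  choose x hx using fun k => hTne (k + 1) ω
  have hd : Filter.Tendsto (fun k => dist (x k) (c k ω)) Filter.atTop (nhds 0) := by
    refine squeeze_zero (fun _ => dist_nonneg) (fun k => (hx k).2.le) ?_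
    exact tendsto_pow_atTop_nhds_zero_of_lt_one (by norm_num) (by norm_num)
  refine (hcl ω).mem_of_tendsto ((tendsto_iff_of_dist hd).2 (hs ω))
    (Filter.Eventually.of_forall fun k => hTsub (k + 1) ω (hx k))

/-- A continuous surjective homomorphism of Polish abelian groups has a Borel section. -/
theorem exists_measurable_section {B C : Type*} [AddCommGroup B] [TopologicalSpace B]
    [IsTopologicalAddGroup B] [PolishSpace B] [MeasurableSpace B] [BorelSpace B]
    [AddCommGroup C] [TopologicalSpace C] [PolishSpace C] [MeasurableSpace C] [BorelSpace C]
    (p : B →+ C) (hp : Continuous p) (hs : Function.Surjective p) :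
    ∃ s : C → B, Measurable s ∧ ∀ c, p (s c) = c := by
  refine exists_measurable_selection (fun c => p ⁻¹' {c})
    (fun c => isClosed_singleton.preimage hp) (fun c => hs c) fun O hO => ?_
  -- A Borel surjection of Polish spaces detects Borel sets by their preimages, and the preimage of
  -- `p(O)` is the open set `O + ker p`. No openness of `p` is needed.
  rw [← hp.measurable.measurableSet_preimage_iff_of_surjective hs]
  refine IsOpen.measurableSet ?_
  have : p ⁻¹' {c | (p ⁻¹' {c} ∩ O).Nonempty} = ⋃ k ∈ p.ker, (fun b => b + k) ⁻¹' O := by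
    ext b
    simp only [Set.mem_preimage, Set.mem_ofPred_eq, Set.mem_iUnion, exists_prop]
    constructor
    · rintro ⟨x, hx, hxO⟩
      have hx : p x = p b := hx
      refine ⟨x - b, ?_, by simpa using hxO⟩
      rw [AddMonoidHom.mem_ker, map_sub, hx, sub_self]
    · rintro ⟨k, hk, h⟩
      have hk : p k = 0 := hk
      refine ⟨b + k, ?_, h⟩
      change p (b + k) = p b
      rw [map_add, hk, add_zero]
  rw [this]
  exact isOpen_biUnion fun k _ => hO.preimage (by fun_prop)

end

/-! ### Exactness of the cochain functors and the long exact sequence. -/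

noncomputable section

namespace MatchedPair

variable {G : Type u} [Group G] [TopologicalSpace G] [IsTopologicalGroup G]
  [LocallyCompactSpace G] [SecondCountableTopology G] [T2Space G] [MeasurableSpace G] [BorelSpace G]
  (M : MatchedPair G)

section Lift

variable {A : Type*} [AddCommGroup A] [TopologicalSpace A] [IsTopologicalAddGroup A]
  [DistribMulAction G A] [ContinuousSMul G A]
  {B : Type*} [AddCommGroup B] [TopologicalSpace B] [IsTopologicalAddGroup B]
  [DistribMulAction G B] [ContinuousSMul G B]
  {C : Type*} [AddCommGroup C] [TopologicalSpace C] [IsTopologicalAddGroup C]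
  [DistribMulAction G C] [ContinuousSMul G C]
  (f : A →+[G] B) (hf : Continuous f) (g : B →+[G] C) (hg : Continuous g)

theorem coeFn_mapL {p q : ℕ} (F : M.L A p q) : M.mapL f hf p q F =ᵐ[M.μ p q] fun X => f (F X) :=
  AEEqFun.coeFn_comp _ hf _

theorem mapL_injective (hi : Function.Injective f) (p q : ℕ) :
    Function.Injective (M.mapL f hf p q) := by
  intro F F' h
  refine AEEqFun.ext ?_
  filter_upwards [M.coeFn_mapL f hf F, M.coeFn_mapL f hf F'] with X h1 h2
  exact hi (by rw [← h1, ← h2, h])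

theorem mapL_surjective [PolishSpace A] [PolishSpace B] (hs : Function.Surjective f) (p q : ℕ) :
    Function.Surjective (M.mapL f hf p q) := by
  let : MeasurableSpace A := borel A
  have : BorelSpace A := ⟨rfl⟩
  let : MeasurableSpace B := borel B
  have : BorelSpace B := ⟨rfl⟩
  obtain ⟨s, hsm, hs'⟩ := exists_measurable_section (f : A →+ B) hf hs
  intro F
  refine ⟨AEEqFun.compMeasurable s hsm F, AEEqFun.ext ?_⟩
  filter_upwards [M.coeFn_mapL f hf (AEEqFun.compMeasurable s hsm F),
    AEEqFun.coeFn_compMeasurable s hsm F] with X h1 h2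
  rw [h1, h2]
  exact hs' _

/-- A continuous injection of Polish spaces is a Borel embedding, so its inverse extends from the
image to a Borel map `r` on `B`. If `g ∘ F = 0` almost everywhere, then `r ∘ F` is a preimage of
`F`. -/
theorem mapL_exact [PolishSpace A] [PolishSpace B] (hi : Function.Injective f)
    (h : Function.Exact f g) (p q : ℕ) :
    Function.Exact (M.mapL f hf p q) (M.mapL g hg p q) := by
  let : MeasurableSpace A := borel A
  have : BorelSpace A := ⟨rfl⟩
  let : MeasurableSpace B := borel B
  have : BorelSpace B := ⟨rfl⟩
  obtain ⟨r, hrm, hr⟩ := (hf.measurableEmbedding hi).exists_measurable_extend (g := id)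
    measurable_id fun _ => ⟨0⟩
  intro F
  constructor
  · intro hF
    refine ⟨AEEqFun.compMeasurable r hrm F, AEEqFun.ext ?_⟩
    have h0 := M.coeFn_mapL g hg F
    rw [hF] at h0
    filter_upwards [M.coeFn_mapL f hf (AEEqFun.compMeasurable r hrm F),
      AEEqFun.coeFn_compMeasurable r hrm F, h0, AEEqFun.coeFn_zero (μ := M.μ p q) (β := C)]
      with X h1 h2 h3 h4
    rw [h1, h2]
    obtain ⟨a, ha⟩ := (h _).1 (h3.symm.trans h4)
    rw [Function.comp_apply, ← ha, show r (f a) = a from congrFun hr a]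
  · rintro ⟨F', rfl⟩
    refine AEEqFun.ext ?_
    filter_upwards [M.coeFn_mapL g hg (M.mapL f hf p q F'), M.coeFn_mapL f hf F',
      AEEqFun.coeFn_zero (μ := M.μ p q) (β := C)] with X h1 h2 h3
    rw [h1, h2, h3]
    exact h.apply_apply_eq_zero _

theorem mapD_injective (hi : Function.Injective f) (n : ℕ) :
    Function.Injective (M.mapD f hf n) := fun _ _ h =>
  funext fun x => M.mapL_injective f hf hi _ _ (congrFun h x)

theorem mapD_surjective [PolishSpace A] [PolishSpace B] (hs : Function.Surjective f) (n : ℕ) :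
    Function.Surjective (M.mapD f hf n) := by
  intro F
  choose F' hF' using fun x => M.mapL_surjective f hf hs _ _ (F x)
  exact ⟨F', funext hF'⟩

theorem mapD_exact [PolishSpace A] [PolishSpace B] (hi : Function.Injective f)
    (h : Function.Exact f g) (n : ℕ) : Function.Exact (M.mapD f hf n) (M.mapD g hg n) := by
  intro F
  constructor
  · intro hF
    choose F' hF' using fun x => (M.mapL_exact f hf g hg hi h _ _ (F x)).1 (congrFun hF x)
    exact ⟨F', funext hF'⟩
  · rintro ⟨F', rfl⟩
    exact funext fun x => (M.mapL_exact f hf g hg hi h _ _).apply_apply_eq_zero _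

theorem mapCone_injective (hi : Function.Injective f) (n : ℕ) :
    Function.Injective (M.mapCone f hf n) :=
  (M.mapD_injective f hf hi _).prodMap
    ((M.mapL_injective f hf hi _ _).prodMap (M.mapL_injective f hf hi _ _))

theorem mapCone_surjective [PolishSpace A] [PolishSpace B] (hs : Function.Surjective f) (n : ℕ) :
    Function.Surjective (M.mapCone f hf n) :=
  (M.mapD_surjective f hf hs _).prodMap
    ((M.mapL_surjective f hf hs _ _).prodMap (M.mapL_surjective f hf hs _ _))

theorem mapCone_exact [PolishSpace A] [PolishSpace B] (hi : Function.Injective f)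
    (h : Function.Exact f g) (n : ℕ) :
    Function.Exact (M.mapCone f hf n) (M.mapCone g hg n) := by
  have e0 := M.mapD_exact f hf g hg hi h (n + 1)
  have e1 := M.mapL_exact f hf g hg hi h n 0
  have e2 := M.mapL_exact f hf g hg hi h 0 n
  rintro ⟨F, H₁, H₂⟩
  constructor
  · intro hz
    obtain ⟨F', hF⟩ := (e0 F).1 (congrArg Prod.fst hz)
    obtain ⟨H₁', hH₁⟩ := (e1 H₁).1 (congrArg (fun z => z.2.1) hz)
    obtain ⟨H₂', hH₂⟩ := (e2 H₂).1 (congrArg (fun z => z.2.2) hz)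
    exact ⟨(F', H₁', H₂'), Prod.ext hF (Prod.ext hH₁ hH₂)⟩
  · rintro ⟨⟨F', H₁', H₂'⟩, h'⟩
    rw [← h']
    exact Prod.ext (e0.apply_apply_eq_zero _)
      (Prod.ext (e1.apply_apply_eq_zero _) (e2.apply_apply_eq_zero _))

/-- `D⁰` has only the component `(0, 0)`, which `J` retains. So the cone has no cohomology in degree
`-1`, which is why the long exact sequence begins with `0 → H⁰`. -/
theorem dConeNegOne_injective : Function.Injective (M.dConeNegOne A) := by
  intro F F' h
  funext ⟨⟨p, q⟩, hpq⟩
  obtain ⟨rfl, rfl⟩ : p = 0 ∧ q = 0 := by simpa using hpq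
  exact congrArg (fun z => z.2.1) h

/-- The map of `D⁰(A)` to `M⁰(A)` is natural. -/
theorem mapCone_dConeNegOne (F : M.D A 0) :
    M.mapCone f hf 0 (M.dConeNegOne A F) = M.dConeNegOne B (M.mapD f hf 0 F) :=
  Prod.ext (M.mapD_dD f hf 0 F) rfl

/-- The class of a cocycle. -/
def toH (A : Type*) [AddCommGroup A] [TopologicalSpace A] [IsTopologicalAddGroup A]
    [DistribMulAction G A] [ContinuousSMul G A] (n : ℕ) : M.cocycles A n →+ M.H A n :=
  QuotientAddGroup.mk' _

theorem toH_surjective (n : ℕ) : Function.Surjective (M.toH A n) :=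
  QuotientAddGroup.mk'_surjective _

theorem toH_eq_zero {n : ℕ} {z : M.cocycles A n} :
    M.toH A n z = 0 ↔ (z : M.Cone A n) ∈ M.coboundaries A n := by
  rw [toH, QuotientAddGroup.mk'_apply, QuotientAddGroup.eq_zero_iff, AddSubgroup.mem_addSubgroupOf]

theorem mapH_toH (n : ℕ) (z : M.cocycles A n) :
    M.mapH f hf n (M.toH A n z)
      = M.toH B n ⟨M.mapCone f hf n z, M.mapCone_mem_cocycles f hf n z.2⟩ := rfl

/-- Coboundaries of degree `0` come from `D⁰` and not from a cone. With this case treated here, the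
diagram chases of `mem_coboundaries_of_connecting` and `mapH_i_p_exact` are uniform in the degree.
-/
theorem exists_coboundary_lift [PolishSpace A] [PolishSpace B] (hs : Function.Surjective f) {n : ℕ}
    {z : M.Cone B n} (hz : z ∈ M.coboundaries B n) :
    ∃ w ∈ M.coboundaries A n, M.mapCone f hf n w = z := by
  cases n with
  | zero =>
    obtain ⟨y, rfl⟩ := hz
    obtain ⟨x, rfl⟩ := M.mapD_surjective f hf hs 0 y
    exact ⟨_, ⟨x, rfl⟩, M.mapCone_dConeNegOne f hf x⟩
  | succ n =>
    obtain ⟨y, rfl⟩ := hz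
    obtain ⟨x, rfl⟩ := M.mapCone_surjective f hf hs n y
    exact ⟨_, ⟨x, rfl⟩, M.mapCone_dCone f hf n x⟩

end Lift

section LongExact

open PolishGModule

variable {A B C : PolishGModule.{u, w} G} (S : ShortExact A B C)

theorem mapCone_i_injective (n : ℕ) : Function.Injective (M.mapCone S.i S.continuous_i n) :=
  M.mapCone_injective _ _ S.injective_i n

theorem mapCone_p_surjective (n : ℕ) : Function.Surjective (M.mapCone S.p S.continuous_p n) :=
  M.mapCone_surjective _ _ S.surjective_p n

theorem mapCone_i_p_exact (n : ℕ) :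
    Function.Exact (M.mapCone S.i S.continuous_i n) (M.mapCone S.p S.continuous_p n) :=
  M.mapCone_exact _ _ _ _ S.injective_i S.exact n

theorem dCone_eq_zero {A : Type*} [AddCommGroup A] [TopologicalSpace A] [IsTopologicalAddGroup A]
    [DistribMulAction G A] [ContinuousSMul G A] {n : ℕ} {z : M.Cone A n}
    (hz : z ∈ M.coboundaries A n) : M.dCone A n z = 0 := M.coboundaries_le_cocycles A n hz

/-- After subtraction of a coboundary that lifts `p(y)`, the cochain `y` comes from `A`, and its
preimage has coboundary `x`. This covers both the choice of the lift and the choice of the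
representing cocycle. -/
theorem mem_coboundaries_of_connecting {n : ℕ} {y : M.Cone B.carrier n}
    (hy : M.mapCone S.p S.continuous_p n y ∈ M.coboundaries C.carrier n)
    {x : M.Cone A.carrier (n + 1)}
    (hx : M.mapCone S.i S.continuous_i (n + 1) x = M.dCone B.carrier n y) :
    x ∈ M.coboundaries A.carrier (n + 1) := by
  obtain ⟨w, hw, hwy⟩ := M.exists_coboundary_lift S.p S.continuous_p S.surjective_p hy
  obtain ⟨x', hx'⟩ := (M.mapCone_i_p_exact S n (y - w)).1 (by rw [map_sub, hwy, sub_self])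
  refine ⟨x', M.mapCone_i_injective S _ ?_⟩
  rw [mapCone_dCone, hx', hx, map_sub, M.dCone_eq_zero hw, sub_zero]

theorem mem_cocycles_of_connecting {n : ℕ} {y : M.Cone B.carrier n}
    {x : M.Cone A.carrier (n + 1)}
    (hx : M.mapCone S.i S.continuous_i (n + 1) x = M.dCone B.carrier n y) :
    x ∈ M.cocycles A.carrier (n + 1) := by
  refine M.mapCone_i_injective S _ ?_
  rw [mapCone_dCone, hx, dCone_dCone, map_zero]

theorem exists_connecting {n : ℕ} {y : M.Cone B.carrier n}
    (hy : M.mapCone S.p S.continuous_p n y ∈ M.cocycles C.carrier n) :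
    ∃ x, M.mapCone S.i S.continuous_i (n + 1) x = M.dCone B.carrier n y :=
  (M.mapCone_i_p_exact S (n + 1) _).1 (by rw [mapCone_dCone]; exact hy)

theorem exists_connecting_cocycle {n : ℕ} (z : M.cocycles C.carrier n) :
    ∃ (y : M.Cone B.carrier n) (x : M.cocycles A.carrier (n + 1)),
      M.mapCone S.p S.continuous_p n y = z ∧
      M.mapCone S.i S.continuous_i (n + 1) x = M.dCone B.carrier n y := by
  obtain ⟨y, hy⟩ := M.mapCone_p_surjective S n z
  obtain ⟨x, hx⟩ := M.exists_connecting S (y := y) (by rw [hy]; exact z.2)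
  exact ⟨y, ⟨x, M.mem_cocycles_of_connecting S hx⟩, hy, hx⟩

/-- A lift to `B` of a cocycle with values in `C`. -/
def connectingLift {n : ℕ} (z : M.cocycles C.carrier n) : M.Cone B.carrier n :=
  (M.exists_connecting_cocycle S z).choose

/-- The coboundary of `connectingLift`, as a cocycle with values in `A`. -/
def connectingCocycle {n : ℕ} (z : M.cocycles C.carrier n) : M.cocycles A.carrier (n + 1) :=
  (M.exists_connecting_cocycle S z).choose_spec.choose

theorem mapCone_connectingLift {n : ℕ} (z : M.cocycles C.carrier n) :
    M.mapCone S.p S.continuous_p n (M.connectingLift S z) = z :=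
  (M.exists_connecting_cocycle S z).choose_spec.choose_spec.1

theorem mapCone_connectingCocycle {n : ℕ} (z : M.cocycles C.carrier n) :
    M.mapCone S.i S.continuous_i (n + 1) (M.connectingCocycle S z).1
      = M.dCone B.carrier n (M.connectingLift S z) :=
  (M.exists_connecting_cocycle S z).choose_spec.choose_spec.2

/-- Independence of the chosen lift. Additivity, exactness and naturality then only require some
convenient lift to be exhibited. -/
theorem toH_connectingCocycle {n : ℕ} (z : M.cocycles C.carrier n) {y : M.Cone B.carrier n}
    {x : M.cocycles A.carrier (n + 1)} (hy : M.mapCone S.p S.continuous_p n y = z)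
    (hx : M.mapCone S.i S.continuous_i (n + 1) x = M.dCone B.carrier n y) :
    M.toH _ _ (M.connectingCocycle S z) = M.toH _ _ x := by
  have h : ((M.connectingCocycle S z - x : M.cocycles A.carrier (n + 1)) :
      M.Cone A.carrier (n + 1)) = (M.connectingCocycle S z).1 - x.1 := rfl
  refine sub_eq_zero.1 ((map_sub (M.toH A.carrier (n + 1)) _ _).symm.trans ?_)
  rw [toH_eq_zero, h]
  refine M.mem_coboundaries_of_connecting S (y := M.connectingLift S z - y) ?_ ?_
  · rw [map_sub, mapCone_connectingLift, hy, sub_self]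
    exact zero_mem _
  · rw [map_sub, map_sub, mapCone_connectingCocycle, hx]

/-- The connecting homomorphism on cocycles. -/
def connectingCocycles (n : ℕ) : M.cocycles C.carrier n →+ M.H A.carrier (n + 1) :=
  AddMonoidHom.mk' (fun z => M.toH _ _ (M.connectingCocycle S z)) fun z z' =>
    (M.toH_connectingCocycle S (z + z') (y := M.connectingLift S z + M.connectingLift S z')
      (x := M.connectingCocycle S z + M.connectingCocycle S z')
      ((map_add _ _ _).trans (by
        rw [mapCone_connectingLift, mapCone_connectingLift]; rfl))
      ((map_add (M.mapCone S.i S.continuous_i (n + 1)) (M.connectingCocycle S z).1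
        (M.connectingCocycle S z').1).trans (by
          rw [mapCone_connectingCocycle, mapCone_connectingCocycle, map_add]))).trans
    (map_add (M.toH A.carrier (n + 1)) _ _)

theorem connectingCocycles_eq {n : ℕ} (z : M.cocycles C.carrier n) {y : M.Cone B.carrier n}
    {x : M.cocycles A.carrier (n + 1)} (hy : M.mapCone S.p S.continuous_p n y = z)
    (hx : M.mapCone S.i S.continuous_i (n + 1) x = M.dCone B.carrier n y) :
    M.connectingCocycles S n z = M.toH _ _ x :=
  M.toH_connectingCocycle S z hy hx

/-- The connecting homomorphism `Hⁿ(m.p., C) → Hⁿ⁺¹(m.p., A)` of a short exact sequence. -/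
def connecting (n : ℕ) : M.H C.carrier n →+ M.H A.carrier (n + 1) :=
  QuotientAddGroup.lift _ (M.connectingCocycles S n) <| by
    intro z hz
    obtain ⟨y, x, h1, h2⟩ := M.exists_connecting_cocycle S z
    change M.connectingCocycles S n z = 0
    rw [M.connectingCocycles_eq S z h1 h2, toH_eq_zero]
    exact M.mem_coboundaries_of_connecting S (y := y) (by rw [h1]; exact hz) h2

theorem connecting_toH {n : ℕ} (z : M.cocycles C.carrier n) {y : M.Cone B.carrier n}
    {x : M.cocycles A.carrier (n + 1)} (hy : M.mapCone S.p S.continuous_p n y = z)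
    (hx : M.mapCone S.i S.continuous_i (n + 1) x = M.dCone B.carrier n y) :
    M.connecting S n (M.toH _ _ z) = M.toH _ _ x :=
  M.connectingCocycles_eq S z hy hx

theorem mapH_i_zero_injective : Function.Injective (M.mapH S.i S.continuous_i 0) := by
  rw [injective_iff_map_eq_zero]
  intro α hα
  obtain ⟨x, rfl⟩ := M.toH_surjective 0 α
  rw [mapH_toH, toH_eq_zero] at hα
  obtain ⟨y, hy⟩ := hα
  rw [toH_eq_zero]
  have h0 : M.mapD S.p S.continuous_p 0 y = 0 := by
    apply M.dConeNegOne_injective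
    rw [← mapCone_dConeNegOne, hy, map_zero]
    exact (M.mapCone_i_p_exact S 0).apply_apply_eq_zero _
  obtain ⟨a, rfl⟩ := (M.mapD_exact S.i S.continuous_i S.p S.continuous_p S.injective_i S.exact 0
    y).1 h0
  exact ⟨a, M.mapCone_i_injective S 0 (by rw [mapCone_dConeNegOne, hy])⟩

theorem mapH_i_p_exact (n : ℕ) :
    Function.Exact (M.mapH S.i S.continuous_i n) (M.mapH S.p S.continuous_p n) := by
  intro α
  obtain ⟨y, rfl⟩ := M.toH_surjective n α
  rw [mapH_toH, toH_eq_zero]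
  constructor
  · intro hy
    -- Replacing `y` by the cohomologous `y - w` makes its image in `C` vanish as a cochain, so that
    -- exactness of cochains applies.
    obtain ⟨w, hw, hwy⟩ := M.exists_coboundary_lift S.p S.continuous_p S.surjective_p hy
    obtain ⟨x, hx⟩ := (M.mapCone_i_p_exact S n (y - w)).1 (by rw [map_sub, hwy, sub_self])
    have hxc : x ∈ M.cocycles A.carrier n := by
      refine M.mapCone_i_injective S (n + 1) ?_
      rw [mapCone_dCone, hx, map_sub, M.dCone_eq_zero hw, map_zero, sub_zero]
      exact y.2
    refine ⟨M.toH _ _ ⟨x, hxc⟩, ?_⟩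
    rw [mapH_toH, ← sub_eq_zero, ← map_sub, toH_eq_zero]
    simpa [hx] using hw
  · rintro ⟨β, hβ⟩
    obtain ⟨x, rfl⟩ := M.toH_surjective n β
    rw [mapH_toH, ← sub_eq_zero, ← map_sub, toH_eq_zero] at hβ
    have := M.mapCone_mem_coboundaries S.p S.continuous_p n hβ
    simpa [(M.mapCone_i_p_exact S n).apply_apply_eq_zero] using this

theorem mapH_p_connecting_exact (n : ℕ) :
    Function.Exact (M.mapH S.p S.continuous_p n) (M.connecting S n) := by
  intro α
  constructor
  · intro hα
    obtain ⟨z, rfl⟩ := M.toH_surjective n α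
    obtain ⟨y, x, hy, hx⟩ := M.exists_connecting_cocycle S z
    rw [M.connecting_toH S z hy hx, toH_eq_zero] at hα
    obtain ⟨x', hx'⟩ := hα
    have hc : y - M.mapCone S.i S.continuous_i n x' ∈ M.cocycles B.carrier n := by
      change M.dCone _ _ _ = 0
      rw [map_sub, ← mapCone_dCone, hx', hx, sub_self]
    refine ⟨M.toH _ _ ⟨_, hc⟩, ?_⟩
    rw [mapH_toH]
    congr 1
    apply Subtype.ext
    simp [(M.mapCone_i_p_exact S n).apply_apply_eq_zero, hy]
  · rintro ⟨β, rfl⟩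
    obtain ⟨y, rfl⟩ := M.toH_surjective n β
    -- The cocycle `y` is its own lift and has coboundary zero.
    rw [mapH_toH, M.connecting_toH S _ (y := y) (x := 0) rfl, map_zero]
    simpa using (show M.dCone _ _ _ = 0 from y.2).symm

theorem connecting_mapH_i_exact (n : ℕ) :
    Function.Exact (M.connecting S n) (M.mapH S.i S.continuous_i (n + 1)) := by
  intro α
  constructor
  · intro hα
    obtain ⟨x, rfl⟩ := M.toH_surjective (n + 1) α
    rw [mapH_toH, toH_eq_zero] at hα
    obtain ⟨y, hy⟩ := hα
    have hc : M.mapCone S.p S.continuous_p n y ∈ M.cocycles C.carrier n := by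
      change M.dCone _ _ _ = 0
      rw [← mapCone_dCone, hy]
      exact (M.mapCone_i_p_exact S (n + 1)).apply_apply_eq_zero _
    exact ⟨M.toH _ _ ⟨_, hc⟩, M.connecting_toH S _ rfl hy.symm⟩
  · rintro ⟨β, rfl⟩
    obtain ⟨z, rfl⟩ := M.toH_surjective n β
    obtain ⟨y, x, hy, hx⟩ := M.exists_connecting_cocycle S z
    rw [M.connecting_toH S z hy hx, mapH_toH, toH_eq_zero]
    exact ⟨y, hx.symm⟩

theorem connecting_natural {A' B' C' : PolishGModule.{u, w} G} (S' : ShortExact A' B' C')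
    (a : A.carrier →+[G] A'.carrier) (b : B.carrier →+[G] B'.carrier)
    (c : C.carrier →+[G] C'.carrier) (ha : Continuous a) (hb : Continuous b) (hc : Continuous c)
    (h₁ : ∀ x, b (S.i x) = S'.i (a x)) (h₂ : ∀ x, c (S.p x) = S'.p (b x)) (n : ℕ)
    (α : M.H C.carrier n) :
    M.mapH a ha (n + 1) (M.connecting S n α) = M.connecting S' n (M.mapH c hc n α) := by
  have e₁ : ∀ (p q : ℕ) (F : M.L A.carrier p q), M.mapL b hb p q (M.mapL S.i S.continuous_i p q F)
      = M.mapL S'.i S'.continuous_i p q (M.mapL a ha p q F) := fun p q F => by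
    refine AEEqFun.ext ?_
    filter_upwards [M.coeFn_mapL b hb (M.mapL S.i S.continuous_i p q F),
      M.coeFn_mapL S.i S.continuous_i F,
      M.coeFn_mapL S'.i S'.continuous_i (M.mapL a ha p q F), M.coeFn_mapL a ha F]
      with X k₁ k₂ k₃ k₄
    rw [k₁, k₂, k₃, k₄, h₁]
  have e₂ : ∀ (p q : ℕ) (F : M.L B.carrier p q), M.mapL c hc p q (M.mapL S.p S.continuous_p p q F)
      = M.mapL S'.p S'.continuous_p p q (M.mapL b hb p q F) := fun p q F => by
    refine AEEqFun.ext ?_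
    filter_upwards [M.coeFn_mapL c hc (M.mapL S.p S.continuous_p p q F),
      M.coeFn_mapL S.p S.continuous_p F,
      M.coeFn_mapL S'.p S'.continuous_p (M.mapL b hb p q F), M.coeFn_mapL b hb F]
      with X k₁ k₂ k₃ k₄
    rw [k₁, k₂, k₃, k₄, h₂]
  have e₁' : ∀ n (x : M.Cone A.carrier n), M.mapCone b hb n (M.mapCone S.i S.continuous_i n x)
      = M.mapCone S'.i S'.continuous_i n (M.mapCone a ha n x) := fun n x =>
    Prod.ext (funext fun _ => e₁ _ _ _) (Prod.ext (e₁ _ _ _) (e₁ _ _ _))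
  have e₂' : ∀ n (x : M.Cone B.carrier n), M.mapCone c hc n (M.mapCone S.p S.continuous_p n x)
      = M.mapCone S'.p S'.continuous_p n (M.mapCone b hb n x) := fun n x =>
    Prod.ext (funext fun _ => e₂ _ _ _) (Prod.ext (e₂ _ _ _) (e₂ _ _ _))
  obtain ⟨z, rfl⟩ := M.toH_surjective n α
  obtain ⟨y, x, hy, hx⟩ := M.exists_connecting_cocycle S z
  rw [M.connecting_toH S z hy hx, mapH_toH, mapH_toH]
  refine (M.connecting_toH S' _ (y := M.mapCone b hb n y) ?_ ?_).symm
  · rw [← e₂', hy]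
  · rw [← e₁', hx, mapCone_dCone]

theorem hasNaturalLongExactSequences : HasNaturalLongExactSequences.{u, w} M :=
  ⟨fun S n => M.connecting S n,
    fun S => ⟨M.mapH_i_zero_injective S, fun n => ⟨M.mapH_i_p_exact S n,
      M.mapH_p_connecting_exact S n, M.connecting_mapH_i_exact S n⟩⟩,
    fun S S' a b c ha hb hc h₁ h₂ n α => M.connecting_natural S S' a b c ha hb hc h₁ h₂ n α⟩

end LongExact

end MatchedPair

end

/-! ### `L(G, A)` is a Polish group. -/

noncomputable section

open Filter Topology

namespace LFun

variable {G : Type u} [Group G] [TopologicalSpace G] [IsTopologicalGroup G]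
  [LocallyCompactSpace G] [SecondCountableTopology G] [T2Space G] [MeasurableSpace G] [BorelSpace G]
  {A : Type v} [AddCommGroup A] [TopologicalSpace A] [IsTopologicalAddGroup A]
  [DistribMulAction G A] [ContinuousSMul G A]

/-- A measurable representative of an element of `L(G, A)`. -/
def fn (F : LFun G A) : G → A := AEEqFun.cast F

/-- The class of a measurable function. -/
def ofFun (f : G → A) (hf : AEStronglyMeasurable f (Measure.haar : Measure G)) : LFun G A :=
  AEEqFun.mk f hf

theorem stronglyMeasurable_fn (F : LFun G A) : StronglyMeasurable (fn F) :=
  AEEqFun.stronglyMeasurable F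

theorem fn_ofFun (f : G → A) (hf : AEStronglyMeasurable f (Measure.haar : Measure G)) :
    fn (ofFun f hf) =ᵐ[(Measure.haar : Measure G)] f := AEEqFun.coeFn_mk f hf

theorem ext_fn {F H : LFun G A} (h : fn F =ᵐ[(Measure.haar : Measure G)] fn H) : F = H :=
  AEEqFun.ext h

theorem fn_add (F H : LFun G A) : fn (F + H) =ᵐ[(Measure.haar : Measure G)]
    fun y => fn F y + fn H y := AEEqFun.coeFn_add F H

theorem fn_sub (F H : LFun G A) : fn (F - H) =ᵐ[(Measure.haar : Measure G)]
    fun y => fn F y - fn H y := AEEqFun.coeFn_sub F H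

theorem fn_neg (F : LFun G A) : fn (-F) =ᵐ[(Measure.haar : Measure G)]
    fun y => -fn F y := AEEqFun.coeFn_neg F

theorem fn_zero : fn (0 : LFun G A) =ᵐ[(Measure.haar : Measure G)]
    fun _ => 0 := AEEqFun.coeFn_zero

theorem fn_smul (x : G) (F : LFun G A) : fn (x • F) =ᵐ[(Measure.haar : Measure G)]
    fun y => x • fn F (x⁻¹ * y) := by
  refine (AEEqFun.coeFn_comp (fun a : A => x • a) (continuous_const_smul x) _).trans ?_
  filter_upwards [AEEqFun.coeFn_compQuasiMeasurePreserving F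
    (measurePreserving_mul_left Measure.haar x⁻¹).quasiMeasurePreserving] with y hy
  rw [Function.comp_apply, hy]
  rfl

variable [PolishSpace A]

/-- A bounded metric is small exactly when the metric is. -/
theorem tendsto_min_one_dist_iff {ι X : Type*} [PseudoMetricSpace X] {l : Filter ι} {u : ι → X}
    {a : X} :
    Tendsto (fun n => min 1 (dist (u n) a)) l (𝓝 0) ↔ Tendsto u l (𝓝 a) := by
  rw [tendsto_iff_dist_tendsto_zero (f := u)]
  refine ⟨fun h => ?_, fun h => by simpa using (tendsto_const_nhds (x := (1 : ℝ))).min h⟩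
  refine Tendsto.congr' ?_ h
  filter_upwards [h.eventually_lt_const one_pos] with n hn
  exact min_eq_right ((min_lt_iff.1 hn).resolve_left (lt_irrefl _)).le

theorem integrable_min_one_dist {X : Type*} [MeasurableSpace X] {μ : Measure X} [IsFiniteMeasure μ]
    {E : Type*} [PseudoMetricSpace E] {f g : X → E} (hf : AEStronglyMeasurable f μ)
    (hg : AEStronglyMeasurable g μ) : Integrable (fun y => min 1 (dist (f y) (g y))) μ := by
  refine (integrable_const (1 : ℝ)).mono' (aestronglyMeasurable_const.inf (hf.dist hg))
    (Eventually.of_forall fun y => ?_)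
  rw [Real.norm_of_nonneg (le_min zero_le_one dist_nonneg)]
  exact min_le_left _ _

theorem tendsto_iff_rho {ι : Type*} {l : Filter ι} {u : ι → LFun G A} {F : LFun G A} :
    Tendsto u l (𝓝 F) ↔ Tendsto (fun n => rho (u n) F) l (𝓝 0) :=
  @tendsto_iff_dist_tendsto_zero _ _ pseudoMetricSpace _ _ _

/-- Dominated convergence with the constant bound `1`, for a finite measure with the same null sets
as Haar measure. -/
theorem tendsto_of_ae_tendsto {u : ℕ → LFun G A} {F : LFun G A}
    (h : ∀ᵐ y ∂(Measure.haar : Measure G),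
      Tendsto (fun n => fn (u n) y) atTop (𝓝 (fn F y))) :
    Tendsto u atTop (𝓝 F) := by
  let : MetricSpace A := TopologicalSpace.completelyMetrizableMetric A
  rw [tendsto_iff_rho]
  rw [← ae_toFinite] at h
  have := tendsto_integral_of_dominated_convergence
    (F := fun n y => min 1 (dist (fn (u n) y) (fn F y)))
    (f := fun _ => (0 : ℝ)) (μ := (Measure.haar : Measure G).toFinite) (fun _ => (1 : ℝ))
    (fun n => (integrable_min_one_dist (stronglyMeasurable_fn _).aestronglyMeasurable
      (stronglyMeasurable_fn _).aestronglyMeasurable).1) (integrable_const _)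
    (fun n => Eventually.of_forall fun y => by
      rw [Real.norm_of_nonneg (le_min zero_le_one dist_nonneg)]; exact min_le_left _ _)
    (h.mono fun y hy => tendsto_min_one_dist_iff.2 hy)
  rw [integral_zero] at this
  exact this

theorem exists_subseq_ae_tendsto {u : ℕ → LFun G A} {F : LFun G A} (h : Tendsto u atTop (𝓝 F)) :
    ∃ ns : ℕ → ℕ, StrictMono ns ∧ ∀ᵐ y ∂(Measure.haar : Measure G),
      Tendsto (fun n => fn (u (ns n)) y) atTop (𝓝 (fn F y)) := by
  let : MetricSpace A := TopologicalSpace.completelyMetrizableMetric A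
  have hi := fun n => integrable_min_one_dist (μ := (Measure.haar : Measure G).toFinite)
    (stronglyMeasurable_fn (u n)).aestronglyMeasurable
    (stronglyMeasurable_fn F).aestronglyMeasurable
  have hL : Tendsto (fun n => eLpNorm ((fun y => min 1 (dist (fn (u n) y)
      (fn F y))) - fun _ => (0 : ℝ)) 1 (Measure.haar : Measure G).toFinite)
      atTop (𝓝 0) := by
    have h1 : ∀ n, eLpNorm ((fun y => min 1 (dist (fn (u n) y)
      (fn F y))) - fun _ => (0 : ℝ)) 1 (Measure.haar : Measure G).toFinite
        = ENNReal.ofReal (rho (u n) F) := by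
      intro n
      rw [show ((fun y => min 1 (dist (fn (u n) y) (fn F y))) -
        fun _ => (0 : ℝ)) = fun y => min 1 (dist (fn (u n) y) (fn F y)) by
          ext; simp, eLpNorm_one_eq_lintegral_enorm]
      change _ = ENNReal.ofReal (∫ y, min 1 (dist (fn (u n) y) (fn F y))
        ∂(Measure.haar : Measure G).toFinite)
      rw [ofReal_integral_eq_lintegral_ofReal (hi n)
          (Eventually.of_forall fun y => le_min zero_le_one dist_nonneg)]
      refine lintegral_congr fun y => ?_
      rw [Real.enorm_eq_ofReal (le_min zero_le_one dist_nonneg)]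
    simp_rw [h1]
    simpa using ENNReal.tendsto_ofReal (tendsto_iff_rho.1 h)
  obtain ⟨ns, hns, h2⟩ := (tendstoInMeasure_of_tendsto_eLpNorm one_ne_zero
    (fun n => (hi n).1) aestronglyMeasurable_const hL).exists_seq_tendsto_ae
  rw [ae_toFinite] at h2
  exact ⟨ns, hns, h2.mono fun y hy => tendsto_min_one_dist_iff.1 hy⟩

/-- Convergence in `L(G, A)` means that every subsequence has a further subsequence that converges
almost everywhere. Together with `exists_subseq_ae_tendsto` this reduces continuity of an operation
on `L(G, A)` to its pointwise continuity. -/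
theorem tendsto_of_subseq {u : ℕ → LFun G A} {F : LFun G A}
    (h : ∀ ns : ℕ → ℕ, Tendsto ns atTop atTop → ∃ ms : ℕ → ℕ,
      ∀ᵐ y ∂(Measure.haar : Measure G), Tendsto (fun n => fn (u (ns (ms n))) y) atTop
        (𝓝 (fn F y))) : Tendsto u atTop (𝓝 F) :=
  tendsto_of_subseq_tendsto fun ns hns => by
    obtain ⟨ms, hms⟩ := h ns hns
    exact ⟨ms, tendsto_of_ae_tendsto (u := fun n => u (ns (ms n))) hms⟩

theorem eq_of_rho_eq_zero {F H : LFun G A} (h : rho F H = 0) : F = H := by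
  let : MetricSpace A := TopologicalSpace.completelyMetrizableMetric A
  change ∫ y, min 1 (dist (fn F y) (fn H y)) ∂(Measure.haar : Measure G).toFinite = 0 at h
  rw [integral_eq_zero_iff_of_nonneg (fun y => le_min zero_le_one dist_nonneg)
    (integrable_min_one_dist (stronglyMeasurable_fn _).aestronglyMeasurable
      (stronglyMeasurable_fn _).aestronglyMeasurable)] at h
  have h' : (fun y => min 1 (dist (fn F y) (fn H y))) =ᵐ[(Measure.haar : Measure G)] 0 := by
    rw [Filter.EventuallyEq, ← ae_toFinite]
    exact h
  refine ext_fn ?_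
  filter_upwards [h'] with y hy
  simp only [Pi.zero_apply] at hy
  rcases min_choice 1 (dist (fn F y) (fn H y)) with h1 | h1
  · rw [h1] at hy; exact absurd hy one_ne_zero
  · rw [h1] at hy; exact dist_eq_zero.1 hy

/-- The metric `ρ_μ` on `L(G, A)`. -/
abbrev metricSpace : MetricSpace (LFun G A) :=
  { pseudoMetricSpace with eq_of_dist_eq_zero := eq_of_rho_eq_zero }

instance : TopologicalSpace.MetrizableSpace (LFun G A) :=
  @EMetricSpace.metrizableSpace _ metricSpace.toEMetricSpace

/-- Summable distances make a sequence converge almost everywhere. -/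
theorem ae_summable_of_rho_le {u : ℕ → LFun G A} {H : ℕ → LFun G A} {b : ℕ → ℝ} (hb : Summable b)
    (h : ∀ n, rho (u n) (H n) ≤ b n) :
    letI : MetricSpace A := TopologicalSpace.completelyMetrizableMetric A
    ∀ᵐ y ∂(Measure.haar : Measure G),
      Summable fun n => min 1 (dist (fn (u n) y) (fn (H n) y)) := by
  let : MetricSpace A := TopologicalSpace.completelyMetrizableMetric A
  have hi := fun n => integrable_min_one_dist (μ := (Measure.haar : Measure G).toFinite)
    (stronglyMeasurable_fn (u n)).aestronglyMeasurable
    (stronglyMeasurable_fn (H n)).aestronglyMeasurable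
  have h0 : ∀ n y, 0 ≤ min 1 (dist (fn (u n) y) (fn (H n) y)) :=
    fun n y => le_min zero_le_one dist_nonneg
  have h1 : ∫⁻ y, ∑' n, ENNReal.ofReal (min 1 (dist (fn (u n) y)
      (fn (H n) y))) ∂(Measure.haar : Measure G).toFinite ≠ ⊤ := by
    rw [lintegral_tsum fun n => (hi n).1.aemeasurable.ennreal_ofReal]
    have h2 : ∀ n, ∫⁻ y, ENNReal.ofReal (min 1 (dist (fn (u n) y)
        (fn (H n) y))) ∂(Measure.haar : Measure G).toFinite ≤ ENNReal.ofReal (b n) := by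
      intro n
      rw [← ofReal_integral_eq_lintegral_ofReal (hi n) (Eventually.of_forall (h0 n))]
      exact ENNReal.ofReal_le_ofReal (h n)
    exact ne_top_of_le_ne_top hb.tsum_ofReal_ne_top (ENNReal.tsum_le_tsum h2)
  have h2 := ae_lt_top' (AEMeasurable.tsum
    fun n => (hi n).1.aemeasurable.ennreal_ofReal) h1
  rw [ae_toFinite] at h2
  filter_upwards [h2] with y hy
  have := ENNReal.summable_toReal hy.ne
  simpa only [ENNReal.toReal_ofReal (h0 _ y)] using this

theorem summable_of_min_one {b : ℕ → ℝ} (hb : Summable fun n => min 1 (b n)) : Summable b := by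
  have h := hb.tendsto_atTop_zero.eventually_lt_const one_pos
  refine (summable_congr_atTop (f₁ := b) (h.mono fun n hn => ?_)).2 hb
  exact (min_eq_right ((min_lt_iff.1 hn).resolve_left (lt_irrefl _)).le).symm

/-- It suffices to treat sequences whose successive distances are at most `2⁻ⁿ`. For these the
pointwise distances are summable almost everywhere, so the values are Cauchy in `A` and the
pointwise limit is measurable. -/
theorem completeSpace : @CompleteSpace (LFun G A) pseudoMetricSpace.toUniformSpace := by
  let : PseudoMetricSpace (LFun G A) := pseudoMetricSpace
  refine Metric.complete_of_convergent_controlled_sequences (fun n => (1 / 2 : ℝ) ^ n)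
    (fun n => by positivity) fun u hu => ?_
  let : MetricSpace A := TopologicalSpace.completelyMetrizableMetric A
  have : CompleteSpace A := TopologicalSpace.complete_completelyMetrizableMetric A
  have h := ae_summable_of_rho_le (u := u) (H := fun n => u (n + 1)) (summable_geometric_two)
    (fun n => (hu n n (n + 1) le_rfl n.le_succ).le)
  have hc : ∀ᵐ y ∂(Measure.haar : Measure G),
      ∃ a, Tendsto (fun n => fn (u n) y) atTop (𝓝 a) := by
    filter_upwards [h] with y hy
    exact cauchySeq_tendsto_of_complete (cauchySeq_of_summable_dist (summable_of_min_one hy))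
  obtain ⟨f, hf, hf'⟩ := exists_stronglyMeasurable_limit_of_tendsto_ae
    (fun n => (stronglyMeasurable_fn (u n)).aestronglyMeasurable) hc
  refine ⟨ofFun f hf.aestronglyMeasurable, ?_⟩
  refine tendsto_of_ae_tendsto (F := (ofFun f hf.aestronglyMeasurable : LFun G A)) ?_
  filter_upwards [hf', fn_ofFun f hf.aestronglyMeasurable] with y h1 h2
  rw [h2]
  exact h1

instance : IsTopologicalAddGroup (LFun G A) where
  continuous_add := by
    refine continuous_iff_seqContinuous.2 fun u F hu => ?_
    refine tendsto_of_subseq fun ns hns => ?_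
    have h1 := ((continuous_fst.tendsto F).comp hu).comp hns
    obtain ⟨ms, hms, h1⟩ := exists_subseq_ae_tendsto h1
    have h2 := (((continuous_snd.tendsto F).comp hu).comp hns).comp hms.tendsto_atTop
    obtain ⟨ks, hks, h2⟩ := exists_subseq_ae_tendsto h2
    refine ⟨ms ∘ ks, ?_⟩
    filter_upwards [h1, h2, fn_add F.1 F.2,
      ae_all_iff.2 fun n => fn_add (u n).1 (u n).2] with y h1 h2 h3 h4
    simp only [Function.comp_apply] at h1 h2 ⊢
    simp_rw [h4, h3]
    exact (h1.comp hks.tendsto_atTop).add h2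
  continuous_neg := by
    refine continuous_iff_seqContinuous.2 fun u F hu => ?_
    refine tendsto_of_subseq fun ns hns => ?_
    obtain ⟨ms, hms, h1⟩ := exists_subseq_ae_tendsto (hu.comp hns)
    refine ⟨ms, ?_⟩
    filter_upwards [h1, fn_neg F, ae_all_iff.2 fun n => fn_neg (u n)] with y h1 h3 h4
    simp only [Function.comp_apply] at h1 ⊢
    simp_rw [h4, h3]
    exact h1.neg

/-- The function with values in a dense sequence of `A` whose index is the integer part of `g`. -/
def ofIndex (g : Lp ℝ 1 (Measure.haar : Measure G).toFinite) : LFun G A :=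
  ofFun (fun y => TopologicalSpace.denseSeq A ⌊g y⌋₊) <| by
    let : MeasurableSpace A := borel A
    have : BorelSpace A := ⟨rfl⟩
    exact (measurable_from_nat.comp
      (Nat.measurable_floor.comp (Lp.stronglyMeasurable g).measurable)).aestronglyMeasurable

/-- Separability of `L(G, A)` is inherited from real `L¹`. On functions with natural values,
convergence at a point means that the values are eventually constant, so any substitution of the
index, here by a dense sequence of `A`, preserves almost everywhere convergence. -/
theorem continuous_ofIndex : Continuous fun g : {g : Lp ℝ 1 (Measure.haar : Measure G).toFinite //
    ∀ᵐ y ∂(Measure.haar : Measure G), ∃ n : ℕ, g y = n} => (ofIndex g.1 : LFun G A) := by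
  refine continuous_iff_seqContinuous.2 fun u F hu => ?_
  refine tendsto_of_subseq fun ns hns => ?_
  have h1 := tendstoInMeasure_of_tendsto_Lp (((continuous_subtype_val.tendsto F).comp hu).comp hns)
  obtain ⟨ms, hms, h1⟩ := h1.exists_seq_tendsto_ae
  rw [ae_toFinite] at h1
  refine ⟨ms, ?_⟩
  filter_upwards [h1, F.2, ae_all_iff.2 fun n => (u n).2, fn_ofFun
    (fun y => TopologicalSpace.denseSeq A ⌊F.1 y⌋₊) _, ae_all_iff.2 fun n => fn_ofFun
    (fun y => TopologicalSpace.denseSeq A ⌊(u n).1 y⌋₊) _] with y h1 h2 h3 h4 h5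
  rw [show fn (ofIndex F.1) y = _ from h4]
  have h6 := fun n => show fn (ofIndex (u n).1) y = _ from h5 n
  simp_rw [Function.comp_apply] at h1
  change Tendsto (fun n => fn (ofIndex (u (ns (ms n))).1) y) atTop _
  simp_rw [h6]
  obtain ⟨k, hk⟩ := h2
  refine tendsto_const_nhds.congr' ?_
  rw [hk] at h1 ⊢
  filter_upwards [h1.eventually (Metric.ball_mem_nhds (k : ℝ) one_pos)] with n hn
  obtain ⟨j, hj⟩ := h3 (ns (ms n))
  rw [hj] at hn
  have hn : dist j k < 1 := hn
  rw [hj]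
  have : j = k := by
    by_contra h
    exact absurd hn (not_lt.2 (Nat.pairwise_one_le_dist h))
  rw [this]

theorem denseRange_ofIndex :
    DenseRange fun g : {g : Lp ℝ 1 (Measure.haar : Measure G).toFinite //
      ∀ᵐ y ∂(Measure.haar : Measure G), ∃ n : ℕ, g y = n} => (ofIndex g.1 : LFun G A) := by
  let : MetricSpace A := TopologicalSpace.completelyMetrizableMetric A
  let : MeasurableSpace A := borel A
  have : BorelSpace A := ⟨rfl⟩
  intro F
  have hF := (stronglyMeasurable_fn F).measurable
  have hex : ∀ (j : ℕ) (y : G), ∃ k, dist (fn F y) (TopologicalSpace.denseSeq A k)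
      < (1 / 2 : ℝ) ^ j := fun j y =>
    (TopologicalSpace.denseRange_denseSeq A).exists_dist_lt _ (by positivity)
  classical
  let k : ℕ → G → ℕ := fun j y => Nat.find (hex j y)
  have hk : ∀ j, Measurable (k j) := fun j => measurable_find (hex j) fun n =>
    measurableSet_lt (hF.dist measurable_const) measurable_const
  have hm : ∀ j, Measurable fun y => TopologicalSpace.denseSeq A (k j y) := fun j =>
    measurable_from_nat.comp (hk j)
  have h1 : ∀ j, (ofFun (fun y => TopologicalSpace.denseSeq A (k j y))
      (hm j).aestronglyMeasurable : LFun G A) ∈ closure (Set.range fun g :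
        {g : Lp ℝ 1 (Measure.haar : Measure G).toFinite //
          ∀ᵐ y ∂(Measure.haar : Measure G), ∃ n : ℕ, g y = n} => (ofIndex g.1 : LFun G A)) := by
    intro j
    -- The index function `k j` need not be integrable. Its truncations at `K` are bounded, and at
    -- each point they agree with it for large `K`.
    have hL : ∀ K : ℕ, MemLp (fun y => ((min (k j y) K : ℕ) : ℝ)) 1
        (Measure.haar : Measure G).toFinite := fun K =>
      MemLp.of_bound (measurable_from_nat.comp ((hk j).min measurable_const)).aestronglyMeasurable
        K (Eventually.of_forall fun y => by
          rw [Real.norm_natCast]; exact_mod_cast min_le_right _ _)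
    have hLc : ∀ K : ℕ, (hL K).toLp _ =ᵐ[(Measure.haar : Measure G)]
        fun y => ((min (k j y) K : ℕ) : ℝ) := fun K => by
      have := (hL K).coeFn_toLp
      rwa [Filter.EventuallyEq, ae_toFinite] at this
    refine mem_closure_of_tendsto (b := (atTop : Filter ℕ)) (f := fun K : ℕ => (ofIndex ((hL K).toLp _) :
      LFun G A)) (tendsto_of_ae_tendsto ?_) (Eventually.of_forall fun K =>
        ⟨⟨(hL K).toLp _, (hLc K).mono fun y hy => ⟨_, hy⟩⟩, rfl⟩)
    filter_upwards [ae_all_iff.2 hLc, fn_ofFun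
      (fun y => TopologicalSpace.denseSeq A (k j y)) (hm j).aestronglyMeasurable,
      ae_all_iff.2 fun K : ℕ => fn_ofFun
        (fun y => TopologicalSpace.denseSeq A ⌊((hL K).toLp _ : G → ℝ) y⌋₊) _] with y h1 h2 h3
    rw [h2]
    have h4 := fun K : ℕ => show fn (ofIndex ((hL K).toLp _)) y = _ from h3 K
    simp_rw [h4, h1, Nat.floor_natCast]
    refine tendsto_const_nhds.congr' ?_
    filter_upwards [eventually_ge_atTop (k j y)] with K hK
    rw [min_eq_left hK]
  rw [← closure_closure]
  refine mem_closure_of_tendsto (tendsto_of_ae_tendsto ?_) (Eventually.of_forall h1)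
  filter_upwards [ae_all_iff.2 fun j => fn_ofFun
      (fun y => TopologicalSpace.denseSeq A (k j y)) (hm j).aestronglyMeasurable] with y h2
  simp_rw [h2]
  rw [tendsto_iff_dist_tendsto_zero]
  refine squeeze_zero (fun _ => dist_nonneg) (fun j => ?_)
    (tendsto_pow_atTop_nhds_zero_of_lt_one (r := (1 / 2 : ℝ)) (by norm_num) (by norm_num))
  rw [dist_comm]
  exact (Nat.find_spec (hex j y)).le

instance : SecondCountableTopology (LFun G A) := by
  have : Fact ((1 : ENNReal) ≠ ⊤) := ⟨ENNReal.one_ne_top⟩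
  have : SecondCountableTopology (Lp ℝ 1 (Measure.haar : Measure G).toFinite) := inferInstance
  have : TopologicalSpace.SeparableSpace (LFun G A) :=
    denseRange_ofIndex.separableSpace continuous_ofIndex
  let := pseudoMetricSpace (G := G) (A := A)
  exact UniformSpace.secondCountable_of_separable _

instance : PolishSpace (LFun G A) where
  complete := ⟨metricSpace, rfl, completeSpace⟩

end LFun

end

/-! ### Continuity of the action on `L(G, A)`, and the correspondence between maps to `L(G, A)` and
functions of two variables. -/

noncomputable section

open Filter Topology
open scoped symmDiff Pointwise

/-- Convergence in measure on compact sets implies convergence in any absolutely continuous finite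
measure. -/
theorem tendstoInMeasure_of_isCompact {X E : Type*} [TopologicalSpace X] [MeasurableSpace X]
    [OpensMeasurableSpace X] [T2Space X] [PseudoMetricSpace E] {μ m : Measure X} [IsFiniteMeasure m]
    [m.InnerRegularCompactLTTop] [SigmaFinite μ] (hm : m ≪ μ) {f : ℕ → X → E} {g : X → E}
    (h : ∀ K, IsCompact K → TendstoInMeasure (μ.restrict K) f atTop g) :
    TendstoInMeasure m f atTop g := by
  intro ε hε
  rw [ENNReal.tendsto_nhds_zero]
  intro η hη
  have hη2 : η / 2 ≠ 0 := (ENNReal.half_pos hη.ne').ne'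
  -- `K` carries `m` up to `η / 2`. Inside `K`, a set of small `μ`-measure has small `m`-measure
  -- because the density of `m` is integrable.
  obtain ⟨K, -, hK, hKm⟩ := MeasurableSet.univ.exists_isCompact_sdiff_lt (measure_ne_top m _) hη2
  obtain ⟨δ, hδ, hδ'⟩ := exists_pos_setLIntegral_lt_of_measure_lt (μ := μ) (f := m.rnDeriv μ)
    (Measure.lintegral_rnDeriv_lt_top m μ).ne hη2
  filter_upwards [(h K hK ε hε).eventually_lt_const hδ] with n hn
  rw [Measure.restrict_apply' hK.measurableSet] at hn
  have h1 := hδ' _ hn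
  have h2 : m ({x | ε ≤ edist (f n x) (g x)} ∩ K) ≤ η / 2 := by
    rw [← Measure.setLIntegral_rnDeriv hm]
    exact h1.le
  calc m {x | ε ≤ edist (f n x) (g x)}
      ≤ m (({x | ε ≤ edist (f n x) (g x)} ∩ K) ∪ (Set.univ \ K)) := measure_mono fun x hx => by
        by_cases hxK : x ∈ K
        · exact Or.inl ⟨hx, hxK⟩
        · exact Or.inr ⟨trivial, hxK⟩
    _ ≤ η / 2 + η / 2 := (measure_union_le _ _).trans (add_le_add h2 hKm.le)
    _ = η := ENNReal.add_halves η

namespace LFun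

variable {G : Type u} [Group G] [TopologicalSpace G] [IsTopologicalGroup G]
  [LocallyCompactSpace G] [SecondCountableTopology G] [T2Space G] [MeasurableSpace G] [BorelSpace G]
  {A : Type v} [AddCommGroup A] [TopologicalSpace A] [IsTopologicalAddGroup A]
  [DistribMulAction G A] [ContinuousSMul G A]

/-- Left translates of a measurable function vary continuously in measure on compact sets. -/
theorem tendstoInMeasure_translate {E : Type*} [PseudoMetricSpace E]
    [TopologicalSpace.SeparableSpace E] [MeasurableSpace E] [OpensMeasurableSpace E]
    [Nonempty E] {f : G → E} (hf : Measurable f)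
    {x : ℕ → G} {x₀ : G} (hx : Tendsto x atTop (𝓝 x₀)) {K : Set G} (hK : IsCompact K) :
    TendstoInMeasure ((Measure.haar : Measure G).restrict K) (fun n y => f ((x n)⁻¹ * y)) atTop
      fun y => f (x₀⁻¹ * y) := by
  have hKx : IsCompact ((fun y => x₀⁻¹ * y) '' K) := hK.image (by fun_prop)
  set K' := (fun y => x₀⁻¹ * y) '' K
  intro ε hε
  rw [ENNReal.tendsto_nhds_zero]
  intro η hη
  have hη2 : 0 < η / 2 := ENNReal.half_pos hη.ne'
  have hε2 : 0 < ε / 2 := ENNReal.half_pos hε.ne'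
  -- On each `S k` the function `f` varies by less than `ε`. Finitely many of them cover `K'` up to
  -- measure `η / 2`, and the translates of each `S k` vary continuously in measure.
  let S : ℕ → Set G := fun k =>
    f ⁻¹' Metric.eball (TopologicalSpace.denseSeq E k) (ε / 2) ∩ K'
  have hSm : ∀ k, MeasurableSet (S k) := fun k =>
    (hf Metric.isOpen_eball.measurableSet).inter hKx.measurableSet
  have hSf : ∀ k, (Measure.haar : Measure G) (S k) ≠ ⊤ := fun k =>
    ne_top_of_le_ne_top hKx.measure_ne_top (measure_mono Set.inter_subset_right)
  have hcov : ∀ y ∈ K', ∃ k, y ∈ S k := fun y hy => by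
    obtain ⟨k, hk⟩ := (TopologicalSpace.denseRange_denseSeq E).exists_mem_open
      (Metric.isOpen_eball (x := f y) (ε := ε / 2)) ⟨_, Metric.mem_eball_self hε2⟩
    exact ⟨k, by rwa [Set.mem_preimage, Metric.mem_eball'], hy⟩
  have hlim : Tendsto (fun N => (Measure.haar : Measure G) (K' \ ⋃ k < N, S k)) atTop (𝓝 0) := by
    have := tendsto_measure_iInter_atTop (μ := (Measure.haar : Measure G))
      (s := fun N => K' \ ⋃ k < N, S k)
      (fun N => (hKx.measurableSet.diff
        (MeasurableSet.iUnion fun k => MeasurableSet.iUnion fun _ => hSm k)).nullMeasurableSet)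
      (fun N N' h => Set.sdiff_subset_sdiff_right
        (Set.biUnion_subset_biUnion_left fun k (hk : k < N) => lt_of_lt_of_le hk h))
      ⟨0, ne_top_of_le_ne_top hKx.measure_ne_top (measure_mono Set.sdiff_subset)⟩
    rwa [show ⋂ N, K' \ ⋃ k < N, S k = ∅ from ?_, measure_empty] at this
    refine Set.eq_empty_of_forall_notMem fun y hy => ?_
    rw [Set.mem_iInter] at hy
    obtain ⟨k, hk⟩ := hcov y (hy 0).1
    exact (hy (k + 1)).2 (Set.mem_biUnion (x := k) (Nat.lt_succ_self k) hk)
  obtain ⟨N, hN⟩ := (hlim.eventually_lt_const hη2).exists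
  let T : G → C(G, G) := ContinuousMap.curry ⟨fun p : G × G => p.1⁻¹ * p.2, by fun_prop⟩
  have hT : Tendsto (fun n => T (x n)) atTop (𝓝 (T x₀)) :=
    ((ContinuousMap.curry _).continuous.tendsto x₀).comp hx
  have hs : ∀ k, Tendsto (fun n => (Measure.haar : Measure G) ((T (x n) ⁻¹' S k) ∆ (T x₀ ⁻¹' S k)))
      atTop (𝓝 0) := fun k =>
    tendsto_measure_symmDiff_preimage_nhds_zero hT
      (Eventually.of_forall fun n => measurePreserving_mul_left Measure.haar (x n)⁻¹)
      (measurePreserving_mul_left Measure.haar x₀⁻¹) (hSm k).nullMeasurableSet (hSf k)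
  have hsum := tendsto_finsetSum (Finset.range N) fun k _ => hs k
  rw [Finset.sum_const_zero] at hsum
  filter_upwards [hsum.eventually_lt_const hη2] with n hn
  rw [Measure.restrict_apply' hK.measurableSet]
  calc (Measure.haar : Measure G) ({y | ε ≤ edist (f ((x n)⁻¹ * y)) (f (x₀⁻¹ * y))} ∩ K)
      ≤ (Measure.haar : Measure G) ((fun y => x₀⁻¹ * y) ⁻¹' (K' \ ⋃ k < N, S k) ∪
          ⋃ k ∈ Finset.range N, (T (x n) ⁻¹' S k) ∆ (T x₀ ⁻¹' S k)) := measure_mono ?_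
    _ ≤ η / 2 + η / 2 := by
        refine (measure_union_le _ _).trans (add_le_add ?_ ?_)
        · rw [measure_preimage_mul]; exact hN.le
        · exact (measure_biUnion_finset_le _ _).trans hn.le
    _ = η := ENNReal.add_halves η
  rintro y ⟨hy, hyK⟩
  have hyK' : x₀⁻¹ * y ∈ K' := ⟨y, hyK, rfl⟩
  -- If `x₀⁻¹y` and `(x n)⁻¹y` lay in one `S k`, the two values of `f` would be closer than `ε`. So
  -- a bad `y` lies in a symmetric difference or is not covered at all.
  by_cases hc : x₀⁻¹ * y ∈ ⋃ k < N, S k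
  · simp only [Set.mem_iUnion, exists_prop] at hc
    obtain ⟨k, hk, hyk⟩ := hc
    refine Or.inr (Set.mem_biUnion (Finset.mem_range.2 hk) (Or.inr ⟨hyk, fun h' => ?_⟩))
    have h1 : edist (f ((x n)⁻¹ * y)) (TopologicalSpace.denseSeq E k) < ε / 2 := h'.1
    have h2 : edist (f (x₀⁻¹ * y)) (TopologicalSpace.denseSeq E k) < ε / 2 := hyk.1
    have h3 := (edist_triangle_right (f ((x n)⁻¹ * y)) (f (x₀⁻¹ * y))
      (TopologicalSpace.denseSeq E k)).trans_lt (ENNReal.add_lt_add h1 h2)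
    rw [ENNReal.add_halves] at h3
    exact absurd h3 (not_lt.2 hy)
  · exact Or.inl ⟨hyK', hc⟩

variable [PolishSpace A]

theorem tendstoInMeasure_of_tendsto {u : ℕ → LFun G A} {F : LFun G A}
    (h : Tendsto u atTop (𝓝 F)) {K : Set G} (hK : IsCompact K) :
    letI : MetricSpace A := TopologicalSpace.completelyMetrizableMetric A
    TendstoInMeasure ((Measure.haar : Measure G).restrict K) (fun n => fn (u n)) atTop (fn F) := by
  let : MetricSpace A := TopologicalSpace.completelyMetrizableMetric A
  have : IsFiniteMeasure ((Measure.haar : Measure G).restrict K) :=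
    ⟨by rw [Measure.restrict_apply_univ]; exact hK.measure_lt_top⟩
  rw [exists_seq_tendstoInMeasure_atTop_iff fun n => (stronglyMeasurable_fn _).aestronglyMeasurable]
  intro ns hns
  obtain ⟨ms, hms, h'⟩ := exists_subseq_ae_tendsto (h.comp hns.tendsto_atTop)
  exact ⟨ms, hms, ae_restrict_of_ae h'⟩

/-- The triangle inequality through `F((x n)⁻¹y)` separates the translation of a fixed function from
the variation of the function. The finite measure that defines the topology need not be translation
invariant, so the estimates are made for Haar measure on compact sets. In the second one,
translation moves `K` into `V⁻¹K` for a compact neighbourhood `V` of `x₀`. -/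
theorem exists_subseq_ae_tendsto_translate {u : ℕ → LFun G A} {F : LFun G A}
    (h : Tendsto u atTop (𝓝 F)) {x : ℕ → G} {x₀ : G} (hx : Tendsto x atTop (𝓝 x₀)) :
    ∃ ns : ℕ → ℕ, StrictMono ns ∧ ∀ᵐ y ∂(Measure.haar : Measure G),
      Tendsto (fun n => fn (u (ns n)) ((x (ns n))⁻¹ * y)) atTop (𝓝 (fn F (x₀⁻¹ * y))) := by
  let : MetricSpace A := TopologicalSpace.completelyMetrizableMetric A
  let : MeasurableSpace A := borel A
  have : BorelSpace A := ⟨rfl⟩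
  have hloc : ∀ K, IsCompact K → TendstoInMeasure ((Measure.haar : Measure G).restrict K)
      (fun n y => fn (u n) ((x n)⁻¹ * y)) atTop fun y => fn F (x₀⁻¹ * y) := by
    intro K hK
    have h1 := tendstoInMeasure_translate (stronglyMeasurable_fn F).measurable hx hK
    obtain ⟨V, hV, hVx⟩ := exists_compact_mem_nhds x₀
    have hK' : IsCompact (V⁻¹ * K) := hV.inv.mul hK
    have h2 := tendstoInMeasure_of_tendsto h hK'
    intro ε hε
    have hε2 : 0 < ε / 2 := ENNReal.half_pos hε.ne'
    have h12 := (h1 _ hε2).add (h2 _ hε2)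
    rw [add_zero] at h12
    refine tendsto_of_tendsto_of_tendsto_of_le_of_le' tendsto_const_nhds h12
      (Eventually.of_forall fun _ => zero_le) ?_
    filter_upwards [hx hVx] with n hn
    rw [Measure.restrict_apply' hK.measurableSet, Measure.restrict_apply' hK.measurableSet,
      Measure.restrict_apply' hK'.measurableSet, add_comm (Measure.haar _),
      ← measure_preimage_mul (Measure.haar : Measure G) (x n)⁻¹ (_ ∩ (V⁻¹ * K))]
    refine (measure_mono ?_).trans (measure_union_le _ _)
    rintro y ⟨hy, hyK⟩
    by_contra hc
    simp only [Set.mem_union, Set.mem_inter_iff, Set.mem_preimage, Set.mem_ofPred_eq, hyK, and_true,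
      not_or, not_le, not_and] at hc
    have h3 := hc.1
    have h4 : edist (fn (u n) ((x n)⁻¹ * y)) (fn F ((x n)⁻¹ * y)) < ε / 2 := by
      by_contra h5
      exact h3 (not_lt.1 h5) (Set.mul_mem_mul (Set.inv_mem_inv.2 hn) hyK)
    have h6 := (edist_triangle _ (fn F ((x n)⁻¹ * y)) _).trans_lt (ENNReal.add_lt_add h4 hc.2)
    rw [ENNReal.add_halves] at h6
    exact absurd h6 (not_lt.2 hy)
  obtain ⟨ns, hns, h'⟩ := (tendstoInMeasure_of_isCompact
    (toFinite_absolutelyContinuous (μ := (Measure.haar : Measure G))) hloc).exists_seq_tendsto_ae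
  rw [ae_toFinite] at h'
  exact ⟨ns, hns, h'⟩

instance : ContinuousSMul G (LFun G A) where
  continuous_smul := by
    refine continuous_iff_seqContinuous.2 fun u F hu => ?_
    refine tendsto_of_subseq fun ns hns => ?_
    have h1 := ((continuous_fst.tendsto F).comp hu).comp hns
    have h2 := ((continuous_snd.tendsto F).comp hu).comp hns
    obtain ⟨ms, hms, h3⟩ := exists_subseq_ae_tendsto_translate h2 h1
    refine ⟨ms, ?_⟩
    filter_upwards [h3, fn_smul F.1 F.2, ae_all_iff.2 fun n => fn_smul (u n).1 (u n).2]
      with y h3 h4 h5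
    simp only [Function.comp_apply] at h1 h3 ⊢
    simp_rw [h4, h5]
    exact (h1.comp hms.tendsto_atTop).smul h3

/-- Point evaluation on `L(G, A)` has a jointly measurable version. -/
theorem exists_measurable_eval (G : Type u) [Group G] [TopologicalSpace G] [IsTopologicalGroup G]
    [LocallyCompactSpace G] [SecondCountableTopology G] [T2Space G] [MeasurableSpace G]
    [BorelSpace G] (A : Type v) [AddCommGroup A] [TopologicalSpace A] [IsTopologicalAddGroup A]
    [DistribMulAction G A] [ContinuousSMul G A] [PolishSpace A]
    [MeasurableSpace (LFun G A)] [BorelSpace (LFun G A)] :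
    ∃ ev : LFun G A × G → A, StronglyMeasurable ev ∧
      ∀ F, (fun y => ev (F, y)) =ᵐ[(Measure.haar : Measure G)] fn F := by
  let : MetricSpace A := TopologicalSpace.completelyMetrizableMetric A
  let : MeasurableSpace A := borel A
  have : BorelSpace A := ⟨rfl⟩
  let : MetricSpace (LFun G A) := metricSpace
  have hex : ∀ (j : ℕ) (F : LFun G A), ∃ k, dist F (TopologicalSpace.denseSeq (LFun G A) k)
      < (1 / 2 : ℝ) ^ j := fun j F =>
    (TopologicalSpace.denseRange_denseSeq _).exists_dist_lt _ (by positivity)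
  classical
  let k : ℕ → LFun G A → ℕ := fun j F => Nat.find (hex j F)
  have hk : ∀ j, Measurable (k j) := fun j => measurable_find (hex j) fun n =>
    measurableSet_lt (measurable_id.dist measurable_const) measurable_const
  have hkd : ∀ j F, dist F (TopologicalSpace.denseSeq (LFun G A) (k j F)) < (1 / 2 : ℝ) ^ j :=
    fun j F => Nat.find_spec (hex j F)
  let e : ℕ → LFun G A × G → A := fun j z => fn (TopologicalSpace.denseSeq (LFun G A) (k j z.1)) z.2
  have he : ∀ j, StronglyMeasurable (e j) := fun j => by
    have h1 : Measurable fun z : ℕ × G => fn (TopologicalSpace.denseSeq (LFun G A) z.1) z.2 :=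
      measurable_from_prod_countable_right fun n =>
        (stronglyMeasurable_fn (TopologicalSpace.denseSeq (LFun G A) n)).measurable
    exact (h1.comp (((hk j).comp measurable_fst).prodMk measurable_snd)).stronglyMeasurable
  refine ⟨_, StronglyMeasurable.limUnder (l := atTop) he, fun F => ?_⟩
  -- The approximants converge to `F` at the rate `2⁻ʲ`, hence almost everywhere and not only in
  -- measure. At such points `limUnder` returns the value of `F`.
  have h := ae_summable_of_rho_le (u := fun j => TopologicalSpace.denseSeq (LFun G A) (k j F))
    (H := fun _ => F) summable_geometric_two
    (fun j => (by rw [dist_comm]; exact (hkd j F).le :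
      dist (TopologicalSpace.denseSeq (LFun G A) (k j F)) F ≤ (1 / 2 : ℝ) ^ j))
  filter_upwards [h] with y hy
  exact (tendsto_min_one_dist_iff.1 hy.tendsto_atTop_zero).limUnder_eq

/-- A jointly measurable function gives a measurable map to `L(G, A)`. -/
theorem measurable_of_measurable_fn {X : Type*} [MeasurableSpace X] [MeasurableSpace (LFun G A)]
    [BorelSpace (LFun G A)] {f : X × G → A} (hf : StronglyMeasurable f) {φ : X → LFun G A}
    (hφ : ∀ x, fn (φ x) =ᵐ[(Measure.haar : Measure G)] fun y => f (x, y)) : Measurable φ := by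
  let : MetricSpace A := TopologicalSpace.completelyMetrizableMetric A
  let : MetricSpace (LFun G A) := metricSpace
  refine measurable_of_isOpen fun O hO => ?_
  -- The distance to a fixed `H` is an integral over `G` of a jointly measurable function, and open
  -- sets are countable unions of balls with dense centres and rational radii.
  have hd : ∀ H : LFun G A, Measurable fun x => dist (φ x) H := by
    intro H
    have h1 : ∀ x, dist (φ x) H = ∫ y, min 1 (dist (f (x, y)) (fn H y))
        ∂(Measure.haar : Measure G).toFinite := by
      intro x
      refine integral_congr_ae ?_
      rw [Filter.EventuallyEq, ae_toFinite]
      filter_upwards [hφ x] with y hy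
      rw [← hy]
      rfl
    simp_rw [h1]
    have h2 : StronglyMeasurable fun z : X × G => min 1 (dist (f z) (fn H z.2)) :=
      stronglyMeasurable_const.inf
        (hf.dist ((stronglyMeasurable_fn H).comp_measurable measurable_snd))
    exact h2.integral_prod_right'.measurable
  obtain ⟨C, hC, -, hO'⟩ : ∃ C : Set (LFun G A × ℚ), C.Countable ∧ True ∧
      O = ⋃ c ∈ C, Metric.ball c.1 c.2 := by
    refine ⟨{c | c.1 ∈ Set.range (TopologicalSpace.denseSeq (LFun G A)) ∧
      Metric.ball c.1 (c.2 : ℝ) ⊆ O}, ?_, trivial, ?_⟩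
    · refine Set.Countable.mono (s₂ := Set.range (TopologicalSpace.denseSeq (LFun G A)) ×ˢ Set.univ)
        (fun c hc => ⟨hc.1, trivial⟩) ((Set.countable_range _).prod Set.countable_univ)
    · refine Set.Subset.antisymm (fun F hF => ?_) (Set.iUnion₂_subset fun c hc => hc.2)
      obtain ⟨ε, hε, hb⟩ := Metric.isOpen_iff.1 hO F hF
      obtain ⟨r, hr0, hr⟩ := exists_rat_btwn (half_pos hε)
      obtain ⟨n, hn⟩ := (TopologicalSpace.denseRange_denseSeq (LFun G A)).exists_dist_lt F hr0
      refine Set.mem_biUnion (x := (TopologicalSpace.denseSeq (LFun G A) n, r))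
        ⟨⟨n, rfl⟩, fun H hH => hb ?_⟩ hn
      rw [Metric.mem_ball] at hH ⊢
      have := dist_triangle_right H F (TopologicalSpace.denseSeq (LFun G A) n)
      simp only at hH
      linarith
  rw [hO', Set.preimage_iUnion₂]
  exact MeasurableSet.biUnion hC fun c _ => measurableSet_lt (hd c.1) measurable_const

end LFun

end

/-! ### The factorizations `G₁G₂` and `G₂G₁` and Haar null sets. -/

noncomputable section

open Filter

theorem qmp_skew {α α' β β' : Type*} [MeasurableSpace α] [MeasurableSpace α'] [MeasurableSpace β]
    [MeasurableSpace β'] {μ : Measure α} {μ' : Measure α'} {ν : Measure β} {ν' : Measure β'}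
    [SFinite ν] [SFinite ν'] {f : α → α'} (hf : Measure.QuasiMeasurePreserving f μ μ')
    {g : α → β → β'} (hg : Measurable (Function.uncurry g))
    (h : ∀ x, Measure.QuasiMeasurePreserving (g x) ν ν') :
    Measure.QuasiMeasurePreserving (fun z : α × β => (f z.1, g z.1 z.2)) (μ.prod ν)
      (μ'.prod ν') := by
  have hm : Measurable fun z : α × β => (f z.1, g z.1 z.2) :=
    (hf.measurable.comp measurable_fst).prodMk hg
  refine ⟨hm, Measure.AbsolutelyContinuous.mk fun N hN hN0 => ?_⟩
  rw [Measure.map_apply hm hN, Measure.measure_prod_null (hm hN)]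
  rw [Measure.measure_prod_null hN] at hN0
  filter_upwards [hf.ae hN0] with x hx
  exact (h x).preimage_null hx

namespace MatchedPair

variable {G : Type u} [Group G] [TopologicalSpace G] [IsTopologicalGroup G]
  [LocallyCompactSpace G] [SecondCountableTopology G] [T2Space G] [MeasurableSpace G] [BorelSpace G]
  (M : MatchedPair G)

/-- The elements of `G₁G₂`. -/
def Factors (x : G) : Prop := ∃ g ∈ M.G₁, ∃ s ∈ M.G₂, g * s = x

theorem ae_factors : ∀ᵐ x ∂(Measure.haar : Measure G), M.Factors x := M.ae_mem_mul

theorem ae_swap_factors : ∀ᵐ x ∂(Measure.haar : Measure G), M.swap.Factors x := M.swap.ae_mem_mul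

open Classical in
/-- The first component of the factorization `G₁G₂`, extended by `1`. -/
def proj₁ (x : G) : M.G₁ := if M.Factors x then M.exists_factor.choose x else 1

/-- The first component of the factorization `G₂G₁`, extended by `1`. -/
def proj₂ : G → M.G₂ := M.swap.proj₁

theorem measurable_proj₁ : Measurable M.proj₁ :=
  Measurable.ite M.measurableSet_mul M.exists_factor.choose_spec.1 measurable_const

theorem measurable_proj₂ : Measurable M.proj₂ := M.swap.measurable_proj₁

theorem proj₁_mul (g : M.G₁) (s : M.G₂) : M.proj₁ (g * s) = g := by
  rw [proj₁, if_pos ⟨g, g.2, s, s.2, rfl⟩]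
  exact M.exists_factor.choose_spec.2 g s

theorem proj₂_mul (s : M.G₂) (g : M.G₁) : M.proj₂ (s * g) = s := M.swap.proj₁_mul s g

theorem proj₁_coe (g : M.G₁) : M.proj₁ g = g := by simpa using M.proj₁_mul g 1

/-- `G₁G₂` is stable under right multiplication by `G₂`, so with the constant default value this
holds for all `x`: `proj₁` is a function on `G/G₂`. -/
theorem proj₁_mul_right (x : G) {s : G} (hs : s ∈ M.G₂) : M.proj₁ (x * s) = M.proj₁ x := by
  by_cases h : M.Factors x
  · obtain ⟨g, hg, t, ht, rfl⟩ := h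
    have h1 := M.proj₁_mul ⟨g, hg⟩ ⟨t, ht⟩
    have h2 := M.proj₁_mul ⟨g, hg⟩ (⟨t, ht⟩ * ⟨s, hs⟩)
    simp only [Subgroup.coe_mul, ← mul_assoc] at h1 h2
    rw [h1, h2]
  · have h' : ¬ M.Factors (x * s) := by
      rintro ⟨g, hg, t, ht, h'⟩
      exact h ⟨g, hg, t * s⁻¹, M.G₂.mul_mem ht (M.G₂.inv_mem hs), by
        rw [← mul_assoc, h', mul_inv_cancel_right]⟩
    rw [proj₁, proj₁, if_neg h, if_neg h']

theorem proj₂_mul_right (x : G) {g : G} (hg : g ∈ M.G₁) : M.proj₂ (x * g) = M.proj₂ x :=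
  M.swap.proj₁_mul_right x hg

theorem Factors.proj₁_inv_mul_mem {x : G} (h : M.Factors x) : (M.proj₁ x : G)⁻¹ * x ∈ M.G₂ := by
  obtain ⟨g, hg, s, hs, rfl⟩ := h
  have := M.proj₁_mul ⟨g, hg⟩ ⟨s, hs⟩
  simp only at this
  rw [this, inv_mul_cancel_left]
  exact hs

theorem proj₂_inv_mul_mem {x : G} (h : M.swap.Factors x) : (M.proj₂ x : G)⁻¹ * x ∈ M.G₁ :=
  Factors.proj₁_inv_mul_mem M.swap h

theorem qmp_proj₁ (x : G) : Measure.QuasiMeasurePreserving (fun a : M.G₁ => M.proj₁ (x * a))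
    Measure.haar Measure.haar :=
  M.qmp_factor M.measurable_proj₁ M.proj₁_mul x

theorem qmp_proj₂ (x : G) : Measure.QuasiMeasurePreserving (fun a : M.G₂ => M.proj₂ (x * a))
    Measure.haar Measure.haar :=
  M.swap.qmp_proj₁ x

theorem qmp_mul_inv : Measure.QuasiMeasurePreserving
    (fun z : M.G₁ × M.G₂ => (z.1 : G) * (z.2 : G)⁻¹)
    ((Measure.haar : Measure M.G₁).prod (Measure.haar : Measure M.G₂)) Measure.haar := by
  have hm : Measurable fun z : M.G₁ × M.G₂ => (z.1 : G) * (z.2 : G)⁻¹ := by fun_prop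
  refine ⟨hm, Measure.AbsolutelyContinuous.mk fun N hN hN0 => ?_⟩
  rw [Measure.map_apply hm hN]
  rw [M.null_iff hN] at hN0
  exact measure_eq_zero_iff_ae_notMem.2 hN0

theorem qmp_inv (H : Type*) [Group H] [TopologicalSpace H] [IsTopologicalGroup H]
    [LocallyCompactSpace H] [SecondCountableTopology H] [MeasurableSpace H] [BorelSpace H] :
    Measure.QuasiMeasurePreserving (fun x : H => x⁻¹) Measure.haar Measure.haar :=
  quasiMeasurePreserving_inv _

theorem qmp_mul : Measure.QuasiMeasurePreserving
    (fun z : M.G₁ × M.G₂ => (z.1 : G) * (z.2 : G))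
    ((Measure.haar : Measure M.G₁).prod (Measure.haar : Measure M.G₂)) Measure.haar := by
  have := M.qmp_mul_inv.comp (QuasiMeasurePreserving.prodMap
    (Measure.QuasiMeasurePreserving.id _) (qmp_inv M.G₂))
  simpa [Function.comp_def] using this

theorem qmp_inv_mul : Measure.QuasiMeasurePreserving
    (fun z : M.G₁ × M.G₂ => (z.1 : G)⁻¹ * (z.2 : G))
    ((Measure.haar : Measure M.G₁).prod (Measure.haar : Measure M.G₂)) Measure.haar := by
  have := M.qmp_mul.comp (QuasiMeasurePreserving.prodMap
    (qmp_inv M.G₁) (Measure.QuasiMeasurePreserving.id _))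
  simpa [Function.comp_def] using this

theorem qmp_inv_mul_subgroup₁ : Measure.QuasiMeasurePreserving
    (fun z : G × M.G₁ => z.1⁻¹ * (z.2 : G))
    ((Measure.haar : Measure G).prod (Measure.haar : Measure M.G₁)) Measure.haar := by
  refine QuasiMeasurePreserving.prod_of_left (by fun_prop) (Eventually.of_forall fun a => ?_)
  exact (quasiMeasurePreserving_mul_right _ (a : G)).comp (qmp_inv G)

theorem qmp_inv_mul_subgroup₂ : Measure.QuasiMeasurePreserving
    (fun z : G × M.G₂ => z.1⁻¹ * (z.2 : G))
    ((Measure.haar : Measure G).prod (Measure.haar : Measure M.G₂)) Measure.haar :=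
  M.swap.qmp_inv_mul_subgroup₁

/-- By `null_iff`, null sets of `G` may be tested on `x = gs⁻¹`. There `proj₁` returns `g`, and for
fixed `g` the map `s ↦ proj₂ (gs⁻¹)` pulls null sets back to null sets. -/
theorem qmp_proj : Measure.QuasiMeasurePreserving (fun x : G => (M.proj₁ x⁻¹, M.proj₂ x⁻¹))
    Measure.haar ((Measure.haar : Measure M.G₁).prod (Measure.haar : Measure M.G₂)) := by
  have hm : Measurable fun x : G => (M.proj₁ x, M.proj₂ x) :=
    M.measurable_proj₁.prodMk M.measurable_proj₂
  suffices h : Measure.QuasiMeasurePreserving (fun x : G => (M.proj₁ x, M.proj₂ x))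
      Measure.haar ((Measure.haar : Measure M.G₁).prod (Measure.haar : Measure M.G₂)) from
    h.comp (qmp_inv G)
  refine ⟨hm, Measure.AbsolutelyContinuous.mk fun N hN hN0 => ?_⟩
  rw [Measure.map_apply hm hN, M.null_iff (hm hN)]
  have hp := M.measurable_proj₂
  have h1 := qmp_skew (f := fun g : M.G₁ => g) (μ := Measure.haar) (μ' := Measure.haar)
    (Measure.QuasiMeasurePreserving.id _)
    (g := fun (g : M.G₁) (s : M.G₂) => M.proj₂ (g * (s⁻¹ : M.G₂))) (ν := Measure.haar)
    (ν' := Measure.haar)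
    (by unfold Function.uncurry; fun_prop) fun g => (M.qmp_proj₂ g).comp (qmp_inv M.G₂)
  have h2 := h1.ae (measure_eq_zero_iff_ae_notMem.1 hN0)
  filter_upwards [h2] with z hz hz'
  apply hz
  have h3 := M.proj₁_mul z.1 z.2⁻¹
  simp only [Set.mem_preimage, Subgroup.coe_inv] at hz' h3 ⊢
  rwa [h3] at hz'

/-- The vertex `x` in the intersection of the cosets `uG₂` and `vG₁`. -/
def vertex (z : M.G₁ × M.G₂) : G := z.1 * M.proj₂ ((z.1 : G)⁻¹ * z.2)

theorem measurable_vertex : Measurable M.vertex := by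
  have := M.measurable_proj₂
  unfold vertex
  fun_prop

theorem qmp_vertex : Measure.QuasiMeasurePreserving (fun z => (M.vertex z)⁻¹)
    ((Measure.haar : Measure M.G₁).prod (Measure.haar : Measure M.G₂)) Measure.haar := by
  have hp := M.measurable_proj₂
  have h1 := qmp_skew (f := fun g : M.G₁ => g) (μ := Measure.haar) (μ' := Measure.haar)
    (Measure.QuasiMeasurePreserving.id _)
    (g := fun (g : M.G₁) (s : M.G₂) => M.proj₂ ((g : G)⁻¹ * s)) (ν := Measure.haar)
    (ν' := Measure.haar)
    (by unfold Function.uncurry; fun_prop) fun g => M.qmp_proj₂ _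
  exact (qmp_inv G).comp (M.qmp_mul.comp h1)

/-- An element of `G` is determined by its cosets modulo `G₂` and modulo `G₁`, since `G₁ ∩ G₂` is
trivial. With `proj₁_vertex` and `proj₂_vertex` this identifies `G` and `G₁ × G₂` up to null sets.
-/
theorem vertex_proj {x : G} (h₁ : M.Factors x) (h₂ : M.swap.Factors x) :
    M.vertex (M.proj₁ x, M.proj₂ x) = x := by
  have k₁ := h₁.proj₁_inv_mul_mem
  have k₂ := M.proj₂_inv_mul_mem h₂
  have h := M.proj₂_mul ⟨_, k₁⟩ ⟨_, M.G₁.inv_mem k₂⟩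
  simp only [mul_inv_rev, inv_inv, mul_assoc, mul_inv_cancel_left] at h
  simp [vertex, h]

theorem proj₁_vertex (z : M.G₁ × M.G₂) : M.proj₁ (M.vertex z) = z.1 := M.proj₁_mul _ _

theorem proj₂_vertex {z : M.G₁ × M.G₂} (h : M.swap.Factors ((z.1 : G)⁻¹ * z.2)) :
    M.proj₂ (M.vertex z) = z.2 := by
  have k := M.G₁.inv_mem (M.proj₂_inv_mul_mem h)
  have h' := M.proj₂_mul z.2 ⟨_, k⟩
  simpa [mul_assoc, vertex] using h'

/-- Under the identification of `G₁` with `G/G₂` up to null sets, `a ↦ proj₁ (xa)` is the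
translation by `x`, and `x` and `x⁻¹` act as inverses wherever the factorization exists. -/
theorem proj₁_mul_proj₁ {x : G} {a : M.G₁} (h : M.Factors (x⁻¹ * a)) :
    M.proj₁ (x * M.proj₁ (x⁻¹ * a)) = a := by
  have k := h.proj₁_inv_mul_mem
  have h' := M.proj₁_mul a ⟨_, M.G₂.inv_mem k⟩
  simpa [mul_assoc] using h'

theorem proj₂_mul_proj₂ {x : G} {a : M.G₂} (h : M.swap.Factors (x⁻¹ * a)) :
    M.proj₂ (x * M.proj₂ (x⁻¹ * a)) = a := M.swap.proj₁_mul_proj₁ h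

end MatchedPair

end

/-! ### Translated grids in coset coordinates. -/

noncomputable section

open Filter

theorem measurePreserving_prodProdProdComm {α β γ δ : Type*} [MeasurableSpace α]
    [MeasurableSpace β] [MeasurableSpace γ] [MeasurableSpace δ] (μa : Measure α) (μb : Measure β)
    (μc : Measure γ) (μd : Measure δ) [SFinite μa] [SFinite μb] [SFinite μc] [SFinite μd] :
    MeasurePreserving (fun z : (α × β) × (γ × δ) => ((z.1.1, z.2.1), (z.1.2, z.2.2)))
      ((μa.prod μb).prod (μc.prod μd)) ((μa.prod μc).prod (μb.prod μd)) := by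
  have e1 := measurePreserving_prodAssoc μa μb (μc.prod μd)
  have e2 := (MeasurePreserving.id μa).prod
    (MeasurePreserving.symm _ (measurePreserving_prodAssoc μb μc μd))
  have e3 := (MeasurePreserving.id μa).prod
    ((Measure.measurePreserving_swap (μ := μb) (ν := μc)).prod (MeasurePreserving.id μd))
  have e4 := (MeasurePreserving.id μa).prod (measurePreserving_prodAssoc μc μb μd)
  have e5 := MeasurePreserving.symm _ (measurePreserving_prodAssoc μa μc (μb.prod μd))
  exact e5.comp (e4.comp (e3.comp (e2.comp e1)))

namespace MatchedPair

variable {G : Type u} [Group G] [TopologicalSpace G] [IsTopologicalGroup G]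
  [LocallyCompactSpace G] [SecondCountableTopology G] [T2Space G] [MeasurableSpace G] [BorelSpace G]
  (M : MatchedPair G)

/-- The space `G₁ ^ m × G₂ ^ n`. -/
abbrev Prods (m n : ℕ) : Type u := (Fin m → M.G₁) × (Fin n → M.G₂)

/-- Haar measure on `G₁ ^ m × G₂ ^ n`. -/
abbrev haarProds (m n : ℕ) : Measure (M.Prods m n) :=
  (Measure.pi fun _ => Measure.haar).prod (Measure.pi fun _ => Measure.haar)

theorem qmp_headTail (p q : ℕ) : Measure.QuasiMeasurePreserving
    (fun w : M.Prods (p + 1) (q + 1) => ((w.1 0, w.2 0), ((Fin.tail w.1, Fin.tail w.2) :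
      M.Prods p q)))
    (M.haarProds (p + 1) (q + 1)) ((Measure.haar.prod Measure.haar).prod (M.haarProds p q)) :=
  ((measurePreserving_prodProdProdComm _ _ _ _).comp
    ((measurePreserving_piFinSuccAbove (fun _ : Fin (p + 1) => (Measure.haar : Measure M.G₁)) 0).prod
      (measurePreserving_piFinSuccAbove
        (fun _ : Fin (q + 1) => (Measure.haar : Measure M.G₂)) 0))).quasiMeasurePreserving

theorem measurePreserving_cons {α : Type*} [MeasurableSpace α] (μ : Measure α) [SigmaFinite μ]
    (n : ℕ) : MeasurePreserving (fun z : α × (Fin n → α) => (Fin.cons z.1 z.2 : Fin (n + 1) → α))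
      (μ.prod (Measure.pi fun _ => μ)) (Measure.pi fun _ => μ) := by
  have := MeasurePreserving.symm _ (measurePreserving_piFinSuccAbove (fun _ : Fin (n + 1) => μ) 0)
  convert this using 1
  funext z
  simp [MeasurableEquiv.piFinSuccAbove]
  rfl

theorem qmp_cons (p q : ℕ) : Measure.QuasiMeasurePreserving
    (fun z : (M.G₁ × M.G₂) × M.Prods p q =>
      ((Fin.cons z.1.1 z.2.1, Fin.cons z.1.2 z.2.2) : M.Prods (p + 1) (q + 1)))
    ((Measure.haar.prod Measure.haar).prod (M.haarProds p q)) (M.haarProds (p + 1) (q + 1)) :=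
  (((measurePreserving_cons _ _).prod (measurePreserving_cons _ _)).comp
    (measurePreserving_prodProdProdComm _ _ _ _)).quasiMeasurePreserving

/-- The change of coordinates from a translated normalized grid to its cosets. -/
def toCosets {p q : ℕ} (z : G × M.Prods p q) : (M.G₁ × M.G₂) × M.Prods p q :=
  ((M.proj₁ z.1⁻¹, M.proj₂ z.1⁻¹),
    (fun i => M.proj₁ (z.1⁻¹ * z.2.1 i), fun j => M.proj₂ (z.1⁻¹ * z.2.2 j)))

/-- The change of coordinates from the cosets to a translated normalized grid. -/
def ofCosets {p q : ℕ} (z : (M.G₁ × M.G₂) × M.Prods p q) : G × M.Prods p q :=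
  ((M.vertex z.1)⁻¹,
    (fun i => M.proj₁ ((M.vertex z.1)⁻¹ * z.2.1 i), fun j => M.proj₂ ((M.vertex z.1)⁻¹ * z.2.2 j)))

theorem qmp_toCosets (p q : ℕ) : Measure.QuasiMeasurePreserving (M.toCosets (p := p) (q := q))
    (Measure.haar.prod (M.haarProds p q))
    ((Measure.haar.prod Measure.haar).prod (M.haarProds p q)) := by
  have h₁ := M.measurable_proj₁
  have h₂ := M.measurable_proj₂
  exact qmp_skew M.qmp_proj (g := fun (y : G) (t : M.Prods p q) =>
    ((fun i => M.proj₁ (y⁻¹ * t.1 i), fun j => M.proj₂ (y⁻¹ * t.2 j)) : M.Prods p q))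
    (by unfold Function.uncurry; fun_prop) fun y =>
      QuasiMeasurePreserving.prodMap (qmp_pi (M.qmp_proj₁ y⁻¹) p) (qmp_pi (M.qmp_proj₂ y⁻¹) q)

theorem qmp_ofCosets (p q : ℕ) : Measure.QuasiMeasurePreserving (M.ofCosets (p := p) (q := q))
    ((Measure.haar.prod Measure.haar).prod (M.haarProds p q))
    (Measure.haar.prod (M.haarProds p q)) := by
  have h₁ := M.measurable_proj₁
  have h₂ := M.measurable_proj₂
  have h₃ := M.measurable_vertex
  exact qmp_skew M.qmp_vertex (g := fun (b : M.G₁ × M.G₂) (t : M.Prods p q) =>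
    ((fun i => M.proj₁ ((M.vertex b)⁻¹ * t.1 i), fun j => M.proj₂ ((M.vertex b)⁻¹ * t.2 j)) :
      M.Prods p q))
    (by unfold Function.uncurry; fun_prop) fun b =>
      QuasiMeasurePreserving.prodMap (qmp_pi (M.qmp_proj₁ _) p) (qmp_pi (M.qmp_proj₂ _) q)

theorem ae_factors_inv_mul₁ (p q : ℕ) : ∀ᵐ z ∂((Measure.haar : Measure G).prod (M.haarProds p q)),
    ∀ i, M.Factors (z.1⁻¹ * z.2.1 i) := by
  refine ae_all_iff.2 fun i => ?_
  exact (M.qmp_inv_mul_subgroup₁.comp (QuasiMeasurePreserving.prodMap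
    (Measure.QuasiMeasurePreserving.id _) ((Measure.quasiMeasurePreserving_eval
        (fun _ : Fin p => (Measure.haar : Measure M.G₁)) i).comp
      Measure.quasiMeasurePreserving_fst))).ae M.ae_factors

theorem ae_factors_inv_mul₂ (p q : ℕ) : ∀ᵐ z ∂((Measure.haar : Measure G).prod (M.haarProds p q)),
    ∀ j, M.swap.Factors (z.1⁻¹ * z.2.2 j) := by
  refine ae_all_iff.2 fun j => ?_
  exact (M.qmp_inv_mul_subgroup₂.comp (QuasiMeasurePreserving.prodMap
    (Measure.QuasiMeasurePreserving.id _) ((Measure.quasiMeasurePreserving_eval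
        (fun _ : Fin q => (Measure.haar : Measure M.G₂)) j).comp
      Measure.quasiMeasurePreserving_snd))).ae M.ae_swap_factors

theorem ofCosets_toCosets (p q : ℕ) : ∀ᵐ z ∂((Measure.haar : Measure G).prod (M.haarProds p q)),
    M.ofCosets (M.toCosets z) = z := by
  filter_upwards [Measure.quasiMeasurePreserving_fst.ae ((qmp_inv G).ae M.ae_factors),
    Measure.quasiMeasurePreserving_fst.ae ((qmp_inv G).ae M.ae_swap_factors),
    M.ae_factors_inv_mul₁ p q, M.ae_factors_inv_mul₂ p q] with z h₁ h₂ h₃ h₄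
  have hv : M.vertex (M.proj₁ z.1⁻¹, M.proj₂ z.1⁻¹) = z.1⁻¹ := M.vertex_proj h₁ h₂
  refine Prod.ext ?_ (Prod.ext (funext fun i => ?_) (funext fun j => ?_))
  · simp [ofCosets, toCosets, hv]
  · simpa [ofCosets, toCosets, hv] using M.proj₁_mul_proj₁ (h₃ i)
  · simpa [ofCosets, toCosets, hv] using M.proj₂_mul_proj₂ (h₄ j)

theorem toCosets_ofCosets (p q : ℕ) : ∀ᵐ z ∂(((Measure.haar : Measure M.G₁).prod
    (Measure.haar : Measure M.G₂)).prod (M.haarProds p q)), M.toCosets (M.ofCosets z) = z := by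
  have k : Measure.QuasiMeasurePreserving (fun z : (M.G₁ × M.G₂) × M.Prods p q =>
      (M.vertex z.1, z.2)) (((Measure.haar : Measure M.G₁).prod
      (Measure.haar : Measure M.G₂)).prod (M.haarProds p q))
      ((Measure.haar : Measure G).prod (M.haarProds p q)) := by
    have := QuasiMeasurePreserving.prodMap ((qmp_inv G).comp M.qmp_vertex)
      (Measure.QuasiMeasurePreserving.id (M.haarProds p q))
    simpa only [Function.comp_def, Prod.map_def, inv_inv, id] using this
  filter_upwards [Measure.quasiMeasurePreserving_fst.ae (M.qmp_inv_mul.ae M.ae_swap_factors),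
    k.ae (M.ae_factors_inv_mul₁ p q), k.ae (M.ae_factors_inv_mul₂ p q)] with z h₁ h₂ h₃
  refine Prod.ext (Prod.ext ?_ ?_) (Prod.ext (funext fun i => ?_) (funext fun j => ?_))
  · simp [ofCosets, toCosets, proj₁_vertex]
  · simpa [ofCosets, toCosets] using M.proj₂_vertex h₁
  · simpa [ofCosets, toCosets] using M.proj₁_mul_proj₁ (h₂ i)
  · simpa [ofCosets, toCosets] using M.proj₂_mul_proj₂ (h₃ j)

instance (p q : ℕ) : SFinite (M.μ p q) := by
  have e := M.measurableEmbedding_coord p q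
  refine ⟨fun n => (sfiniteSeq (M.haarProds p q) n).comap (M.coord p q), inferInstance, ?_⟩
  ext s hs
  have h := congrArg (fun ν => ν (M.coord p q '' s)) (sum_sfiniteSeq (M.haarProds p q))
  simp only [Measure.sum_apply _ (e.measurableSet_image' hs)] at h
  rw [μ, e.comap_apply, Measure.sum_apply _ hs, ← h]
  exact tsum_congr fun n => (e.comap_apply _ _).symm

theorem qmp_coord (p q : ℕ) :
    Measure.QuasiMeasurePreserving (M.coord p q) (M.μ p q) (M.haarProds p q) := by
  refine ⟨(M.continuous_coord p q).measurable, ?_⟩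
  rw [μ, (M.measurableEmbedding_coord p q).map_comap]
  exact Measure.restrict_le_self.absolutelyContinuous

/-- A grid is completed from its left column `a` and top row `b` by letting `x_{ij}` be the point of
`b_jG₁ ∩ a_iG₂`, which exists when `b_j⁻¹a_i` lies in `G₁G₂`. Hence `coord` has conull range. -/
theorem exists_coord_eq {p q : ℕ} {t : M.Prods p q}
    (h : ∀ i j, M.Factors ((t.2 j : G)⁻¹ * t.1 i)) : ∃ X, M.coord p q X = t := by
  let a : Fin (p + 1) → M.G₁ := Fin.cons 1 t.1
  let b : Fin (q + 1) → M.G₂ := Fin.cons 1 t.2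
  have hab : ∀ i j, M.Factors ((b j : G)⁻¹ * a i) := by
    intro i j
    refine Fin.cases ?_ (fun i => ?_) i
    · exact ⟨1, M.G₁.one_mem, (b j)⁻¹, (b j)⁻¹.2, by simp [a]⟩
    · refine Fin.cases ?_ (fun j => ?_) j
      · exact ⟨t.1 i, (t.1 i).2, 1, M.G₂.one_mem, by simp [a, b]⟩
      · simpa [a, b] using h i j
  let X : Fin (p + 1) → Fin (q + 1) → G := fun i j => b j * M.proj₁ ((b j : G)⁻¹ * a i)
  have hX : ∀ i j, (X i j)⁻¹ * a i ∈ M.G₂ := fun i j => by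
    simpa [X, mul_assoc] using (hab i j).proj₁_inv_mul_mem
  refine ⟨⟨X, ?_, fun i k j => ?_, fun i j k => ?_⟩, Prod.ext (funext fun i => Subtype.ext ?_)
    (funext fun j => Subtype.ext ?_)⟩
  · simpa [X, a, b] using M.proj₁_coe 1
  · simp only [X, mul_inv_rev, mul_assoc, inv_mul_cancel_left]
    exact M.G₁.mul_mem (M.G₁.inv_mem (Subtype.prop _)) (Subtype.prop _)
  · simpa [mul_assoc] using M.G₂.mul_mem (hX i j) (M.G₂.inv_mem (hX i k))
  · simp [coord, X, a, b, proj₁_coe]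
  · have := M.proj₁_mul_right 1 (s := (t.2 j : G)⁻¹) (M.G₂.inv_mem (t.2 j).2)
    have h1 : M.proj₁ 1 = 1 := by simpa using M.proj₁_coe 1
    rw [one_mul] at this
    simp [coord, X, a, b, this, h1]

theorem ae_exists_coord_eq (p q : ℕ) : ∀ᵐ t ∂(M.haarProds p q), ∃ X, M.coord p q X = t := by
  have h : ∀ i j, ∀ᵐ t ∂(M.haarProds p q), M.Factors ((t.2 j : G)⁻¹ * t.1 i) := fun i j => by
    have := ((qmp_inv G).comp (M.qmp_inv_mul.comp (QuasiMeasurePreserving.prodMap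
      (Measure.quasiMeasurePreserving_eval (fun _ : Fin p => (Measure.haar : Measure M.G₁)) i)
      (Measure.quasiMeasurePreserving_eval
        (fun _ : Fin q => (Measure.haar : Measure M.G₂)) j)))).ae M.ae_factors
    simpa using this
  filter_upwards [ae_all_iff.2 fun i => ae_all_iff.2 fun j => h i j] with t ht
  exact M.exists_coord_eq ht

/-- A measurable inverse of `coord`. -/
theorem exists_uncoord (p q : ℕ) : ∃ c : M.Prods p q → M.Γ p q,
    Measure.QuasiMeasurePreserving c (M.haarProds p q) (M.μ p q) ∧ (∀ X, c (M.coord p q X) = X) ∧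
      ∀ᵐ t ∂(M.haarProds p q), M.coord p q (c t) = t := by
  obtain ⟨c, hc, hc'⟩ := (M.measurableEmbedding_coord p q).exists_measurable_extend (g := id)
    measurable_id fun _ => ⟨⟨fun _ _ => 1, by simp, by simp [M.G₁.one_mem],
      by simp [M.G₂.one_mem]⟩⟩
  have hX : ∀ X, c (M.coord p q X) = X := congrFun hc'
  have hae : ∀ᵐ t ∂(M.haarProds p q), M.coord p q (c t) = t := by
    filter_upwards [M.ae_exists_coord_eq p q] with t ht
    obtain ⟨X, rfl⟩ := ht
    rw [hX]
  refine ⟨c, ⟨hc, Measure.AbsolutelyContinuous.mk fun N hN hN0 => ?_⟩, hX, hae⟩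
  rw [Measure.map_apply hc hN]
  rw [μ, (M.measurableEmbedding_coord _ _).comap_apply] at hN0
  rw [measure_eq_zero_iff_ae_notMem] at hN0 ⊢
  filter_upwards [hN0, hae] with t h1 h2 h3
  exact h1 ⟨c t, h3, h2⟩

/-- The cosets `y⁻¹x_{k0}G₂` and `y⁻¹x_{0l}G₁` of the rows and columns of a translated grid. -/
def cosets (p q : ℕ) (z : M.Γ p q × G) : M.Prods (p + 1) (q + 1) :=
  (fun k => M.proj₁ (z.2⁻¹ * z.1.1 k 0), fun l => M.proj₂ (z.2⁻¹ * z.1.1 0 l))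

theorem cosets_eq (p q : ℕ) (z : M.Γ p q × G) : M.cosets p q z =
    (Fin.cons (M.toCosets (z.2, M.coord p q z.1)).1.1 (M.toCosets (z.2, M.coord p q z.1)).2.1,
      Fin.cons (M.toCosets (z.2, M.coord p q z.1)).1.2
        (M.toCosets (z.2, M.coord p q z.1)).2.2) := by
  refine Prod.ext (funext fun k => ?_) (funext fun l => ?_)
  · refine Fin.cases ?_ (fun k => ?_) k <;> simp [cosets, toCosets, coord, z.1.2.1]
  · refine Fin.cases ?_ (fun l => ?_) l <;> simp [cosets, toCosets, coord, z.1.2.1]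

theorem qmp_swap_coord (p q : ℕ) : Measure.QuasiMeasurePreserving
    (fun z : M.Γ p q × G => (z.2, M.coord p q z.1)) ((M.μ p q).prod Measure.haar)
    (Measure.haar.prod (M.haarProds p q)) :=
  Measure.measurePreserving_swap.quasiMeasurePreserving.comp
    (QuasiMeasurePreserving.prodMap (M.qmp_coord p q) (Measure.QuasiMeasurePreserving.id _))

theorem qmp_cosets (p q : ℕ) : Measure.QuasiMeasurePreserving (M.cosets p q)
    ((M.μ p q).prod Measure.haar) (M.haarProds (p + 1) (q + 1)) := by
  rw [show M.cosets p q = _ from funext (M.cosets_eq p q)]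
  exact (M.qmp_cons p q).comp ((M.qmp_toCosets p q).comp (M.qmp_swap_coord p q))

/-- With `qmp_cosets`, this makes `cosets` an isomorphism of measure classes up to null sets. The
two first coordinates recover the base point `y⁻¹` through `vertex`; translation back by `y` and
completion of the grid give `X`. -/
theorem exists_cosets_inverse (p q : ℕ) : ∃ θ : M.Prods (p + 1) (q + 1) → M.Γ p q × G,
    Measure.QuasiMeasurePreserving θ (M.haarProds (p + 1) (q + 1)) ((M.μ p q).prod Measure.haar) ∧
      (∀ᵐ z ∂((M.μ p q).prod Measure.haar), θ (M.cosets p q z) = z) ∧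
      ∀ᵐ w ∂(M.haarProds (p + 1) (q + 1)), M.cosets p q (θ w) = w := by
  obtain ⟨c, hc, hc₁, hc₂⟩ := M.exists_uncoord p q
  have hcs : Measure.QuasiMeasurePreserving (fun z : G × M.Prods p q => (c z.2, z.1))
      (Measure.haar.prod (M.haarProds p q)) ((M.μ p q).prod Measure.haar) :=
    Measure.measurePreserving_swap.quasiMeasurePreserving.comp
      (QuasiMeasurePreserving.prodMap (Measure.QuasiMeasurePreserving.id _) hc)
  have hθ := (M.qmp_ofCosets p q).comp (M.qmp_headTail p q)
  refine ⟨_, hcs.comp hθ, ?_, ?_⟩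
  · filter_upwards [(M.qmp_swap_coord p q).ae (M.ofCosets_toCosets p q)] with z hz
    simp only [Function.comp_apply, cosets_eq, Fin.cons_zero, Fin.tail_cons, Prod.mk.eta]
    rw [hz, hc₁]
  · filter_upwards [(M.qmp_headTail p q).ae (M.toCosets_ofCosets p q),
      hθ.ae (Measure.quasiMeasurePreserving_snd.ae hc₂)] with w h1 h2
    simp only [Function.comp_apply] at h2 ⊢
    rw [cosets_eq, h2, Prod.mk.eta, h1, Fin.cons_self_tail, Fin.cons_self_tail]

/-- The normalization of the face is absorbed by the translation of `y`. Passing to another column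
moves each left vertex inside its coset of `G₂`, so the row coordinates do not change and the column
coordinates lose one entry. -/
theorem cosets_faceH {p q : ℕ} (i : Fin (q + 2)) (X : M.Γ p (q + 1)) (y : G) :
    M.cosets p q (M.faceH i X, (X.1 0 (i.succAbove 0))⁻¹ * y)
      = ((M.cosets p (q + 1) (X, y)).1, fun l => (M.cosets p (q + 1) (X, y)).2 (i.succAbove l)) := by
  refine Prod.ext (funext fun k => ?_) (funext fun l => ?_)
  · have h := M.proj₁_mul_right (y⁻¹ * X.1 k 0) (X.2.2.2 k 0 (i.succAbove 0))
    simp only [mul_assoc, mul_inv_cancel_left] at h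
    simp [cosets, faceH, mul_assoc, h]
  · simp [cosets, faceH, mul_assoc]

theorem cosets_faceV {p q : ℕ} (j : Fin (p + 2)) (X : M.Γ (p + 1) q) (y : G) :
    M.cosets p q (M.faceV j X, (X.1 (j.succAbove 0) 0)⁻¹ * y)
      = (fun k => (M.cosets (p + 1) q (X, y)).1 (j.succAbove k), (M.cosets (p + 1) q (X, y)).2) := by
  refine Prod.ext (funext fun k => ?_) (funext fun l => ?_)
  · simp [cosets, faceV, mul_assoc]
  · have h := M.proj₂_mul_right (y⁻¹ * X.1 0 l) (X.2.2.1 0 (j.succAbove 0) l)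
    simp only [mul_assoc, mul_inv_cancel_left] at h
    simp [cosets, faceV, mul_assoc, h]

end MatchedPair

end

/-! ### The contractible complex of functions on tuples of cosets. -/

noncomputable section

open Filter

theorem AEEqFun.coeFn_sum_zsmul {X A ι : Type*} [MeasurableSpace X] {μ : Measure X} [AddCommGroup A]
    [TopologicalSpace A] [IsTopologicalAddGroup A] (s : Finset ι) (c : ι → ℤ)
    (F : ι → X →ₘ[μ] A) :
    (∑ i ∈ s, c i • F i : X →ₘ[μ] A) =ᵐ[μ] fun x => ∑ i ∈ s, c i • F i x := by
  classical
  induction s using Finset.induction_on with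
  | empty => simp only [Finset.sum_empty]; exact AEEqFun.coeFn_zero
  | insert i s hi ih =>
    rw [Finset.sum_insert hi]
    filter_upwards [ih, AEEqFun.coeFn_add (c i • F i) (∑ i ∈ s, c i • F i),
      AEEqFun.coeFn_smul (c i) (F i)] with x h1 h2 h3
    rw [h2, Pi.add_apply, h3, h1, Finset.sum_insert hi, Pi.smul_apply]

/-- A cochain with vanishing coboundary is the coboundary of its contraction by almost every
point. -/
theorem ae_eq_sum_cons {Y V A : Type*} [MeasurableSpace Y] [MeasurableSpace V] [AddCommGroup A]
    (ν : Measure Y) (μ : Measure V) [SigmaFinite μ] [SFinite ν] {n : ℕ}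
    (h : Y × (Fin (n + 2) → V) → A)
    (hh : ∀ᵐ z ∂(ν.prod (Measure.pi fun _ : Fin (n + 3) => μ)),
      ∑ i : Fin (n + 3), (-1 : ℤ) ^ (i : ℕ) • h (z.1, fun l => z.2 (i.succAbove l)) = 0) :
    ∀ᵐ t ∂μ, ∀ᵐ z ∂(ν.prod (Measure.pi fun _ : Fin (n + 2) => μ)),
      ∑ j : Fin (n + 2), (-1 : ℤ) ^ (j : ℕ) • h (z.1, Fin.cons t fun l => z.2 (j.succAbove l))
        = h z := by
  have e1 := (Measure.measurePreserving_swap (μ := μ) (ν := ν)).prod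
    (MeasurePreserving.id (Measure.pi fun _ : Fin (n + 2) => μ))
  have e2 := measurePreserving_prodAssoc ν μ (Measure.pi fun _ : Fin (n + 2) => μ)
  have e3 := (MeasurePreserving.id ν).prod (MatchedPair.measurePreserving_cons μ (n + 2))
  have e0 := MeasurePreserving.symm _
    (measurePreserving_prodAssoc μ ν (Measure.pi fun _ : Fin (n + 2) => μ))
  have key := Measure.ae_ae_of_ae_prod
    ((e3.comp (e2.comp (e1.comp e0))).quasiMeasurePreserving.ae hh)
  filter_upwards [key] with t ht
  filter_upwards [ht] with z hz
  change ∑ i : Fin (n + 3), (-1 : ℤ) ^ (i : ℕ) • h (z.1, fun l =>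
    (Fin.cons t z.2 : Fin (n + 3) → V) (i.succAbove l)) = 0 at hz
  -- Deleting the inserted point `t` gives back `h z`. The other terms delete a coordinate of `z`
  -- and carry the opposite signs, because `t` shifts the indices by one.
  rw [Fin.sum_univ_succ] at hz
  have h1 : ∀ j : Fin (n + 2), (fun l => (Fin.cons t z.2 : Fin (n + 3) → V) (j.succ.succAbove l))
      = (Fin.cons t fun l => z.2 (j.succAbove l) : Fin (n + 2) → V) := fun j => by
    funext l
    refine Fin.cases ?_ (fun l => ?_) l
    · rw [Fin.succ_succAbove_zero, Fin.cons_zero, Fin.cons_zero]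
    · rw [Fin.succ_succAbove_succ, Fin.cons_succ, Fin.cons_succ]
  simp only [h1, Fin.succAbove_zero, Fin.cons_succ, Fin.val_zero, pow_zero, one_smul, Fin.val_succ,
    pow_succ, mul_neg, mul_one, neg_smul, Finset.sum_neg_distrib] at hz
  exact (sub_eq_zero.1 (by rw [sub_eq_add_neg]; exact hz)).symm

namespace MatchedPair

variable {G : Type u} [Group G] [TopologicalSpace G] [IsTopologicalGroup G]
  [LocallyCompactSpace G] [SecondCountableTopology G] [T2Space G] [MeasurableSpace G] [BorelSpace G]
  (M : MatchedPair G)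
  (A : Type v) [AddCommGroup A] [TopologicalSpace A] [IsTopologicalAddGroup A]

/-- Cochains on pairs of tuples of cosets. -/
abbrev CosetL (p q : ℕ) : Type (max u v) :=
  M.Prods (p + 1) (q + 1) →ₘ[M.haarProds (p + 1) (q + 1)] A

theorem qmp_dropH {p q : ℕ} (i : Fin (q + 2)) : Measure.QuasiMeasurePreserving
    (fun w : M.Prods (p + 1) (q + 2) => ((w.1, fun l => w.2 (i.succAbove l)) :
      M.Prods (p + 1) (q + 1))) (M.haarProds (p + 1) (q + 2)) (M.haarProds (p + 1) (q + 1)) :=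
  QuasiMeasurePreserving.prodMap (Measure.QuasiMeasurePreserving.id _) (qmp_drop i)

theorem qmp_dropV {p q : ℕ} (j : Fin (p + 2)) : Measure.QuasiMeasurePreserving
    (fun w : M.Prods (p + 2) (q + 1) => ((fun k => w.1 (j.succAbove k), w.2) :
      M.Prods (p + 1) (q + 1))) (M.haarProds (p + 2) (q + 1)) (M.haarProds (p + 1) (q + 1)) :=
  QuasiMeasurePreserving.prodMap (qmp_drop j) (Measure.QuasiMeasurePreserving.id _)

/-- The horizontal faces on cochains of tuples of cosets. -/
def cosetHFace {p q : ℕ} (i : Fin (q + 2)) : M.CosetL A p q →+ M.CosetL A p (q + 1) :=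
  AddMonoidHom.mk' (fun H => H.compQuasiMeasurePreserving _ (M.qmp_dropH i)) fun F F' =>
    AEEqFun.induction_on₂ F F' fun _ _ _ _ => rfl

/-- The vertical faces on cochains of tuples of cosets. -/
def cosetVFace {p q : ℕ} (j : Fin (p + 2)) : M.CosetL A p q →+ M.CosetL A (p + 1) q :=
  AddMonoidHom.mk' (fun H => H.compQuasiMeasurePreserving _ (M.qmp_dropV j)) fun F F' =>
    AEEqFun.induction_on₂ F F' fun _ _ _ _ => rfl

/-- The horizontal coboundary on cochains of tuples of cosets. -/
def cosetH (p q : ℕ) : M.CosetL A p q →+ M.CosetL A p (q + 1) :=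
  ∑ i : Fin (q + 2), (-1 : ℤ) ^ (i : ℕ) • M.cosetHFace A i

/-- The vertical coboundary on cochains of tuples of cosets. -/
def cosetV (p q : ℕ) : M.CosetL A p q →+ M.CosetL A (p + 1) q :=
  ∑ j : Fin (p + 2), (-1 : ℤ) ^ (j : ℕ) • M.cosetVFace A j

variable {A}

theorem coeFn_cosetHFace {p q : ℕ} (i : Fin (q + 2)) (H : M.CosetL A p q) :
    M.cosetHFace A i H =ᵐ[M.haarProds (p + 1) (q + 2)] fun w =>
      H (w.1, fun l => w.2 (i.succAbove l)) :=
  AEEqFun.coeFn_compQuasiMeasurePreserving H (M.qmp_dropH i)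

theorem coeFn_cosetVFace {p q : ℕ} (j : Fin (p + 2)) (H : M.CosetL A p q) :
    M.cosetVFace A j H =ᵐ[M.haarProds (p + 2) (q + 1)] fun w =>
      H (fun k => w.1 (j.succAbove k), w.2) :=
  AEEqFun.coeFn_compQuasiMeasurePreserving H (M.qmp_dropV j)

theorem coeFn_cosetH {p q : ℕ} (H : M.CosetL A p q) :
    M.cosetH A p q H =ᵐ[M.haarProds (p + 1) (q + 2)] fun w =>
      ∑ i : Fin (q + 2), (-1 : ℤ) ^ (i : ℕ) • H (w.1, fun l => w.2 (i.succAbove l)) := by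
  simp only [cosetH, AddMonoidHom.finsetSum_apply, AddMonoidHom.smul_apply]
  filter_upwards [AEEqFun.coeFn_sum_zsmul Finset.univ (fun i : Fin (q + 2) => (-1 : ℤ) ^ (i : ℕ))
    fun i => M.cosetHFace A i H, ae_all_iff.2 fun i => M.coeFn_cosetHFace i H] with w h1 h2
  rw [h1]
  simp only [h2]

theorem coeFn_cosetV {p q : ℕ} (H : M.CosetL A p q) :
    M.cosetV A p q H =ᵐ[M.haarProds (p + 2) (q + 1)] fun w =>
      ∑ j : Fin (p + 2), (-1 : ℤ) ^ (j : ℕ) • H (fun k => w.1 (j.succAbove k), w.2) := by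
  simp only [cosetV, AddMonoidHom.finsetSum_apply, AddMonoidHom.smul_apply]
  filter_upwards [AEEqFun.coeFn_sum_zsmul Finset.univ (fun j : Fin (p + 2) => (-1 : ℤ) ^ (j : ℕ))
    fun j => M.cosetVFace A j H, ae_all_iff.2 fun j => M.coeFn_cosetVFace j H] with w h1 h2
  rw [h1]
  simp only [h2]

/-- The primitive is `H` with a fixed point `t` inserted in front of the `G₂`-tuple. Since `H` is
only a class, this is controlled for almost every `t`, and one such `t` suffices. -/
theorem cosetH_exact [PolishSpace A] {p q : ℕ} (H : M.CosetL A p (q + 1))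
    (hH : M.cosetH A p (q + 1) H = 0) : ∃ H', M.cosetH A p q H' = H := by
  let : MeasurableSpace A := borel A
  have : BorelSpace A := ⟨rfl⟩
  have h0 := M.coeFn_cosetH H
  rw [hH] at h0
  have h1 := ae_eq_sum_cons (Measure.pi fun _ : Fin (p + 1) => (Measure.haar : Measure M.G₁))
    (Measure.haar : Measure M.G₂) (fun w => H w)
    (h0.symm.trans AEEqFun.coeFn_zero)
  obtain ⟨t, ht⟩ := h1.exists
  have hm : Measurable fun w : M.Prods (p + 1) (q + 1) => H (w.1, Fin.cons t w.2) := by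
    refine (AEEqFun.stronglyMeasurable H).measurable.comp (measurable_fst.prodMk ?_)
    exact (measurePreserving_cons (Measure.haar : Measure M.G₂) (q + 1)).measurable.comp
      (measurable_const.prodMk measurable_snd)
  refine ⟨AEEqFun.mk _ hm.aestronglyMeasurable, AEEqFun.ext ?_⟩
  filter_upwards [M.coeFn_cosetH (AEEqFun.mk _ hm.aestronglyMeasurable), ht,
    ae_all_iff.2 fun i => (M.qmp_dropH i).ae (AEEqFun.coeFn_mk _ hm.aestronglyMeasurable)]
    with w h1 h2 h3
  rw [h1, ← h2]
  simp only [h3]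

/-- Insertion of a point in the `G₁`-tuple does not touch the `G₂`-tuple, so for generic `t` it
preserves horizontal cocycles. The additional clause is needed for the corner component in
`dD_exact`. -/
theorem cosetV_exact [PolishSpace A] {p q : ℕ} (H : M.CosetL A (p + 1) q)
    (hH : M.cosetV A (p + 1) q H = 0) :
    ∃ H', M.cosetV A p q H' = H ∧ (M.cosetH A (p + 1) q H = 0 → M.cosetH A p q H' = 0) := by
  let : MeasurableSpace A := borel A
  have : BorelSpace A := ⟨rfl⟩
  have h0 := M.coeFn_cosetV H
  rw [hH] at h0
  have hs : ∀ m n, Measure.QuasiMeasurePreserving (Prod.swap : (Fin m → M.G₂) × (Fin n → M.G₁) → _)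
      ((Measure.pi fun _ => Measure.haar).prod (Measure.pi fun _ => Measure.haar))
      (M.haarProds n m) := fun m n => Measure.measurePreserving_swap.quasiMeasurePreserving
  have hs' : ∀ m n, Measure.QuasiMeasurePreserving (Prod.swap : M.Prods n m → _) (M.haarProds n m)
      ((Measure.pi fun _ => Measure.haar).prod (Measure.pi fun _ => Measure.haar)) :=
    fun m n => Measure.measurePreserving_swap.quasiMeasurePreserving
  have h1 := ae_eq_sum_cons (Measure.pi fun _ : Fin (q + 1) => (Measure.haar : Measure M.G₂))
    (Measure.haar : Measure M.G₁) (fun w => H w.swap)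
    ((hs _ _).ae (h0.symm.trans AEEqFun.coeFn_zero))
  have e0 := MeasurePreserving.symm _ (measurePreserving_prodAssoc (Measure.haar : Measure M.G₁)
    (Measure.pi fun _ : Fin (p + 1) => (Measure.haar : Measure M.G₁))
    (Measure.pi fun _ : Fin (q + 2) => (Measure.haar : Measure M.G₂)))
  have e1 := (measurePreserving_cons (Measure.haar : Measure M.G₁) (p + 1)).prod
    (MeasurePreserving.id (Measure.pi fun _ : Fin (q + 2) => (Measure.haar : Measure M.G₂)))
  -- The hypothesis on `cosetH` is kept inside the almost everywhere statement, so that a single `t`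
  -- serves both conclusions.
  have h2 : ∀ᵐ t ∂(Measure.haar : Measure M.G₁), M.cosetH A (p + 1) q H = 0 →
      ∀ᵐ w ∂(M.haarProds (p + 1) (q + 2)), ∑ i : Fin (q + 2), (-1 : ℤ) ^ (i : ℕ) •
        H (Fin.cons t w.1, fun l => w.2 (i.succAbove l)) = 0 := by
    by_cases h : M.cosetH A (p + 1) q H = 0
    · have h3 := M.coeFn_cosetH H
      rw [h] at h3
      have h4 := Measure.ae_ae_of_ae_prod ((e1.comp e0).quasiMeasurePreserving.ae
        (h3.symm.trans AEEqFun.coeFn_zero))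
      exact h4.mono fun t ht _ => ht
    · exact Eventually.of_forall fun _ h' => absurd h' h
  obtain ⟨t, ht, ht'⟩ := (h1.and h2).exists
  have hm : Measurable fun w : M.Prods (p + 1) (q + 1) => H (Fin.cons t w.1, w.2) := by
    refine (AEEqFun.stronglyMeasurable H).measurable.comp (Measurable.prodMk ?_ measurable_snd)
    exact (measurePreserving_cons (Measure.haar : Measure M.G₁) (p + 1)).measurable.comp
      (measurable_const.prodMk measurable_fst)
  refine ⟨AEEqFun.mk _ hm.aestronglyMeasurable, AEEqFun.ext ?_, fun h => AEEqFun.ext ?_⟩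
  · filter_upwards [M.coeFn_cosetV (AEEqFun.mk _ hm.aestronglyMeasurable), (hs' _ _).ae ht,
      ae_all_iff.2 fun i => (M.qmp_dropV i).ae (AEEqFun.coeFn_mk _ hm.aestronglyMeasurable)]
      with w h1 h2 h3
    rw [h1]
    simp only [h3]
    exact h2
  · filter_upwards [M.coeFn_cosetH (AEEqFun.mk _ hm.aestronglyMeasurable), ht' h,
      AEEqFun.coeFn_zero (μ := M.haarProds (p + 1) (q + 2)) (β := A),
      ae_all_iff.2 fun i => (M.qmp_dropH i).ae (AEEqFun.coeFn_mk _ hm.aestronglyMeasurable)]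
      with w h1 h2 h3 h4
    rw [h1, h3]
    simp only [h4]
    exact h2

end MatchedPair

end

/-! ### Comparison of `L(G, A)`-valued cochains with functions of cosets. -/

noncomputable section

open Filter

namespace MatchedPair

variable {G : Type u} [Group G] [TopologicalSpace G] [IsTopologicalGroup G]
  [LocallyCompactSpace G] [SecondCountableTopology G] [T2Space G] [MeasurableSpace G] [BorelSpace G]
  (M : MatchedPair G)
  {A : Type v} [AddCommGroup A] [TopologicalSpace A] [IsTopologicalAddGroup A]
  [DistribMulAction G A] [ContinuousSMul G A] [PolishSpace A]

/-- The cochain `F` with values in `L(G, A)` corresponds to the cochain `H` on tuples of cosets: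
`F(X)(y) = y • H(cosets (X, y))`. -/
def IsTwist {p q : ℕ} (H : M.CosetL A p q) (F : M.L (LFun G A) p q) : Prop :=
  ∀ᵐ X ∂(M.μ p q), ∀ᵐ y ∂(Measure.haar : Measure G),
    LFun.fn (F X) y = y • H (M.cosets p q (X, y))

variable {M} {p q : ℕ}

theorem isTwist_zero : M.IsTwist (0 : M.CosetL A p q) 0 := by
  have h := Measure.ae_ae_of_ae_prod ((M.qmp_cosets p q).ae
    (AEEqFun.coeFn_zero (μ := M.haarProds (p + 1) (q + 1)) (β := A)))
  filter_upwards [h, AEEqFun.coeFn_zero (μ := M.μ p q) (β := LFun G A)] with X h1 h2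
  filter_upwards [h1, LFun.fn_zero (G := G) (A := A)] with y h3 h4
  rw [h2, h3]
  simpa using h4

theorem IsTwist.eq_of_eq {H : M.CosetL A p q} {F F' : M.L (LFun G A) p q} (h : M.IsTwist H F)
    (h' : M.IsTwist H F') : F = F' := by
  refine AEEqFun.ext ?_
  filter_upwards [h, h'] with X h1 h2
  refine LFun.ext_fn ?_
  filter_upwards [h1, h2] with y h3 h4
  rw [h3, h4]

/-- The twist only gives equality of `H` and `H'` along `cosets`. Pulling this back along the almost
everywhere inverse `θ` gives equality as classes on the tuples. -/
theorem IsTwist.inv_eq_of_eq {H H' : M.CosetL A p q} {F : M.L (LFun G A) p q}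
    (h : M.IsTwist H F) (h' : M.IsTwist H' F) : H = H' := by
  obtain ⟨θ, hθ, -, hc⟩ := M.exists_cosets_inverse p q
  let : MeasurableSpace A := borel A
  have : BorelSpace A := ⟨rfl⟩
  have hm : MeasurableSet {z : M.Γ p q × G | H (M.cosets p q z) = H' (M.cosets p q z)} :=
    measurableSet_eq_fun
      ((AEEqFun.stronglyMeasurable H).measurable.comp (M.qmp_cosets p q).measurable)
      ((AEEqFun.stronglyMeasurable H').measurable.comp (M.qmp_cosets p q).measurable)
  have key : ∀ᵐ z ∂((M.μ p q).prod (Measure.haar : Measure G)),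
      H (M.cosets p q z) = H' (M.cosets p q z) := by
    rw [Measure.ae_prod_iff_ae_ae hm]
    filter_upwards [h, h'] with X h1 h2
    filter_upwards [h1, h2] with y h3 h4
    exact smul_left_cancel y (h3.symm.trans h4)
  refine AEEqFun.ext ?_
  filter_upwards [hθ.ae key, hc] with w h1 h2
  rwa [h2] at h1

theorem exists_isTwist (H : M.CosetL A p q) : ∃ F, M.IsTwist H F := by
  let : MeasurableSpace A := borel A
  have : BorelSpace A := ⟨rfl⟩
  let : MeasurableSpace (LFun G A) := borel (LFun G A)
  have : BorelSpace (LFun G A) := ⟨rfl⟩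
  have hf : StronglyMeasurable fun z : M.Γ p q × G => z.2 • H (M.cosets p q z) :=
    (measurable_snd.smul ((AEEqFun.stronglyMeasurable H).measurable.comp
      (M.qmp_cosets p q).measurable)).stronglyMeasurable
  have hX : ∀ X, AEStronglyMeasurable (fun y => y • H (M.cosets p q (X, y)))
      (Measure.haar : Measure G) := fun X =>
    (hf.comp_measurable measurable_prodMk_left).aestronglyMeasurable
  have hφ : Measurable fun X => LFun.ofFun _ (hX X) :=
    LFun.measurable_of_measurable_fn hf fun X => LFun.fn_ofFun _ (hX X)
  refine ⟨AEEqFun.mk _ hφ.aestronglyMeasurable, ?_⟩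
  filter_upwards [AEEqFun.coeFn_mk _ hφ.aestronglyMeasurable] with X hX'
  rw [hX']
  exact LFun.fn_ofFun _ (hX X)

/-- A jointly measurable evaluation turns `F` into a function of `(X, y)`. It is untwisted by `y⁻¹`
and carried to tuples of cosets by `θ`. -/
theorem exists_isTwist_of_cochain (F : M.L (LFun G A) p q) :
    ∃ H : M.CosetL A p q, M.IsTwist H F := by
  obtain ⟨θ, hθ, hc, -⟩ := M.exists_cosets_inverse p q
  let : MeasurableSpace A := borel A
  have : BorelSpace A := ⟨rfl⟩
  let : MeasurableSpace (LFun G A) := borel (LFun G A)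
  have : BorelSpace (LFun G A) := ⟨rfl⟩
  obtain ⟨ev, hev, hev'⟩ := LFun.exists_measurable_eval G A
  have hm : Measurable fun w => (θ w).2⁻¹ • ev (F (θ w).1, (θ w).2) := by
    have h1 := measurable_fst.comp hθ.measurable
    have h2 := measurable_snd.comp hθ.measurable
    exact h2.inv.smul (hev.measurable.comp
      (((AEEqFun.stronglyMeasurable F).measurable.comp h1).prodMk h2))
  refine ⟨AEEqFun.mk _ hm.aestronglyMeasurable, ?_⟩
  filter_upwards [Measure.ae_ae_of_ae_prod hc, Measure.ae_ae_of_ae_prod ((M.qmp_cosets p q).ae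
    (AEEqFun.coeFn_mk _ hm.aestronglyMeasurable))] with X h1 h2
  filter_upwards [h1, h2, hev' (F X)] with y h3 h4 h5
  rw [h4, h3, smul_inv_smul]
  exact h5.symm

/-- If `x` is the vertex by which the face acts, the action on `L(G, A)` evaluates at `x⁻¹y` and
then applies `x`. The twist contributes `x⁻¹y`, so the total factor is `y` again and the
coefficients on the coset side are untwisted. -/
theorem IsTwist.dHFace {H : M.CosetL A p q} {F : M.L (LFun G A) p q} (h : M.IsTwist H F)
    (i : Fin (q + 2)) : M.IsTwist (M.cosetHFace A i H) (M.dHFace (LFun G A) i F) := by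
  filter_upwards [M.coeFn_dHFace (LFun G A) i F, (M.qmp_faceH i).ae h,
    Measure.ae_ae_of_ae_prod ((M.qmp_cosets p (q + 1)).ae (M.coeFn_cosetHFace i H))]
    with X h1 h2 h3
  rw [h1]
  filter_upwards [LFun.fn_smul (X.1 0 (i.succAbove 0)) (F (M.faceH i X)), h3,
    (measurePreserving_mul_left (Measure.haar : Measure G)
      (X.1 0 (i.succAbove 0))⁻¹).quasiMeasurePreserving.ae h2] with y h4 h5 h6
  rw [h4, h5, h6, M.cosets_faceH i X y, smul_smul, mul_inv_cancel_left]

theorem IsTwist.dVFace {H : M.CosetL A p q} {F : M.L (LFun G A) p q} (h : M.IsTwist H F)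
    (j : Fin (p + 2)) : M.IsTwist (M.cosetVFace A j H) (M.dVFace (LFun G A) j F) := by
  filter_upwards [M.coeFn_dVFace (LFun G A) j F, (M.qmp_faceV j).ae h,
    Measure.ae_ae_of_ae_prod ((M.qmp_cosets (p + 1) q).ae (M.coeFn_cosetVFace j H))]
    with X h1 h2 h3
  rw [h1]
  filter_upwards [LFun.fn_smul (X.1 (j.succAbove 0) 0) (F (M.faceV j X)), h3,
    (measurePreserving_mul_left (Measure.haar : Measure G)
      (X.1 (j.succAbove 0) 0)⁻¹).quasiMeasurePreserving.ae h2] with y h4 h5 h6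
  rw [h4, h5, h6, M.cosets_faceV j X y, smul_smul, mul_inv_cancel_left]

theorem IsTwist.sum_zsmul {ι : Type*} [Countable ι] (s : Finset ι) (c : ι → ℤ)
    {H : ι → M.CosetL A p q} {F : ι → M.L (LFun G A) p q} (h : ∀ i, M.IsTwist (H i) (F i)) :
    M.IsTwist (∑ i ∈ s, c i • H i) (∑ i ∈ s, c i • F i) := by
  filter_upwards [AEEqFun.coeFn_sum_zsmul s c F, ae_all_iff.2 h, Measure.ae_ae_of_ae_prod
    ((M.qmp_cosets p q).ae (AEEqFun.coeFn_sum_zsmul s c H))] with X h1 h2 h3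
  rw [h1]
  have h4 : LFun.fn (∑ i ∈ s, c i • F i X) =ᵐ[(Measure.haar : Measure G)]
      fun y => ∑ i ∈ s, c i • LFun.fn (F i X) y :=
    AEEqFun.coeFn_sum_zsmul (A := A) s c fun i => (F i X : G →ₘ[Measure.haar] A)
  filter_upwards [h4, ae_all_iff.2 h2, h3] with y h5 h6 h7
  rw [h5, h7, Finset.smul_sum]
  refine Finset.sum_congr rfl fun i _ => ?_
  rw [h6, smul_comm]

theorem IsTwist.dH {H : M.CosetL A p q} {F : M.L (LFun G A) p q} (h : M.IsTwist H F) :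
    M.IsTwist (M.cosetH A p q H) (M.dH (LFun G A) p q F) := by
  simp only [cosetH, MatchedPair.dH, AddMonoidHom.finsetSum_apply, AddMonoidHom.smul_apply]
  exact IsTwist.sum_zsmul _ _ fun i => h.dHFace i

theorem IsTwist.dV {H : M.CosetL A p q} {F : M.L (LFun G A) p q} (h : M.IsTwist H F) :
    M.IsTwist (M.cosetV A p q H) (M.dV (LFun G A) p q F) := by
  simp only [cosetV, MatchedPair.dV, AddMonoidHom.finsetSum_apply, AddMonoidHom.smul_apply]
  exact IsTwist.sum_zsmul _ _ fun j => h.dVFace j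

/-- The rows of the double complex of `L(G, A)` are exact in positive degrees. -/
theorem dH_exact (F : M.L (LFun G A) p (q + 1)) (hF : M.dH (LFun G A) p (q + 1) F = 0) :
    ∃ F', M.dH (LFun G A) p q F' = F := by
  obtain ⟨H, hH⟩ := exists_isTwist_of_cochain F
  have h0 := hH.dH
  rw [hF] at h0
  obtain ⟨H', rfl⟩ := M.cosetH_exact H (h0.inv_eq_of_eq isTwist_zero)
  obtain ⟨F', hF'⟩ := exists_isTwist H'
  exact ⟨F', hF'.dH.eq_of_eq hH⟩

/-- The columns of the double complex of `L(G, A)` are exact in positive degrees, and so is their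
subcomplex of horizontal cocycles. -/
theorem dV_exact (F : M.L (LFun G A) (p + 1) q) (hF : M.dV (LFun G A) (p + 1) q F = 0) :
    ∃ F', M.dV (LFun G A) p q F' = F ∧
      (M.dH (LFun G A) (p + 1) q F = 0 → M.dH (LFun G A) p q F' = 0) := by
  obtain ⟨H, hH⟩ := exists_isTwist_of_cochain F
  have h0 := hH.dV
  rw [hF] at h0
  obtain ⟨H', rfl, hH'⟩ := M.cosetV_exact H (h0.inv_eq_of_eq isTwist_zero)
  obtain ⟨F', hF'⟩ := exists_isTwist H'
  refine ⟨F', hF'.dV.eq_of_eq hH, fun h => ?_⟩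
  have h1 := hH.dH
  rw [h] at h1
  have h2 := hF'.dH
  rw [hH' (h1.inv_eq_of_eq isTwist_zero)] at h2
  exact h2.eq_of_eq isTwist_zero

end MatchedPair

end

/-! ### Acyclicity of the total complex and of the mapping cone. -/

noncomputable section

namespace MatchedPair

variable {G : Type u} [Group G] [TopologicalSpace G] [IsTopologicalGroup G]
  [LocallyCompactSpace G] [SecondCountableTopology G] [T2Space G] [MeasurableSpace G] [BorelSpace G]
  (M : MatchedPair G)

section Single

variable {A : Type v} [AddCommGroup A] [TopologicalSpace A] [IsTopologicalAddGroup A]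
  [DistribMulAction G A] [ContinuousSMul G A]

/-- The cochain with the single component `g ∈ L(Γ_{pq}, A)`. -/
def single {n p q : ℕ} (h : p + q = n) (g : M.L A p q) : M.D A n :=
  Pi.single (M := fun x : {x : ℕ × ℕ // x.1 + x.2 = n} => M.L A x.1.1 x.1.2) ⟨(p, q), h⟩ g

theorem single_same {n p q : ℕ} (h h' : p + q = n) (g : M.L A p q) :
    M.single h g ⟨(p, q), h'⟩ = g := Pi.single_eq_same _ _

theorem single_of_ne {n p q p' q' : ℕ} (h : p + q = n) (h' : p' + q' = n) (g : M.L A p q)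
    (hp : p' ≠ p) : M.single h g ⟨(p', q'), h'⟩ = 0 :=
  Pi.single_eq_of_ne (fun e => hp (congrArg (fun x => x.1.1) e)) _

/-- A cocycle that vanishes in the columns before `p` has a horizontal cocycle as its component in
column `p`. -/
theorem dH_eq_zero_of_dD_eq_zero {n p q : ℕ} {F : M.D A n} (hF : M.dD A n F = 0)
    (h0 : ∀ p' q' h, p' < p → F ⟨(p', q'), h⟩ = 0) (h : p + q = n) :
    M.dH A p q (F ⟨(p, q), h⟩) = 0 := by
  have h1 := congrFun hF ⟨(p, q + 1), by omega⟩
  rw [dD_apply] at h1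
  have h2 : M.dVPart A F ⟨(p, q + 1), by omega⟩ = 0 := by
    cases p with
    | zero => rfl
    | succ p =>
      change M.dV A p (q + 1) (F ⟨(p, q + 1), _⟩) = 0
      rw [h0 _ _ _ (Nat.lt_succ_self p), map_zero]
  rw [h2, smul_zero, add_zero] at h1
  exact h1

theorem dVPart_single_of_le {n p q p' q' : ℕ} (h : p + q = n) (h' : p' + q' = n + 1)
    (g : M.L A p q) (hp : p' ≤ p) : M.dVPart A (M.single h g) ⟨(p', q'), h'⟩ = 0 := by
  cases p' with
  | zero => rfl
  | succ p' =>
    change M.dV A p' q' (M.single h g ⟨(p', q'), _⟩) = 0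
    rw [M.single_of_ne _ _ _ (by omega), map_zero]

theorem dHPart_single_of_ne {n p q p' q' : ℕ} (h : p + q = n) (h' : p' + q' = n + 1)
    (g : M.L A p q) (hp : p' ≠ p) : M.dHPart A (M.single h g) ⟨(p', q'), h'⟩ = 0 := by
  cases q' with
  | zero => rfl
  | succ q' =>
    change M.dH A p' q' (M.single h g ⟨(p', q'), _⟩) = 0
    rw [M.single_of_ne _ _ _ hp, map_zero]

end Single

variable {A : Type v} [AddCommGroup A] [TopologicalSpace A] [IsTopologicalAddGroup A]
  [DistribMulAction G A] [ContinuousSMul G A] [PolishSpace A]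

/-- Components are removed in order of increasing `p` by exactness of the rows. This needs `q ≥ 1`,
so it stops before the corner `(n + 1, 0)`. -/
theorem exists_dD_sub_eq_zero_of_lt {n : ℕ} (F : M.D (LFun G A) (n + 1))
    (hF : M.dD (LFun G A) (n + 1) F = 0) (k : ℕ) (hk : k ≤ n + 1) :
    ∃ E : M.D (LFun G A) n, ∀ p q h, p < k → (F - M.dD (LFun G A) n E) ⟨(p, q), h⟩ = 0 := by
  induction k with
  | zero => exact ⟨0, fun p q h hp => absurd hp (Nat.not_lt_zero p)⟩
  | succ k ih =>
    obtain ⟨E, hE⟩ := ih (by omega)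
    obtain ⟨q, rfl⟩ : ∃ q, n = k + q := ⟨n - k, by omega⟩
    have hc : M.dD (LFun G A) (k + q + 1) (F - M.dD (LFun G A) (k + q) E) = 0 := by
      rw [map_sub, hF, dD_dD, sub_zero]
    obtain ⟨g, hg⟩ := dH_exact _ (M.dH_eq_zero_of_dD_eq_zero (p := k) (q := q + 1) hc hE rfl)
    -- The coboundary of a component in bidegree `(k, q)` lies in bidegrees `(k, q + 1)` and `(k +
    -- 1, q)`, so the components already removed stay zero.
    refine ⟨E + M.single rfl g, fun p' q' h hp => ?_⟩
    rw [map_add, ← sub_sub, Pi.sub_apply, M.dD_apply _ (M.single rfl g),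
      M.dVPart_single_of_le _ _ _ (Nat.le_of_lt_succ hp), smul_zero, add_zero]
    rcases Nat.lt_succ_iff_lt_or_eq.1 hp with hp | rfl
    · rw [M.dHPart_single_of_ne _ _ _ hp.ne, hE _ _ _ hp, sub_zero]
    · obtain rfl : q' = q + 1 := by omega
      rw [← hg]
      change _ - M.dH _ p' q (M.single rfl g ⟨(p', q), _⟩) = 0
      rw [single_same, sub_self]

/-- The total complex of `L(G, A)` is acyclic in positive degrees. -/
theorem dD_exact {n : ℕ} (F : M.D (LFun G A) (n + 1)) (hF : M.dD (LFun G A) (n + 1) F = 0) :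
    ∃ E, M.dD (LFun G A) n E = F := by
  obtain ⟨E, hE⟩ := M.exists_dD_sub_eq_zero_of_lt F hF (n + 1) le_rfl
  have hc : M.dD (LFun G A) (n + 1) (F - M.dD (LFun G A) n E) = 0 := by
    rw [map_sub, hF, dD_dD, sub_zero]
  have hV : M.dV (LFun G A) (n + 1) 0 ((F - M.dD (LFun G A) n E) ⟨(n + 1, 0), rfl⟩) = 0 := by
    have h1 := congrFun hc ⟨(n + 2, 0), rfl⟩
    rw [dD_apply] at h1
    simpa [dHPart, dVPart] using h1
  -- The remaining corner is both a vertical and a horizontal cocycle. Its vertical primitive can be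
  -- chosen with `dH g = 0`, so subtracting its coboundary leaves nothing in bidegree `(n, 1)`.
  obtain ⟨g, hg, hg'⟩ := dV_exact _ hV
  have hg0 := hg' (M.dH_eq_zero_of_dD_eq_zero hc hE rfl)
  refine ⟨E + M.single (Nat.add_zero n) g, ?_⟩
  rw [map_add, ← sub_eq_zero, ← neg_eq_zero, neg_sub, ← sub_sub]
  funext ⟨⟨p, q⟩, h⟩
  rw [Pi.sub_apply, M.dD_apply _ (M.single (Nat.add_zero n) g)]
  rcases Nat.lt_or_ge p (n + 1) with hp | hp
  · rw [hE _ _ _ hp, M.dVPart_single_of_le _ _ _ (Nat.le_of_lt_succ hp), smul_zero, add_zero,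
      zero_sub]
    rcases Nat.lt_succ_iff_lt_or_eq.1 hp with hp | rfl
    · rw [M.dHPart_single_of_ne _ _ _ hp.ne, neg_zero]
      rfl
    · obtain rfl : q = 1 := by omega
      change -M.dH _ p 0 (M.single _ g ⟨(p, 0), _⟩) = 0
      rw [single_same, hg0, neg_zero]
  · obtain rfl : p = n + 1 := by omega
    obtain rfl : q = 0 := by omega
    change _ - (0 + (-1 : ℤ) ^ 0 • M.dV _ n 0 (M.single _ g ⟨(n, 0), _⟩)) = 0
    rw [single_same, hg, pow_zero, one_smul, zero_add, sub_self]

/-- The Kac cohomology of `L(G, A)` vanishes in positive degrees. -/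
theorem subsingleton_H_lFun {n : ℕ} (hn : 1 ≤ n) : Subsingleton (M.H (LFun G A) n) := by
  obtain ⟨n, rfl⟩ := Nat.exists_eq_add_of_le' hn
  rw [QuotientAddGroup.subsingleton_iff, AddSubgroup.addSubgroupOf_eq_top]
  rintro ⟨F, H⟩ hz
  have hz' : M.dCone (LFun G A) (n + 1) (F, H) = 0 := hz
  obtain ⟨E, rfl⟩ := M.dD_exact F (congrArg Prod.fst hz')
  -- Once `F = dE`, the difference `H - JE` is a cocycle of `K`, of positive degree because of `hn`.
  -- The two summands of `K` are the column `q = 0` and the row `p = 0` of the double complex, so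
  -- the same exactness applies.
  have hK : M.dK (LFun G A) (n + 1) (H - M.J (LFun G A) (n + 1) E) = 0 := by
    have h1 : -M.dK (LFun G A) (n + 1) H + M.J (LFun G A) (n + 2) (M.dD (LFun G A) (n + 1) E) = 0 :=
      congrArg Prod.snd hz'
    rw [J_dD] at h1
    rw [map_sub, ← neg_eq_zero, ← h1]
    abel
  obtain ⟨H₁, hH₁, -⟩ := dV_exact _ (congrArg Prod.fst hK)
  obtain ⟨H₂, hH₂⟩ := dH_exact _ (congrArg Prod.snd hK)
  -- The sign compensates for `-dK` in the differential of the cone.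
  refine ⟨(E, -(H₁, H₂)), Prod.ext rfl ?_⟩
  have h3 : M.dK (LFun G A) n (H₁, H₂) = H - M.J (LFun G A) (n + 1) E := Prod.ext hH₁ hH₂
  change -M.dK (LFun G A) n (-(H₁, H₂)) + M.J (LFun G A) (n + 1) E = H
  rw [map_neg, neg_neg, h3, sub_add_cancel]

end MatchedPair

end

/-! ### The embedding of `A` in `L(G, A)` and effaceability. -/

noncomputable section

open Filter Topology

namespace LFun

variable {G : Type u} [Group G] [TopologicalSpace G] [IsTopologicalGroup G]
  [LocallyCompactSpace G] [SecondCountableTopology G] [T2Space G] [MeasurableSpace G] [BorelSpace G]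
  {A : Type v} [AddCommGroup A] [TopologicalSpace A] [IsTopologicalAddGroup A]
  [DistribMulAction G A] [ContinuousSMul G A]
  {B : Type w} [AddCommGroup B] [TopologicalSpace B] [IsTopologicalAddGroup B]
  [DistribMulAction G B] [ContinuousSMul G B]

theorem fn_const (a : A) : fn (AEEqFun.const G a : LFun G A) =ᵐ[(Measure.haar : Measure G)]
    fun _ => a := AEEqFun.coeFn_const G a

variable (G A) in
/-- The inclusion of `A` in `L(G, A)` as the constant functions. -/
def constHom : A →+[G] LFun G A where
  toFun a := AEEqFun.const G a
  map_smul' x a := by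
    refine ext_fn ?_
    filter_upwards [fn_const (G := G) (x • a), fn_smul x (AEEqFun.const G a : LFun G A),
      (measurePreserving_mul_left (Measure.haar : Measure G) x⁻¹).quasiMeasurePreserving.ae
        (fn_const (G := G) a)] with y h1 h2 h3
    rw [h1]
    exact (h2.trans (congrArg _ h3)).symm
  map_zero' := rfl
  map_add' _ _ := rfl

theorem fn_constHom (a : A) : fn (constHom G A a) =ᵐ[(Measure.haar : Measure G)] fun _ => a :=
  fn_const a

theorem constHom_injective : Function.Injective (constHom G A) := fun a b h => by
  have h1 := fn_constHom (G := G) a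
  rw [h] at h1
  obtain ⟨y, h2, h3⟩ := (h1.and (fn_constHom (G := G) b)).exists
  exact h2.symm.trans h3

theorem continuous_constHom [PolishSpace A] : Continuous (constHom G A) := by
  refine continuous_iff_seqContinuous.2 fun u a hu => tendsto_of_ae_tendsto ?_
  filter_upwards [fn_constHom (G := G) a, ae_all_iff.2 fun n => fn_constHom (G := G) (u n)]
    with y h1 h2
  simp_rw [Function.comp_apply, h2, h1]
  exact hu

/-- Composition with a continuous `G`-homomorphism. -/
def mapHom (f : A →+[G] B) (hf : Continuous f) : LFun G A →+[G] LFun G B where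
  toFun F := AEEqFun.comp f hf F
  map_smul' x F := by
    refine ext_fn ((AEEqFun.coeFn_comp f hf _).trans ?_)
    filter_upwards [fn_smul x F, fn_smul x (AEEqFun.comp f hf F : LFun G B),
      (measurePreserving_mul_left (Measure.haar : Measure G) x⁻¹).quasiMeasurePreserving.ae
        (AEEqFun.coeFn_comp f hf F)] with y h1 h2 h3
    refine Eq.trans ?_ h2.symm
    change f (fn (x • F) y) = x • AEEqFun.cast (AEEqFun.comp f hf F) (x⁻¹ * y)
    rw [h1, map_smul, h3]
    rfl
  map_zero' := by
    refine ext_fn ((AEEqFun.coeFn_comp f hf _).trans ?_)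
    filter_upwards [fn_zero (G := G) (A := A), fn_zero (G := G) (A := B)] with y h1 h2
    rw [h2]
    exact (congrArg f h1).trans (map_zero f)
  map_add' F H := by
    refine ext_fn ((AEEqFun.coeFn_comp f hf _).trans ?_)
    filter_upwards [fn_add F H, fn_add (AEEqFun.comp f hf F : LFun G B) (AEEqFun.comp f hf H),
      AEEqFun.coeFn_comp f hf F, AEEqFun.coeFn_comp f hf H] with y h1 h2 h3 h4
    refine Eq.trans ?_ (h2.trans (congrArg₂ (· + ·) h3 h4)).symm
    exact (congrArg f h1).trans (map_add f _ _)

theorem fn_mapHom (f : A →+[G] B) (hf : Continuous f) (F : LFun G A) :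
    fn (mapHom f hf F) =ᵐ[(Measure.haar : Measure G)] fun y => f (fn F y) :=
  AEEqFun.coeFn_comp f hf F

theorem continuous_mapHom [PolishSpace A] [PolishSpace B] (f : A →+[G] B) (hf : Continuous f) :
    Continuous (mapHom f hf) := by
  refine continuous_iff_seqContinuous.2 fun u F hu => tendsto_of_subseq fun ns hns => ?_
  obtain ⟨ms, hms, h1⟩ := exists_subseq_ae_tendsto (hu.comp hns)
  refine ⟨ms, ?_⟩
  filter_upwards [h1, fn_mapHom f hf F, ae_all_iff.2 fun n => fn_mapHom f hf (u n)]
    with y h1 h2 h3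
  simp_rw [Function.comp_apply, h3, h2]
  exact (hf.tendsto _).comp h1

variable (G A) in
/-- The map `L(G, A) → L(G, L(G, A))` that takes `b` to the function `y ↦ b - b(y)`. Its kernel
consists of the constant functions. -/
def diff [PolishSpace A] : LFun G A →+[G] LFun G (LFun G A) where
  toFun b := constHom G (LFun G A) b - mapHom (constHom G A) continuous_constHom b
  map_smul' x b := by rw [map_smul, map_smul, MonoidHom.id_apply, smul_sub]
  map_zero' := by rw [map_zero, map_zero, sub_zero]
  map_add' b c := by rw [map_add, map_add]; abel

theorem continuous_diff [PolishSpace A] : Continuous (diff G A) :=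
  continuous_constHom.sub (continuous_mapHom _ _)

theorem fn_diff [PolishSpace A] (b : LFun G A) : fn (diff G A b) =ᵐ[(Measure.haar : Measure G)]
    fun y => b - constHom G A (fn b y) := by
  filter_upwards [fn_sub (constHom G (LFun G A) b) (mapHom (constHom G A) continuous_constHom b),
    fn_constHom (G := G) b, fn_mapHom (constHom G A) continuous_constHom b] with y h1 h2 h3
  rw [← h3]
  exact h1.trans (congrArg (· - _) h2)

/-- If `b - b(y)` vanishes for almost every `y`, a single such `y` shows that `b` is the constant
`b(y)`. -/
theorem exact_constHom_diff [PolishSpace A] : Function.Exact (constHom G A) (diff G A) := by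
  refine fun b => ⟨fun h => ?_, ?_⟩
  · have h1 := fn_diff b
    rw [h] at h1
    obtain ⟨y, h2, h3⟩ := (h1.and (fn_zero (G := G) (A := LFun G A))).exists
    exact ⟨fn b y, (sub_eq_zero.1 (h2.symm.trans h3)).symm⟩
  · rintro ⟨a, rfl⟩
    refine ext_fn ?_
    filter_upwards [fn_diff (constHom G A a), fn_constHom (G := G) a,
      fn_zero (G := G) (A := LFun G A)] with y h1 h2 h3
    rw [h1, h2, h3, sub_self]

variable (G A) in
/-- The map `L(G, L(G, A)) → L(G, L(G, L(G, A)))` that takes `H` to the function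
`(y, z) ↦ H(z) - H(y) + H(y)(z)`. Its kernel is the image of `diff`. -/
def diff₂ [PolishSpace A] : LFun G (LFun G A) →+[G] LFun G (LFun G (LFun G A)) where
  toFun H := diff G (LFun G A) H + mapHom (mapHom (constHom G A) continuous_constHom)
    (continuous_mapHom _ _) H
  map_smul' x H := by rw [map_smul, map_smul, MonoidHom.id_apply, smul_add]
  map_zero' := by rw [map_zero, map_zero, add_zero]
  map_add' H K := by rw [map_add, map_add]; abel

theorem continuous_diff₂ [PolishSpace A] : Continuous (diff₂ G A) :=
  continuous_diff.add (continuous_mapHom _ _)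

theorem fn_diff₂ [PolishSpace A] (H : LFun G (LFun G A)) :
    ∀ᵐ y ∂(Measure.haar : Measure G), ∀ᵐ z ∂(Measure.haar : Measure G),
      fn (fn (diff₂ G A H) y) z = fn H z - fn H y + constHom G A (fn (fn H y) z) := by
  filter_upwards [fn_add (diff G (LFun G A) H) (mapHom (mapHom (constHom G A) continuous_constHom)
    (continuous_mapHom _ _) H), fn_diff H, fn_mapHom (mapHom (constHom G A) continuous_constHom)
    (continuous_mapHom _ _) H] with y h1 h2 h3
  rw [h2, h3] at h1
  have h4 : fn (diff₂ G A H) y = H - constHom G (LFun G A) (fn H y)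
    + mapHom (constHom G A) continuous_constHom (fn H y) := h1
  rw [h4]
  filter_upwards [fn_add (H - constHom G (LFun G A) (fn H y))
    (mapHom (constHom G A) continuous_constHom (fn H y)),
    fn_sub H (constHom G (LFun G A) (fn H y)), fn_constHom (G := G) (fn H y),
    fn_mapHom (constHom G A) continuous_constHom (fn H y)] with z h5 h6 h7 h8
  rw [h5, h6, h7, h8]

/-- For a generic `y` put `b = H(y)`. The vanishing of `diff₂ H` at `(y, z)` then says `H(z) = b -
b(z)` for almost every `z`, which is `H = diff b`. -/
theorem exact_diff_diff₂ [PolishSpace A] : Function.Exact (diff G A) (diff₂ G A) := by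
  refine fun H => ⟨fun h => ?_, ?_⟩
  · have h1 := fn_diff₂ H
    rw [h] at h1
    obtain ⟨y, h2, h3⟩ := (h1.and (fn_zero (G := G) (A := LFun G (LFun G A)))).exists
    rw [h3] at h2
    refine ⟨fn H y, ext_fn ?_⟩
    filter_upwards [h2, fn_zero (G := G) (A := LFun G A), fn_diff (fn H y)] with z h4 h5 h6
    rw [h4] at h5
    rw [h6, sub_eq_iff_eq_add, ← sub_eq_zero, ← neg_eq_zero, ← h5]
    abel
  · rintro ⟨b, rfl⟩
    refine ext_fn ?_
    filter_upwards [fn_diff₂ (diff G A b), fn_diff b, fn_zero (G := G) (A := LFun G (LFun G A))]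
      with y h1 h2 h3
    rw [h3]
    refine ext_fn ?_
    rw [h2] at h1
    filter_upwards [h1, fn_diff b, fn_sub b (constHom G A (fn b y)), fn_constHom (G := G) (fn b y),
      fn_zero (G := G) (A := LFun G A)] with z h4 h5 h6 h7 h8
    rw [h4, h5, h6, h7, h8, map_sub]
    abel

end LFun

namespace PolishGModule

variable {G : Type u} [Group G] [TopologicalSpace G]

/-- The kernel of a continuous `G`-homomorphism of Polish `G`-modules. -/
def ker {A B : PolishGModule.{u, w} G} (f : A.carrier →+[G] B.carrier) (hf : Continuous f) :
    PolishGModule.{u, w} G :=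
  letI : SMul G f.toAddMonoidHom.ker :=
    ⟨fun x a => ⟨x • a.1, by
      have h : f a.1 = 0 := a.2
      change f (x • a.1) = 0
      rw [map_smul, h, smul_zero]⟩⟩
  { carrier := f.toAddMonoidHom.ker
    isTopologicalAddGroup := topologicalAddGroup_induced f.toAddMonoidHom.ker.subtype
    polishSpace := (isClosed_singleton.preimage hf : IsClosed (f ⁻¹' {0})).polishSpace
    distribMulAction := Function.Injective.distribMulAction f.toAddMonoidHom.ker.subtype
      Subtype.val_injective fun _ _ => rfl
    continuousSMul := ⟨Continuous.subtype_mk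
      (continuous_fst.smul (continuous_subtype_val.comp continuous_snd)) _⟩ }

end PolishGModule

namespace MatchedPair

variable {G : Type u} [Group G] [TopologicalSpace G] [IsTopologicalGroup G]
  [LocallyCompactSpace G] [SecondCountableTopology G] [T2Space G] [MeasurableSpace G] [BorelSpace G]

/-- A Polish `G`-module `A` is the kernel of a quotient map of `L(G, A)`. -/
theorem exists_shortExact_lFun (A : PolishGModule.{u, max u v} G) :
    ∃ C : PolishGModule.{u, max u v} G,
      Nonempty (PolishGModule.ShortExact A ⟨LFun G A.carrier⟩ C) := by
  -- The cokernel of `A → L(G, A)` is taken to be the kernel of `diff₂`, which equals the image of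
  -- `diff`. As a closed subgroup it is Polish, and no quotient topology has to be considered.
  let B : PolishGModule.{u, max u v} G := ⟨LFun G (LFun G A.carrier)⟩
  let B' : PolishGModule.{u, max u v} G := ⟨LFun G (LFun G (LFun G A.carrier))⟩
  let f : B.carrier →+[G] B'.carrier := LFun.diff₂ G A.carrier
  have hmem : ∀ b, LFun.diff G A.carrier b ∈ f.toAddMonoidHom.ker := fun b =>
    LFun.exact_diff_diff₂.apply_apply_eq_zero b
  refine ⟨PolishGModule.ker f LFun.continuous_diff₂, ⟨⟨LFun.constHom G A.carrier,
    { toFun := fun b => (⟨LFun.diff G A.carrier b, hmem b⟩ :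
        (PolishGModule.ker f LFun.continuous_diff₂).carrier)
      map_smul' := fun x b => Subtype.ext (map_smul (LFun.diff G A.carrier) x b)
      map_zero' := Subtype.ext (map_zero (LFun.diff G A.carrier))
      map_add' := fun b c => Subtype.ext (map_add (LFun.diff G A.carrier) b c) },
    LFun.continuous_constHom, Continuous.subtype_mk LFun.continuous_diff _,
    LFun.constHom_injective, fun b => ?_, ?_⟩⟩⟩
  · exact Subtype.ext_iff.trans (LFun.exact_constHom_diff b)
  · rintro ⟨H, hH⟩
    obtain ⟨b, rfl⟩ := (LFun.exact_diff_diff₂ H).1 hH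
    exact ⟨b, rfl⟩

variable (M : MatchedPair G)

theorem isEffaceable : IsEffaceable.{u, max u v} M := fun A n hn α => by
  obtain ⟨C, ⟨S⟩⟩ := exists_shortExact_lFun.{u, v} A
  have := M.subsingleton_H_lFun (A := A.carrier) hn
  exact ⟨⟨LFun G A.carrier⟩, C, S, Subsingleton.elim _ _⟩

end MatchedPair

end

/-- Effaceability is asserted in the universe `max u v` because `L(G, A)` must lie in the same
universe as `A`. -/
theorem mainTheorem9 {G : Type u} [Group G] [TopologicalSpace G] [IsTopologicalGroup G]
    [LocallyCompactSpace G] [SecondCountableTopology G] [T2Space G] [MeasurableSpace G]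
    [BorelSpace G] (M : MatchedPair G) :
    (∀ (A : Type v) [AddCommGroup A] [TopologicalSpace A] [PolishSpace A]
        [IsTopologicalAddGroup A] [DistribMulAction G A] [ContinuousSMul G A],
      ∃ (_ : PolishSpace (LFun G A)) (_ : IsTopologicalAddGroup (LFun G A))
        (_ : ContinuousSMul G (LFun G A)),
        ∀ n : ℕ, 1 ≤ n → Subsingleton (M.H (LFun G A) n)) ∧
      MatchedPair.HasNaturalLongExactSequences.{u, v} M ∧
      MatchedPair.IsEffaceable.{u, max u v} M :=
  ⟨fun _ => ⟨inferInstance, inferInstance, inferInstance, fun _ hn => M.subsingleton_H_lFun hn⟩,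
    M.hasNaturalLongExactSequences, M.isEffaceable⟩
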